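/- Let $n \ge 0$ and $I = \{1,\dots,n\}$, and let $\mathsf{N_C}$, $\mathsf{N_R}$ be disjoint countably infinite sets of concept names and role names. The $\mathit{ML}^n_{\mathcal{ALC}}$ concepts and formulas are given by $$C ::= A \mid \lnot C \mid C \sqcap C \mid \exists r.C \mid \Box_i C, \qquad \varphi ::= C \sqsubseteq D \mid \lnot\varphi \mid \varphi\land\varphi \mid \Box_i\varphi,$$ with $A\in\mathsf{N_C}$, $r\in\mathsf{N_R}$, $i\in I$. A neighbourhood frame is a pair $\mathcal F=(\mathcal W,\{\mathcal N_i\}_{i\in I})$ with $\mathcal W\neq\emptyset$ and $\mathcal N_i:\mathcal W\to 2^{2^{\mathcal W}}$. It is supplemented if $\alpha\in\mathcal N_i(w)$ and $\alpha\subseteq\beta\subseteq\mathcal W$ imply $\beta\in\mathcal N_i(w)$; closed under intersection if $\alpha,\beta\in\mathcal N_i(w)$ implies $\alpha\cap\beta\in\mathcal N_i(w)$; and it contains the unit if $\mathcal W\in\mathcal N_i(w)$ (in each case for all $i\in I$, $w\in\mathcal W$). A varying domain neighbourhood model based on $\mathcal F$ assigns to every $w\in\mathcal W$ an interpretation with a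 non-empty domain $\Delta_w$ (the sets $\Delta_w$ may differ and may overlap), sets $A^{\mathcal I_w}\subseteq\Delta_w$ and relations $r^{\mathcal I_w}\subseteq\Delta_w\times\Delta_w$. Concepts are interpreted by $(\lnot C)^{\mathcal I_w}=\Delta_w\setminus C^{\mathcal I_w}$, $(C\sqcap D)^{\mathcal I_w}=C^{\mathcal I_w}\cap D^{\mathcal I_w}$, $(\exists r.C)^{\mathcal I_w}=\{d\in\Delta_w\mid \exists e\in C^{\mathcal I_w}:(d,e)\in r^{\mathcal I_w}\}$ and $(\Box_i C)^{\mathcal I_w}=\{d\in\Delta_w\mid\{v\in\mathcal W\mid d\in C^{\mathcal I_v}\}\in\mathcal N_i(w)\}$. Formulas are satisfied at worlds as follows: $C\sqsubseteq D$ holds at $w$ iff $C^{\mathcal I_w}\subseteq D^{\mathcal I_w}$; $\lnot$ and $\land$ are Boolean; $\Box_i\varphi$ holds at $w$ iff the set of worlds at which $\varphi$ holds belongs to $\mathcal N_i(w)$. For $\mathbf L\in\{\mathbf E,\mathbf M,\mathbf C,\mathbf N\}$, the $\mathbf L^n_{\mathcal{ALC}}$ formula satisfiability problem on varying domain neighbourhood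 models is to decide whether a given $\mathit{ML}^n_{\mathcal{ALC}}$ formula holds at some world of some varying domain neighbourhood model based on a frame that is: arbitrary, for $\mathbf L=\mathbf E$; supplemented, for $\mathbf L=\mathbf M$; closed under intersection, for $\mathbf L=\mathbf C$; containing the unit, for $\mathbf L=\mathbf N$. **Theorem.** For every $n$ and every $\mathbf L\in\{\mathbf E,\mathbf M,\mathbf C,\mathbf N\}$, the $\mathbf L^n_{\mathcal{ALC}}$ formula satisfiability problem on varying domain neighbourhood models is decidable in $\textsc{NExpTime}$: there are a nondeterministic Turing machine and a polynomial $p$ such that, on every input word $x$, all computations of the machine halt after at most $2^{p(|x|)}$ steps, and some computation accepts if and only if $x$ is the code (over a fixed finite alphabet, with names written in binary) of a satisfiable formula. -/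

import Mathlib

/-! ### Syntax of the modal description logic `ML^n_ALC` -/

namespace MLALC

/-- Concept names: a fixed countably infinite set, here the words over `{0, 1}`. -/
abbrev ConceptName : Type := List Bool

/-- Role names: a fixed countably infinite set, here the words over `{0, 1}`.
Concept names and role names occur at different places of an expression, so the two sorts are
never confused. -/
abbrev RoleName : Type := List Bool

/-- `ML^n_ALC` concepts, `C ::= A | ¬ C | C ⊓ C | ∃ r. C | □_i C`. -/
inductive Concept (n : ℕ) : Type
  | name (A : ConceptName) : Concept n
  | neg (C : Concept n) : Concept n
  | inter (C D : Concept n) : Concept n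
  | ex (r : RoleName) (C : Concept n) : Concept n
  | box (i : Fin n) (C : Concept n) : Concept n

/-- `ML^n_ALC` formulas, `φ ::= C ⊑ D | ¬ φ | φ ∧ φ | □_i φ`. -/
inductive Formula (n : ℕ) : Type
  | incl (C D : Concept n) : Formula n
  | neg (φ : Formula n) : Formula n
  | and (φ ψ : Formula n) : Formula n
  | box (i : Fin n) (φ : Formula n) : Formula n

/-! ### Neighbourhood semantics with varying domains -/

/-- A neighbourhood frame: a non-empty set of worlds with `n` neighbourhood functions. -/
structure Frame (n : ℕ) where
  World : Type
  nonempty_world : Nonempty World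
  nbhd : Fin n → World → Set (Set World)

/-- Supplemented frames: neighbourhoods are closed under supersets. -/
def Frame.Supplemented {n : ℕ} (F : Frame n) : Prop :=
  ∀ (i : Fin n) (w : F.World) (α β : Set F.World), α ∈ F.nbhd i w → α ⊆ β → β ∈ F.nbhd i w

/-- Frames closed under (binary) intersection. -/
def Frame.ClosedUnderInter {n : ℕ} (F : Frame n) : Prop :=
  ∀ (i : Fin n) (w : F.World) (α β : Set F.World),
    α ∈ F.nbhd i w → β ∈ F.nbhd i w → α ∩ β ∈ F.nbhd i w

/-- Frames that contain the unit. -/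
def Frame.ContainsUnit {n : ℕ} (F : Frame n) : Prop :=
  ∀ (i : Fin n) (w : F.World), Set.univ ∈ F.nbhd i w

/-- The four systems `E`, `M`, `C`, `N`. -/
inductive Log : Type
  | E
  | M
  | C
  | N

/-- The class of frames of each of the four systems. -/
def Log.frameClass (L : Log) {n : ℕ} (F : Frame n) : Prop :=
  match L with
  | Log.E => True
  | Log.M => F.Supplemented
  | Log.C => F.ClosedUnderInter
  | Log.N => F.ContainsUnit

/-- A varying domain neighbourhood model based on the frame `F`. Every world `w` carries an ALC
interpretation with a non-empty domain `dom w`; the domains are arbitrary subsets of a common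
universe `Obj` of objects and may or may not overlap. -/
structure Model {n : ℕ} (F : Frame n) where
  Obj : Type
  dom : F.World → Set Obj
  dom_nonempty : ∀ w, (dom w).Nonempty
  conceptInt : F.World → ConceptName → Set Obj
  conceptInt_subset : ∀ w A, conceptInt w A ⊆ dom w
  roleInt : F.World → RoleName → Set (Obj × Obj)
  roleInt_subset : ∀ w r, roleInt w r ⊆ dom w ×ˢ dom w

/-- The interpretation of a concept at a world. In the clause for `□_i C` the set
`{v | d ∈ C^{I_v}}` is the truth set of `C` with respect to `d`. -/
def Model.interp {n : ℕ} {F : Frame n} (𝔐 : Model F) : Concept n → F.World → Set 𝔐.Obj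
  | .name A, w => 𝔐.conceptInt w A
  | .neg C, w => 𝔐.dom w \ 𝔐.interp C w
  | .inter C D, w => 𝔐.interp C w ∩ 𝔐.interp D w
  | .ex r C, w => {d | d ∈ 𝔐.dom w ∧ ∃ e ∈ 𝔐.interp C w, (d, e) ∈ 𝔐.roleInt w r}
  | .box i C, w => {d | d ∈ 𝔐.dom w ∧ {v | d ∈ 𝔐.interp C v} ∈ F.nbhd i w}

/-- Satisfaction of a formula at a world. In the clause for `□_i φ` the set `{v | 𝔐, v ⊨ φ}` is
the truth set of `φ`. -/
def Model.Sat {n : ℕ} {F : Frame n} (𝔐 : Model F) : Formula n → F.World → Prop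
  | .incl C D, w => 𝔐.interp C w ⊆ 𝔐.interp D w
  | .neg φ, w => ¬ 𝔐.Sat φ w
  | .and φ ψ, w => 𝔐.Sat φ w ∧ 𝔐.Sat ψ w
  | .box i φ, w => {v | 𝔐.Sat φ v} ∈ F.nbhd i w

/-- `φ` is satisfied at some world of some varying domain neighbourhood model that is based on a
frame in the class of `L`. -/
def Formula.Satisfiable {n : ℕ} (L : Log) (φ : Formula n) : Prop :=
  ∃ F : Frame n, L.frameClass F ∧ ∃ (𝔐 : Model F) (w : F.World), 𝔐.Sat φ w

/-! ### Formulas as words over a finite alphabet -/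

/-- The finite alphabet in which concepts and formulas are written. -/
inductive Letter (n : ℕ) : Type
  | bit (b : Bool) : Letter n
  | endName : Letter n
  | cName : Letter n
  | cNeg : Letter n
  | cInter : Letter n
  | cEx : Letter n
  | cBox (i : Fin n) : Letter n
  | fIncl : Letter n
  | fNeg : Letter n
  | fAnd : Letter n
  | fBox (i : Fin n) : Letter n

/-- A name is written as its bits followed by an end marker. -/
def encodeName (n : ℕ) (a : List Bool) : List (Letter n) :=
  a.map Letter.bit ++ [Letter.endName]

/-- Concepts are written in prefix (Polish) notation. -/
def Concept.encode {n : ℕ} : Concept n → List (Letter n)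
  | .name A => Letter.cName :: encodeName n A
  | .neg C => Letter.cNeg :: C.encode
  | .inter C D => Letter.cInter :: (C.encode ++ D.encode)
  | .ex r C => Letter.cEx :: (encodeName n r ++ C.encode)
  | .box i C => Letter.cBox i :: C.encode

/-- Formulas are written in prefix (Polish) notation. -/
def Formula.encode {n : ℕ} : Formula n → List (Letter n)
  | .incl C D => Letter.fIncl :: (C.encode ++ D.encode)
  | .neg φ => Letter.fNeg :: φ.encode
  | .and φ ψ => Letter.fAnd :: (φ.encode ++ ψ.encode)
  | .box i φ => Letter.fBox i :: φ.encode

/-- The `L^n_ALC` formula satisfiability problem on varying domain neighbourhood models, as a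
language: the set of all codes of satisfiable formulas. -/
def satProblem (L : Log) (n : ℕ) : Language (Letter n) :=
  {x | ∃ φ : Formula n, φ.Satisfiable L ∧ φ.encode = x}

end MLALC

/-! ### Nondeterministic Turing machines and the class `NExpTime` -/

/-- A nondeterministic Turing machine with finitely many two-way infinite tapes, for inputs over
the alphabet `σ`. The blank symbol is `default : Symb`. In state `q`, reading the symbols `s k` on
the tapes `k`, the machine may perform any of the actions in `trans q s`; an action consists of a
new state and, for every tape, a symbol to write and a head movement (`none`: the head stays). -/
structure NTM (σ : Type) where
  State : Type
  finite_state : Finite State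
  Symb : Type
  finite_symb : Finite Symb
  inhabited_symb : Inhabited Symb
  TapeIdx : Type
  finite_tapeIdx : Finite TapeIdx
  decEq_tapeIdx : DecidableEq TapeIdx
  inputTape : TapeIdx
  inputSymb : σ ↪ Symb
  inputSymb_ne_blank : ∀ a, inputSymb a ≠ default
  start : State
  accept : Set State
  trans : State → (TapeIdx → Symb) → Set (State × (TapeIdx → Symb × Option Turing.Dir))

namespace NTM

attribute [instance] NTM.finite_state NTM.finite_symb NTM.inhabited_symb NTM.finite_tapeIdx
  NTM.decEq_tapeIdx

variable {σ : Type}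

/-- Configurations: the current state, and the contents and head positions of all tapes. -/
structure Cfg (M : NTM σ) where
  state : M.State
  tape : M.TapeIdx → Turing.Tape M.Symb

/-- The initial configuration: the input tape holds the input word, with the head on its first
letter; all other tapes are blank. -/
def init (M : NTM σ) (x : List σ) : M.Cfg where
  state := M.start
  tape k := if k = M.inputTape then Turing.Tape.mk₁ (x.map M.inputSymb) else Turing.Tape.mk₁ []

/-- The effect of one action on one tape: write, then move. -/
def actTape (M : NTM σ) (T : Turing.Tape M.Symb) (a : M.Symb × Option Turing.Dir) :
    Turing.Tape M.Symb :=
  match a.2 with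
  | none => T.write a.1
  | some d => (T.write a.1).move d

/-- One step of computation. -/
def Step (M : NTM σ) (c c' : M.Cfg) : Prop :=
  ∃ a ∈ M.trans c.state (fun k => (c.tape k).head),
    c' = ⟨a.1, fun k => M.actTape (c.tape k) (a.2 k)⟩

/-- `M.Run m c c'`: some computation of exactly `m` steps leads from `c` to `c'`. -/
inductive Run (M : NTM σ) : ℕ → M.Cfg → M.Cfg → Prop
  | refl (c : M.Cfg) : Run M 0 c c
  | tail {m : ℕ} {c d e : M.Cfg} (h : Run M m c d) (hs : M.Step d e) : Run M (m + 1) c e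

/-- A configuration is halting if no step is possible. -/
def Halting (M : NTM σ) (c : M.Cfg) : Prop := ∀ c', ¬ M.Step c c'

/-- `M` accepts `x` if some computation on `x` halts in an accepting state. -/
def Accepts (M : NTM σ) (x : List σ) : Prop :=
  ∃ (m : ℕ) (c : M.Cfg), M.Run m (M.init x) c ∧ M.Halting c ∧ c.state ∈ M.accept

/-- `M` decides the language `A` in time `T`: on every input `x`, every computation makes at most
`T |x|` steps (so all computations halt), and some computation accepts iff `x ∈ A`. -/
def DecidesInTime (M : NTM σ) (A : Language σ) (T : ℕ → ℕ) : Prop :=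
  ∀ x : List σ,
    (∀ (m : ℕ) (c : M.Cfg), M.Run m (M.init x) c → m ≤ T x.length) ∧ (M.Accepts x ↔ x ∈ A)

end NTM

/-- `NExpTime`: the languages decided by a nondeterministic Turing machine in time `2 ^ p(|x|)`
for some polynomial `p`. -/
def NExpTime (σ : Type) : Set (Language σ) :=
  {A | ∃ (M : NTM σ) (p : Polynomial ℕ), M.DecidesInTime A (fun m => 2 ^ p.eval m)}

/-!
Satisfiability of a formula `φ` is reduced to the existence of a set of *blocks*, words of the
length of the code of `φ` over a fixed finite alphabet, that has to be closed under conditions on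
pairs of its members. There are only exponentially many blocks, and the conditions can be tested by
a pushdown automaton that scans the input and a bounded number of blocks synchronously. So a machine
can guess the set and test all pairs in exponential time.

*Quasimodels.* A type is a truth assignment to the positions of `φ`, together with a modal depth and
the identity of a world; it stands for an object at a world. A quasimodel (`Quasi`) is a set of types
with the witnesses that are needed: an element for an existential restriction that is true or an
inclusion that is false, a type in which two boxed expressions differ if one box is true and the
other one is false, and so on. The point is that, with varying domains, the box conditions of
different objects hardly interact. In the model of a quasimodel (`Quasi.satisfiable`) the worlds form
a tree, and most children of a world contain at most one of its objects. Truth sets of different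
objects are therefore different unless they are empty, and boxed formulas behave like boxed concepts
with respect to a fictitious object that exists everywhere. Whether the empty set is a neighbourhood
has to be agreed upon by all objects of a world. For `C` one needs, in addition, a child that
contains all objects, so that the intersection of the neighbourhoods of different objects is not
empty if the empty set is not a neighbourhood; for this purpose a quasimodel tells to which world
the objects move (`Quasi.tgt`). Conversely, every model gives a quasimodel
(`Formula.Satisfiable.exists_quasi`): a world is selected for every realized truth assignment, and
these worlds are continued by short sequences of moves as above, so that the identity of a world can
be written down as a word of the length of `φ` over a finite alphabet.

*Blocks.* A block is a type written as a word of cells (`MLALC.Cell`), with auxiliary tracks that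
make all conditions local. The Boolean conditions are tested by a pushdown automaton that parses `φ`
from right to left (`MLALC.accepts_locPDA_iff`); all other conditions concern a fixed number of
blocks, one or two marked positions, one name and the row of a relation between positions, which are
supplied by the second of the two blocks of the pair (`MLALC.accepts_testPDA_iff`). Thus `φ` is
satisfiable if and only if some nonempty set of blocks is closed (`MLALC.Formula.satisfiable_iff`).

*The machine.* The machine of `NTM.mem_NExpTime_of_sweep` writes a list of blocks, the same on
several tapes, and for every pair of blocks in the list it chooses further blocks and simulates the
automaton. It accepts exactly the right words, but has infinite runs, since the list may become
arbitrarily long. A clock, which is a counter on another tape, stops it after exponentially many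
steps (`NTM.mem_NExpTime_of_bounded_accept`).
-/

/-! ### Clocked machines -/

namespace NTM
open Turing

variable {σ : Type}

/-- The tape with the word `p` (read backwards) to the left of the head and with the word `f`
under and to the right of the head. -/
def zipTape {Γ : Type} [Inhabited Γ] (p f : List Γ) : Tape Γ :=
  Tape.mk' (ListBlank.mk p) (ListBlank.mk f)

section zipTape
variable {Γ : Type} [Inhabited Γ]

theorem zipTape_head (p f : List Γ) : (zipTape p f).head = f.headI := by
  simp [zipTape]

theorem listBlank_singleton : ListBlank.mk [(default : Γ)] = ListBlank.mk [] :=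
  Quotient.sound (Or.inr ⟨1, by simp⟩)

theorem zipTape_write_right (p f : List Γ) (b : Γ) :
    ((zipTape p f).write b).move Dir.right = zipTape (b :: p) f.tail := by
  cases f <;> simp [zipTape]

theorem zipTape_cons_left (p f : List Γ) (a : Γ) :
    (zipTape (a :: p) f).move Dir.left = zipTape p (a :: f) := by
  simp [zipTape]

theorem zipTape_cons_right (p f : List Γ) (a : Γ) :
    (zipTape p (a :: f)).move Dir.right = zipTape (a :: p) f := by
  simp [zipTape]

theorem zipTape_write_head (p f : List Γ) : (zipTape p f).write f.headI = zipTape p f := by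
  conv_rhs => rw [← Tape.write_self (zipTape p f), zipTape_head]

theorem zipTape_left_head (p f : List Γ) :
    ((zipTape p f).move Dir.left).head = p.headI := by
  cases p <;> simp [zipTape]

theorem zipTape_write (p f : List Γ) (a b : Γ) :
    (zipTape p (a :: f)).write b = zipTape p (b :: f) := by
  simp [zipTape]

end zipTape

/-- The states of a clocked machine: reading the input once while the counter is written, going
back to the start of the input, and running the given machine together with the counter. The
Boolean tells whether the counter head is on its way back to the right end. -/
inductive ClkState (S : Type) : Type
  | scan
  | rewind
  | run (s : S) (r : Bool)

instance {S : Type} [Finite S] : Finite (ClkState S) :=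
  Finite.of_injective
    (fun q : ClkState S => match q with
      | .scan => (none : Option (Option (S × Bool)))
      | .rewind => some none
      | .run s r => some (some (s, r)))
    (by rintro (_ | _ | _) (_ | _ | _) <;> simp)

/-- The moves of the counter. Going left, it passes the digits `0` until it can decrease a digit;
then it sets all digits to the right of this digit to the greatest digit. It is stuck when all
digits are `0`. -/
inductive ClkAct {Γ : Type} [Inhabited Γ] {b : ℕ} (dig : Fin (b + 1) → Γ) :
    Bool → Γ → Bool → Γ → Dir → Prop
  | skip : ClkAct dig false (dig 0) false (dig 0) Dir.left
  | dec (d : Fin b) : ClkAct dig false (dig d.succ) true (dig d.castSucc) Dir.right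
  | fill (s : Γ) (h : s ≠ default) : ClkAct dig true s true (dig (Fin.last b)) Dir.right
  | turn : ClkAct dig true default false default Dir.left

/-- The number with the given digits in base `b + 1`, least significant digit first. -/
def digitVal {b : ℕ} : List (Fin (b + 1)) → ℕ
  | [] => 0
  | d :: l => d.1 + (b + 1) * digitVal l

theorem digitVal_lt {b : ℕ} : ∀ l : List (Fin (b + 1)), digitVal l < (b + 1) ^ l.length
  | [] => by simp [digitVal]
  | d :: l => by
    have h := digitVal_lt l
    have hd := d.2
    simp only [digitVal, List.length_cons, pow_succ]
    nlinarith

theorem digitVal_replicate {b : ℕ} (m : ℕ) :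
    digitVal (List.replicate m (Fin.last b)) + 1 = (b + 1) ^ m := by
  induction m with
  | zero => simp [digitVal]
  | succ m ih =>
    simp only [List.replicate_succ, digitVal, Fin.val_last, pow_succ, ← ih]
    ring

/-- The counter tape: the cells in `z` are those to the right of the digits in `l`. -/
def clkTape {Γ : Type} [Inhabited Γ] {b : ℕ} (dig : Fin (b + 1) → Γ) (r : Bool)
    (l : List (Fin (b + 1))) (z : List Γ) : Tape Γ :=
  if r then zipTape (l.map dig) z else (zipTape (l.map dig) z).move Dir.left

/-- The value of the counter. The digits to the right of the head count as `0` on the way to the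
left, and as the greatest digit on the way to the right. -/
def clkVal {b : ℕ} (r : Bool) (l : List (Fin (b + 1))) (j : ℕ) : ℕ :=
  if r then (digitVal l + 1) * (b + 1) ^ j - 1 else digitVal l * (b + 1) ^ j

/-- The number of moves before the counter has to change its value or its direction. -/
def clkExtra (r : Bool) (a j : ℕ) : ℕ := if r then a + j + 2 + j else a

theorem clkVal_lt {b : ℕ} (r : Bool) (l : List (Fin (b + 1))) (j : ℕ) :
    clkVal r l j < (b + 1) ^ (l.length + j) := by
  have h := digitVal_lt l
  have hj : 0 < (b + 1) ^ j := by positivity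
  cases r
  · simp only [clkVal, pow_add]
    simpa using Nat.mul_lt_mul_of_pos_right h hj
  · simp only [clkVal, pow_add, if_true]
    have h1 := Nat.mul_le_mul_right ((b + 1) ^ j) (Nat.succ_le_of_lt h)
    have h2 : 0 < (digitVal l + 1) * (b + 1) ^ j := by positivity
    simp only [Nat.succ_eq_add_one] at h1
    omega

/-- A move of the counter decreases its value by one, or leaves the value unchanged and decreases
the number of the remaining moves of this kind. -/
theorem clk_step {Γ : Type} [Inhabited Γ] {b : ℕ} {dig : Fin (b + 1) → Γ}
    (hinj : Function.Injective dig) (hne : ∀ d, dig d ≠ default) {r r' : Bool}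
    {l : List (Fin (b + 1))} {z : List Γ} (hz : ∀ a ∈ z, a ≠ default) {s' : Γ} {d : Dir}
    (h : ClkAct dig r (clkTape dig r l z).head r' s' d) :
    ∃ (l' : List (Fin (b + 1))) (z' : List Γ),
      ((clkTape dig r l z).write s').move d = clkTape dig r' l' z' ∧ (∀ a ∈ z', a ≠ default) ∧
      l'.length + z'.length = l.length + z.length ∧
      clkVal r l z.length ≤ clkVal r' l' z'.length + 1 ∧
      (clkVal r' l' z'.length + 1 = clkVal r l z.length ∨
        clkVal r' l' z'.length = clkVal r l z.length ∧
          clkExtra r' l'.length z'.length < clkExtra r l.length z.length) := by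
  generalize hs : (clkTape dig r l z).head = s at h
  cases h with
  | skip =>
    cases l with
    | nil => simp [clkTape, zipTape_left_head] at hs; exact absurd hs.symm (hne 0)
    | cons a l =>
      have ha : a = 0 := hinj (by simpa [clkTape, zipTape_left_head] using hs)
      subst ha
      refine ⟨l, dig 0 :: z, ?_, ?_, ?_, ?_, ?_⟩
      · simp [clkTape, zipTape_cons_left, zipTape_write]
      · intro a ha
        rcases List.mem_cons.1 ha with rfl | ha
        · exact hne 0
        · exact hz a ha
      · simp only [List.length_cons]; omega
      · simp [clkVal, digitVal, pow_succ]; nlinarith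
      · right
        simp [clkVal, digitVal, pow_succ, clkExtra]; ring
  | dec e =>
    cases l with
    | nil => simp [clkTape, zipTape_left_head] at hs; exact absurd hs.symm (hne _)
    | cons a l =>
      have ha : a = e.succ := hinj (by simpa [clkTape, zipTape_left_head] using hs)
      subst ha
      have key : clkVal true (e.castSucc :: l) z.length + 1 =
          clkVal false (e.succ :: l) z.length := by
        have h2 : 0 < (digitVal (e.castSucc :: l) + 1) * (b + 1) ^ z.length := by positivity
        simp only [clkVal, if_true, Bool.false_eq_true, if_false]
        rw [Nat.sub_add_cancel h2]
        simp [digitVal]; ring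
      refine ⟨e.castSucc :: l, z, ?_, hz, by simp, key.ge, Or.inl key⟩
      simp [clkTape, zipTape_cons_left, zipTape_write_right]
  | fill s hs' =>
    cases z with
    | nil => simp [clkTape, zipTape_head] at hs; exact absurd hs.symm hs'
    | cons a z =>
      have key : clkVal true (Fin.last b :: l) z.length = clkVal true l (a :: z).length := by
        simp only [clkVal, if_true, digitVal, Fin.val_last, List.length_cons, pow_succ]
        congr 1; ring
      refine ⟨Fin.last b :: l, z, ?_, fun a ha => hz a (by simp [ha]), ?_, ?_, ?_⟩
      · simp [clkTape, zipTape_write_right]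
      · simp only [List.length_cons]; omega
      · omega
      · right
        refine ⟨key, ?_⟩
        simp only [clkExtra, if_true, List.length_cons]; omega
  | turn =>
    cases z with
    | cons a z => simp [clkTape, zipTape_head] at hs; exact absurd hs (hz a (by simp))
    | nil =>
      refine ⟨l, [], ?_, by simp, by simp, ?_, ?_⟩
      · have := zipTape_write_head (l.map dig) ([] : List Γ)
        simp only [List.headI_nil] at this
        simp [clkTape, this]
      · simp [clkVal]
      · right; simp [clkVal, clkExtra]

/-- The counter can move unless its value is zero. -/
theorem clk_progress {Γ : Type} [Inhabited Γ] {b : ℕ} {dig : Fin (b + 1) → Γ} {r : Bool}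
    {l : List (Fin (b + 1))} {z : List Γ} (hv : 0 < clkVal r l z.length) :
    ∃ r' s' d, ClkAct dig r (clkTape dig r l z).head r' s' d := by
  cases r
  · cases l with
    | nil => simp [clkVal, digitVal] at hv
    | cons a l =>
      have : (clkTape dig false (a :: l) z).head = dig a := by
        simp [clkTape, zipTape_left_head]
      rw [this]
      refine Fin.cases ⟨_, _, _, ClkAct.skip⟩ (fun e => ⟨_, _, _, ClkAct.dec e⟩) a
  · by_cases h : (clkTape dig true l z).head = default
    · rw [h]; exact ⟨_, _, _, ClkAct.turn⟩
    · exact ⟨_, _, _, ClkAct.fill _ h⟩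

/-- The machine `M` with a clock: it first writes a counter of `|x| + 1` digits of base `b + 1` on
an additional tape, then runs `M` and counts down at the same time. -/
noncomputable def clocked (M : NTM σ) {b : ℕ} (dig : Fin (b + 1) → M.Symb) : NTM σ where
  State := ClkState M.State
  finite_state := inferInstance
  Symb := M.Symb
  finite_symb := M.finite_symb
  inhabited_symb := M.inhabited_symb
  TapeIdx := Option M.TapeIdx
  finite_tapeIdx := inferInstance
  decEq_tapeIdx := inferInstance
  inputTape := some M.inputTape
  inputSymb := M.inputSymb
  inputSymb_ne_blank := M.inputSymb_ne_blank
  start := .scan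
  accept := {q | ∃ s ∈ M.accept, ∃ r, q = .run s r}
  trans q rd := match q with
    | .scan => {a | (rd (some M.inputTape) ≠ default ∧ a = (.scan, fun k => match k with
          | none => (dig (Fin.last b), some Dir.right)
          | some k => (rd (some k), if k = M.inputTape then some Dir.right else none))) ∨
        (rd (some M.inputTape) = default ∧ a = (.rewind, fun k => match k with
          | none => (dig (Fin.last b), some Dir.right)
          | some k => (rd (some k), if k = M.inputTape then some Dir.left else none)))}
    | .rewind => {a | (rd (some M.inputTape) ≠ default ∧ a = (.rewind, fun k =>
          (rd k, if k = some M.inputTape then some Dir.left else none))) ∨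
        (rd (some M.inputTape) = default ∧ a = (.run M.start true, fun k =>
          (rd k, if k = some M.inputTape then some Dir.right else none)))}
    | .run s r => {a | ∃ c ∈ M.trans s (fun k => rd (some k)), ∃ r' s' d,
        ClkAct dig r (rd none) r' s' d ∧ a = (.run c.1 r', fun k => match k with
          | none => (s', some d)
          | some k => c.2 k)}

theorem step_run {M : NTM σ} {m : ℕ} {c d e : M.Cfg} (h : M.Step c d) (h' : M.Run m d e) :
    M.Run (m + 1) c e := by
  induction h' with
  | refl => exact .tail (.refl _) h
  | tail _ hs ih => exact .tail (ih h) hs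

theorem run_trans {M : NTM σ} {m k : ℕ} {c d e : M.Cfg} (h : M.Run m c d) (h' : M.Run k d e) :
    M.Run (m + k) c e := by
  induction h' with
  | refl => exact h
  | tail _ hs ih => exact .tail (ih h) hs

section clocked
variable (M : NTM σ) {b : ℕ} (dig : Fin (b + 1) → M.Symb)

/-- The tapes of `M` in its initial configuration, except for the input tape, which is `T`. -/
def inputTapes (T : Tape M.Symb) (k : M.TapeIdx) : Tape M.Symb :=
  if k = M.inputTape then T else Tape.mk₁ []

/-- Combine the tapes of `M` with a counter tape. -/
def withClk (T : M.TapeIdx → Tape M.Symb) (C : Tape M.Symb) :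
    (clocked M dig).TapeIdx → Tape M.Symb
  | none => C
  | some k => T k

/-- The invariant of a clocked machine on input `x`, with a bound `t` on the number of steps that
are still possible. -/
inductive ClkInv (x : List σ) : (clocked M dig).Cfg → ℕ → Prop
  | scan (p f : List σ) (h : p.reverse ++ f = x) :
    ClkInv x ⟨.scan, withClk M dig
      (inputTapes M (zipTape (p.map M.inputSymb) (f.map M.inputSymb)))
      (zipTape ((List.replicate p.length (Fin.last b)).map dig) [])⟩
      ((b + 1) ^ (x.length + 1) * (2 * (x.length + 1) + 3) + x.length + 2 + f.length)
  | rewind (p f : List σ) (h : p.reverse ++ f = x) :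
    ClkInv x ⟨.rewind, withClk M dig
      (inputTapes M ((zipTape (p.map M.inputSymb) (f.map M.inputSymb)).move Dir.left))
      (zipTape ((List.replicate (x.length + 1) (Fin.last b)).map dig) [])⟩
      ((b + 1) ^ (x.length + 1) * (2 * (x.length + 1) + 3) + p.length + 1)
  | run (k : ℕ) (c : M.Cfg) (hc : M.Run k (M.init x) c) (r : Bool) (l : List (Fin (b + 1)))
      (z : List M.Symb) (hz : ∀ a ∈ z, a ≠ default) (hl : l.length + z.length = x.length + 1) :
    ClkInv x ⟨.run c.state r, withClk M dig c.tape (clkTape dig r l z)⟩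
      (clkVal r l z.length * (2 * (x.length + 1) + 3) + clkExtra r l.length z.length)

theorem clkInv_init (x : List σ) : ClkInv M dig x ((clocked M dig).init x)
    ((b + 1) ^ (x.length + 1) * (2 * (x.length + 1) + 3) + x.length + 2 + x.length) := by
  have h := ClkInv.scan (M := M) (dig := dig) (x := x) [] x (by simp)
  convert h using 1
  simp only [init]
  congr 1
  funext k
  cases k with
  | none => simp [withClk, clocked, zipTape, Tape.mk₁, Tape.mk₂]; rfl
  | some k => simp [withClk, clocked, zipTape, Tape.mk₁, Tape.mk₂, inputTapes]; rfl

theorem zipTape_map_head_eq_default {p f : List σ} :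
    (zipTape (p.map M.inputSymb) (f.map M.inputSymb)).head = default ↔ f = [] := by
  cases f <;> simp [zipTape_head, M.inputSymb_ne_blank]

theorem zipTape_map_left_head_eq_default {p f : List σ} :
    ((zipTape (p.map M.inputSymb) (f.map M.inputSymb)).move Dir.left).head = default ↔
      p = [] := by
  cases p <;> simp [zipTape_left_head, M.inputSymb_ne_blank]

theorem actTape_inputTapes (T : Tape M.Symb) (d : Dir) (k : M.TapeIdx) :
    M.actTape (inputTapes M T k)
      ((inputTapes M T k).head, if k = M.inputTape then some d else none) =
    inputTapes M (T.move d) k := by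
  by_cases hk : k = M.inputTape
  · simp only [hk, inputTapes, if_true, actTape]
    rw [Tape.write_self T]
  · simp only [hk, inputTapes, if_false, actTape]
    exact Tape.write_self _

/-- The steps of the first phase. -/
theorem step_scan {T C : Tape M.Symb} {c' : (clocked M dig).Cfg} :
    (clocked M dig).Step ⟨.scan, withClk M dig (inputTapes M T) C⟩ c' ↔
      (T.head ≠ default ∧ c' = ⟨.scan, withClk M dig (inputTapes M (T.move Dir.right))
        ((C.write (dig (Fin.last b))).move Dir.right)⟩) ∨
      (T.head = default ∧ c' = ⟨.rewind, withClk M dig (inputTapes M (T.move Dir.left))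
        ((C.write (dig (Fin.last b))).move Dir.right)⟩) := by
  have key : ∀ (d : Dir) (c' : (clocked M dig).Cfg) (q : ClkState M.State),
      c' = ⟨q, withClk M dig (inputTapes M (T.move d))
        ((C.write (dig (Fin.last b))).move Dir.right)⟩ ↔
      c' = ⟨q, fun k => (clocked M dig).actTape (withClk M dig (inputTapes M T) C k)
        (match k with
          | none => (dig (Fin.last b), some Dir.right)
          | some k => ((inputTapes M T k).head,
              if k = M.inputTape then some d else none))⟩ := by
    intro d c' q
    have : withClk M dig (inputTapes M (T.move d))
        ((C.write (dig (Fin.last b))).move Dir.right) =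
        fun k => (clocked M dig).actTape (withClk M dig (inputTapes M T) C k)
        (match k with
          | none => (dig (Fin.last b), some Dir.right)
          | some k => ((inputTapes M T k).head,
              if k = M.inputTape then some d else none)) := by
      funext k
      cases k with
      | none => rfl
      | some k => exact (actTape_inputTapes M T d k).symm
    rw [this]
  have hh : ((withClk M dig (inputTapes M T) C) (some M.inputTape)).head = T.head := by
    simp [withClk, inputTapes]
  rw [key, key, ← hh]
  unfold Step
  constructor
  · rintro ⟨A, (⟨h, rfl⟩ | ⟨h, rfl⟩), rfl⟩
    · exact Or.inl ⟨h, by congr 1; funext k; cases k <;> rfl⟩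
    · exact Or.inr ⟨h, by congr 1; funext k; cases k <;> rfl⟩
  · rintro (⟨h, rfl⟩ | ⟨h, rfl⟩)
    · exact ⟨_, Or.inl ⟨h, rfl⟩, by congr 1; funext k; cases k <;> rfl⟩
    · exact ⟨_, Or.inr ⟨h, rfl⟩, by congr 1; funext k; cases k <;> rfl⟩

/-- The steps of the second phase. -/
theorem step_rewind {T C : Tape M.Symb} {c' : (clocked M dig).Cfg} :
    (clocked M dig).Step ⟨.rewind, withClk M dig (inputTapes M T) C⟩ c' ↔
      (T.head ≠ default ∧ c' = ⟨.rewind, withClk M dig (inputTapes M (T.move Dir.left)) C⟩) ∨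
      (T.head = default ∧ c' = ⟨.run M.start true,
        withClk M dig (inputTapes M (T.move Dir.right)) C⟩) := by
  have key : ∀ (d : Dir) (c' : (clocked M dig).Cfg) (q : ClkState M.State),
      c' = ⟨q, withClk M dig (inputTapes M (T.move d)) C⟩ ↔
      c' = ⟨q, fun k : Option M.TapeIdx => (clocked M dig).actTape (withClk M dig (inputTapes M T) C k)
        ((withClk M dig (inputTapes M T) C k).head,
          if k = some M.inputTape then some d else none)⟩ := by
    intro d c' q
    have : withClk M dig (inputTapes M (T.move d)) C =
        fun k : Option M.TapeIdx => (clocked M dig).actTape (withClk M dig (inputTapes M T) C k)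
        ((withClk M dig (inputTapes M T) C k).head,
          if k = some M.inputTape then some d else none) := by
      funext k
      cases k with
      | none => exact (Tape.write_self C).symm
      | some k =>
        simp only [Option.some.injEq]
        exact (actTape_inputTapes M T d k).symm
    rw [this]
  have hh : ((withClk M dig (inputTapes M T) C) (some M.inputTape)).head = T.head := by
    simp [withClk, inputTapes]
  rw [key, key, ← hh]
  unfold Step
  constructor
  · rintro ⟨A, (⟨h, rfl⟩ | ⟨h, rfl⟩), rfl⟩
    · exact Or.inl ⟨h, rfl⟩
    · exact Or.inr ⟨h, rfl⟩
  · rintro (⟨h, rfl⟩ | ⟨h, rfl⟩)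
    · exact ⟨_, Or.inl ⟨h, rfl⟩, rfl⟩
    · exact ⟨_, Or.inr ⟨h, rfl⟩, rfl⟩

/-- In the last phase, a step is a step of `M` together with a move of the counter. -/
theorem step_run_phase {s : M.State} {r : Bool} {T : M.TapeIdx → Tape M.Symb} {C : Tape M.Symb}
    {c' : (clocked M dig).Cfg} :
    (clocked M dig).Step ⟨.run s r, withClk M dig T C⟩ c' ↔
      ∃ d, M.Step ⟨s, T⟩ d ∧ ∃ r' s' dir, ClkAct dig r C.head r' s' dir ∧
        c' = ⟨.run d.state r', withClk M dig d.tape ((C.write s').move dir)⟩ := by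
  unfold Step
  constructor
  · rintro ⟨A, ⟨a, ha, r', s', dir, hc, rfl⟩, rfl⟩
    refine ⟨_, ⟨a, ha, rfl⟩, r', s', dir, hc, ?_⟩
    congr 1
    funext k
    cases k <;> rfl
  · rintro ⟨d, ⟨a, ha, rfl⟩, r', s', dir, hc, rfl⟩
    refine ⟨_, ⟨a, ha, r', s', dir, hc, rfl⟩, ?_⟩
    congr 1
    funext k
    cases k <;> rfl

variable {dig}

theorem zipTape_write_replicate (m : ℕ) :
    ((zipTape ((List.replicate m (Fin.last b)).map dig) []).write (dig (Fin.last b))).move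
      Dir.right = zipTape ((List.replicate (m + 1) (Fin.last b)).map dig) [] := by
  rw [zipTape_write_right]; rfl

/-- Every step uses up part of the bound, so a clocked machine always halts. -/
theorem clkInv_step (hinj : Function.Injective dig) (hne : ∀ d, dig d ≠ default) {x : List σ}
    {c c' : (clocked M dig).Cfg} {t : ℕ} (h : ClkInv M dig x c t)
    (hs : (clocked M dig).Step c c') : ∃ t' < t, ClkInv M dig x c' t' := by
  cases h with
  | scan p f h =>
    rw [step_scan, zipTape_write_replicate] at hs
    rcases hs with ⟨h1, rfl⟩ | ⟨h1, rfl⟩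
    · cases f with
      | nil => exact absurd ((zipTape_map_head_eq_default M).2 rfl) h1
      | cons a f =>
        refine ⟨_, ?_, .scan (a :: p) f (by simpa using h)⟩
        simp only [List.length_cons]; omega
    · obtain rfl : f = [] := (zipTape_map_head_eq_default M).1 h1
      have hp : p.length = x.length := by rw [← h]; simp
      rw [hp]
      refine ⟨_, ?_, .rewind p [] h⟩
      rw [hp]; simp only [List.length_nil]; omega
  | rewind p f h =>
    rw [step_rewind] at hs
    rcases hs with ⟨h1, rfl⟩ | ⟨h1, rfl⟩
    · cases p with
      | nil => exact absurd ((zipTape_map_left_head_eq_default M).2 rfl) h1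
      | cons a p =>
        refine ⟨_, ?_, by
          simpa [zipTape_cons_left] using ClkInv.rewind (dig := dig) p (a :: f) (by simpa using h)⟩
        simp only [List.length_cons]; omega
    · obtain rfl : p = [] := (zipTape_map_left_head_eq_default M).1 h1
      obtain rfl : f = x := by simpa using h
      have h2 := ClkInv.run (dig := dig) (x := f) 0 (M.init f) (.refl _) true
        (List.replicate (f.length + 1) (Fin.last b)) [] (by simp) (by simp)
      refine ⟨_, ?_, by
        convert h2 using 1
        congr 2
        funext k
        simp [init, inputTapes, zipTape, Tape.mk₁, Tape.mk₂, listBlank_singleton]⟩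
      have h3 := clkVal_lt true (List.replicate (f.length + 1) (Fin.last b)) 0
      simp only [List.length_replicate, Nat.add_zero] at h3
      simp only [List.length_nil, List.length_replicate, clkExtra, if_true, Nat.add_zero]
      nlinarith
  | run k c hc r l z hz hl =>
    rw [step_run_phase] at hs
    obtain ⟨d, hd, r', s', dir, hA, rfl⟩ := hs
    obtain ⟨l', z', e, hz', hl', h1, h2⟩ := clk_step hinj hne hz hA
    rw [e]
    refine ⟨_, ?_, .run (k + 1) d (.tail hc hd) r' l' z' hz' (hl'.trans hl)⟩
    rcases h2 with h2 | ⟨h2, h3⟩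
    · rw [← h2]
      have : clkExtra r' l'.length z'.length < 2 * (x.length + 1) + 3 := by
        unfold clkExtra; split_ifs <;> omega
      rw [Nat.add_mul]; omega
    · rw [h2]; omega

theorem clkInv_run (hinj : Function.Injective dig) (hne : ∀ d, dig d ≠ default) {x : List σ}
    {m : ℕ} {c c' : (clocked M dig).Cfg} (hr : (clocked M dig).Run m c c') :
    ∀ {t : ℕ}, ClkInv M dig x c t → ∃ t', t' + m ≤ t ∧ ClkInv M dig x c' t' := by
  induction hr with
  | refl c => exact fun h => ⟨_, le_rfl, h⟩
  | tail _ hs ih =>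
    intro t h
    obtain ⟨t', h1, h2⟩ := ih h
    obtain ⟨t'', h3, h4⟩ := clkInv_step M hinj hne h2 hs
    exact ⟨t'', by omega, h4⟩

theorem clk_reach_rewind (x : List σ) : ∀ f p : List σ, p.reverse ++ f = x →
    ∃ m, (clocked M dig).Run m ⟨.scan, withClk M dig
      (inputTapes M (zipTape (p.map M.inputSymb) (f.map M.inputSymb)))
      (zipTape ((List.replicate p.length (Fin.last b)).map dig) [])⟩
      ⟨.rewind, withClk M dig
      (inputTapes M ((zipTape (x.reverse.map M.inputSymb) []).move Dir.left))
      (zipTape ((List.replicate (x.length + 1) (Fin.last b)).map dig) [])⟩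
  | [], p, h => by
    refine ⟨1, .tail (.refl _) ((step_scan M dig).2 (Or.inr ⟨?_, ?_⟩))⟩
    · simp [zipTape_head]
    · rw [zipTape_write_replicate, ← h]; simp
  | a :: f, p, h => by
    obtain ⟨m, hm⟩ := clk_reach_rewind x f (a :: p) (by simpa using h)
    refine ⟨m + 1, step_run ((step_scan M dig).2 (Or.inl ⟨?_, rfl⟩)) ?_⟩
    · simp [zipTape_head, M.inputSymb_ne_blank]
    · rw [zipTape_write_replicate]
      simpa [zipTape_cons_right] using hm

theorem clk_reach_run (C : Tape M.Symb) : ∀ p f : List σ,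
    ∃ m, (clocked M dig).Run m ⟨.rewind, withClk M dig
      (inputTapes M ((zipTape (p.map M.inputSymb) (f.map M.inputSymb)).move Dir.left)) C⟩
      ⟨.run M.start true, withClk M dig (M.init (p.reverse ++ f)).tape C⟩
  | [], f => by
    refine ⟨1, .tail (.refl _) ((step_rewind M dig).2 (Or.inr ⟨?_, ?_⟩))⟩
    · simp [zipTape_left_head]
    · congr 2
      funext k
      simp [init, inputTapes, zipTape, Tape.mk₁, Tape.mk₂, listBlank_singleton]
  | a :: p, f => by
    obtain ⟨m, hm⟩ := clk_reach_run C p (a :: f)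
    refine ⟨m + 1, step_run ((step_rewind M dig).2 (Or.inl ⟨?_, rfl⟩)) ?_⟩
    · simp [zipTape_left_head, M.inputSymb_ne_blank]
    · simpa [zipTape_cons_left] using hm

/-- As long as the counter is positive, runs of `M` are followed by the clocked machine. -/
theorem clk_follow (hinj : Function.Injective dig) (hne : ∀ d, dig d ≠ default) {k : ℕ}
    {c c' : M.Cfg} (hr : M.Run k c c') {l : List (Fin (b + 1))} (hk : k < (b + 1) ^ l.length)
    (hl : l = List.replicate l.length (Fin.last b)) :
    ∃ r' l' z', (∀ a ∈ z', a ≠ default) ∧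
      (b + 1) ^ l.length ≤ clkVal r' l' z'.length + k + 1 ∧
      (clocked M dig).Run k ⟨.run c.state true, withClk M dig c.tape (clkTape dig true l [])⟩
        ⟨.run c'.state r', withClk M dig c'.tape (clkTape dig r' l' z')⟩ := by
  induction hr with
  | refl c =>
    refine ⟨true, l, [], by simp, ?_, .refl _⟩
    rw [← digitVal_replicate, ← hl]; simp [clkVal]
  | @tail k c d e hcd hs ih =>
    obtain ⟨r, l₁, z, hz, hv, hrun⟩ := ih (by omega)
    obtain ⟨r', s', dir, hA⟩ := clk_progress (dig := dig) (r := r) (l := l₁) (z := z) (by omega)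
    obtain ⟨l', z', e1, hz', -, h1, -⟩ := clk_step hinj hne hz hA
    refine ⟨r', l', z', hz', by omega, .tail hrun ?_⟩
    rw [step_run_phase]
    exact ⟨e, hs, r', s', dir, hA, by rw [e1]⟩

/-- A language belongs to `NExpTime` as soon as a machine accepts exactly its words, and every
word of the language is accepted by some run of exponential length: the clock takes care of the
other runs. -/
theorem mem_NExpTime_of_bounded_accept (A : Language σ) (hinj : Function.Injective dig)
    (hne : ∀ d, dig d ≠ default) (hacc : ∀ s ∈ M.accept, ∀ rd, M.trans s rd = ∅)
    (sound : ∀ x, M.Accepts x → x ∈ A)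
    (compl : ∀ x ∈ A, ∃ k c, k < (b + 1) ^ (x.length + 1) ∧ M.Run k (M.init x) c ∧
      c.state ∈ M.accept) : A ∈ NExpTime σ := by
  have hstuck : ∀ c : M.Cfg, c.state ∈ M.accept → M.Halting c := by
    rintro c hc c' ⟨a, ha, -⟩
    rw [hacc _ hc] at ha
    exact ha
  refine ⟨clocked M dig, Polynomial.C (b + 1) * (Polynomial.X + 1) + Polynomial.X + 4,
    fun x => ⟨fun m c hr => ?_, ⟨?_, fun hx => ?_⟩⟩⟩
  · obtain ⟨t', h1, -⟩ := clkInv_run M hinj hne hr (clkInv_init M dig x)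
    have h2 : (b + 1) ^ (x.length + 1) ≤ 2 ^ ((b + 1) * (x.length + 1)) := by
      rw [pow_mul]; exact Nat.pow_le_pow_left Nat.lt_two_pow_self.le _
    have h3 : 4 * x.length + 7 ≤ 2 ^ (x.length + 4) := by
      have := @Nat.lt_two_pow_self x.length
      rw [pow_add]; omega
    have h4 : 1 ≤ (b + 1) ^ (x.length + 1) := Nat.one_le_pow _ _ (by omega)
    simp only [Polynomial.eval_add, Polynomial.eval_mul, Polynomial.eval_C, Polynomial.eval_X,
      Polynomial.eval_one, Polynomial.eval_ofNat]
    calc m ≤ (b + 1) ^ (x.length + 1) * (2 * (x.length + 1) + 3) + x.length + 2 + x.length := by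
            omega
      _ ≤ (b + 1) ^ (x.length + 1) * (4 * x.length + 7) := by nlinarith
      _ ≤ 2 ^ ((b + 1) * (x.length + 1)) * 2 ^ (x.length + 4) := Nat.mul_le_mul h2 h3
      _ = _ := by rw [← pow_add, add_assoc]
  · rintro ⟨m, c, hr, -, s, hs, r, hst⟩
    obtain ⟨t', -, h⟩ := clkInv_run M hinj hne hr (clkInv_init M dig x)
    cases h with
    | scan => simp at hst
    | rewind => simp at hst
    | run k c hc r l z =>
      simp only [ClkState.run.injEq] at hst
      rw [← hst.1] at hs
      exact sound x ⟨k, c, hc, hstuck c hs, hs⟩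
  · obtain ⟨k, c, hk, hr, hc⟩ := compl x hx
    obtain ⟨m₁, h₁⟩ := clk_reach_rewind M (dig := dig) x x [] (by simp)
    obtain ⟨m₂, h₂⟩ := clk_reach_run M (dig := dig)
      (zipTape ((List.replicate (x.length + 1) (Fin.last b)).map dig) []) x.reverse []
    obtain ⟨r', l', z', -, -, h₃⟩ := clk_follow M hinj hne hr
      (l := List.replicate (x.length + 1) (Fin.last b)) (by simpa using hk) (by simp)
    have e : (M.init x).state = M.start := rfl
    have h₄ : (clocked M dig).init x = ⟨.scan, withClk M dig
      (inputTapes M (zipTape (([] : List σ).map M.inputSymb) (x.map M.inputSymb)))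
      (zipTape ((List.replicate ([] : List σ).length (Fin.last b)).map dig) [])⟩ := by
      simp only [init]
      congr 1
      funext k
      cases k with
      | none => simp [withClk, clocked, zipTape, Tape.mk₁, Tape.mk₂]; rfl
      | some k => simp [withClk, clocked, zipTape, Tape.mk₁, Tape.mk₂, inputTapes]; rfl
    refine ⟨_, _, by rw [h₄]; exact run_trans h₁ (run_trans (by simpa [clkTape, e] using h₂) h₃),
      ?_, ?_⟩
    · intro c' hs
      rw [step_run_phase] at hs
      obtain ⟨d, hd, -⟩ := hs
      exact hstuck c hc d hd
    · exact ⟨_, hc, _, rfl⟩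

end clocked
end NTM

/-! ### Sweeps with a stack -/

/-- An operation on a stack. -/
inductive StackOp (S : Type) : Type
  | nop
  | pop
  | push (s : S)

/-- The effect of an operation on a stack, the top of which is the head of the list. -/
def StackOp.app {S : Type} : StackOp S → List S → List S
  | .nop, st => st
  | .pop, st => st.tail
  | .push s, st => s :: st

/-- A nondeterministic pushdown automaton that reads one letter in every step. -/
structure PDA (Col : Type) where
  Q : Type
  finite_Q : Finite Q
  Stk : Type
  finite_Stk : Finite Stk
  start : Set Q
  acc : Set Q
  δ : Q → Col → Option Stk → Set (Q × StackOp Stk)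

/-- The automaton reads words from right to left; `P.Run cs q st` says that it can be in state `q`
with stack `st` after reading the word `cs`. -/
inductive PDA.Run {Col : Type} (P : PDA Col) : List Col → P.Q → List P.Stk → Prop
  | nil {q : P.Q} (h : q ∈ P.start) : Run P [] q []
  | cons {c : Col} {cs : List Col} {q q' : P.Q} {st : List P.Stk} {op : StackOp P.Stk}
      (h : Run P cs q st) (hs : (q', op) ∈ P.δ q c st.head?) : Run P (c :: cs) q' (op.app st)

/-- Acceptance is by an accepting state with empty stack. -/
def PDA.Accepts {Col : Type} (P : PDA Col) (cs : List Col) : Prop :=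
  ∃ q ∈ P.acc, P.Run cs q []

/-- The columns of the input word `x` and the words `V h`. -/
def sweepCols {σ Γ H : Type} (x : List σ) (V : H → ℕ → Γ) : List (σ × (H → Γ)) :=
  x.mapIdx fun k a => (a, fun h => V h k)

theorem sweepCols_congr {σ Γ H : Type} {x : List σ} {V V' : H → ℕ → Γ}
    (h : ∀ h, ∀ k < x.length, V h k = V' h k) : sweepCols x V = sweepCols x V' := by
  apply List.ext_getElem (by simp [sweepCols])
  intro k hk _
  simp only [sweepCols, List.getElem_mapIdx, Prod.mk.injEq, true_and]
  funext i
  exact h i k (by simpa [sweepCols] using hk)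

/-! ### Tapes as functions on the integers -/

namespace NTM
open Turing

/-- The tape `T` has content `c`, with the head at position `i`. -/
def TapeAt {Γ : Type} [Inhabited Γ] (T : Tape Γ) (c : ℤ → Γ) (i : ℤ) : Prop :=
  ∀ k : ℤ, T.nth k = c (k + i)

/-- The displacement of the head. -/
def dirShift : Option Dir → ℤ
  | none => 0
  | some Dir.left => -1
  | some Dir.right => 1

theorem dirShift_none : dirShift none = 0 := rfl

theorem dirShift_left : dirShift (some Dir.left) = -1 := rfl

theorem dirShift_right : dirShift (some Dir.right) = 1 := rfl

theorem TapeAt.head {Γ : Type} [Inhabited Γ] {T : Tape Γ} {c : ℤ → Γ} {i : ℤ}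
    (h : TapeAt T c i) : T.head = c i := by
  have := h 0; simpa using this

theorem TapeAt.act {σ : Type} {M : NTM σ} {T : Tape M.Symb} {c : ℤ → M.Symb} {i : ℤ}
    (h : TapeAt T c i) (s : M.Symb) (d : Option Dir) :
    TapeAt (M.actTape T (s, d)) (Function.update c i s) (i + dirShift d) := by
  have hw : ∀ k, (T.write s).nth k = Function.update c i s (k + i) := by
    intro k
    rw [Tape.write_nth, Function.update_apply, h k]
    by_cases hk : k = 0
    · simp [hk]
    · simp [hk]
  rcases d with _ | _ | _
  · intro k; simpa [actTape, dirShift] using hw k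
  · intro k
    simp only [actTape, dirShift, Tape.move_left_nth, hw]
    congr 1; ring
  · intro k
    simp only [actTape, dirShift, Tape.move_right_nth, hw]
    congr 1; ring

theorem TapeAt.act_self {σ : Type} {M : NTM σ} {T : Tape M.Symb} {c : ℤ → M.Symb} {i : ℤ}
    (h : TapeAt T c i) (d : Option Dir) :
    TapeAt (M.actTape T (c i, d)) c (i + dirShift d) := by
  have := h.act (c i) d
  rwa [Function.update_eq_self] at this

/-- The content of a tape that holds the word `l` from position `0` on. -/
def wordContent {Γ : Type} [Inhabited Γ] (l : List Γ) (i : ℤ) : Γ :=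
  if 0 ≤ i then l.getI i.toNat else default

theorem tapeAt_mk₁ {Γ : Type} [Inhabited Γ] (l : List Γ) :
    TapeAt (Tape.mk₁ l) (wordContent l) 0 := by
  intro k
  rw [add_zero, wordContent]
  rcases k with k | k
  · have : (Tape.mk₁ l).nth (k : ℤ) = (ListBlank.mk l).nth k := by
      rw [Tape.mk₁, Tape.mk₂, Tape.mk'_nth_nat]
    simpa using this
  · rw [if_neg (by simp)]
    simp [Tape.mk₁, Tape.mk₂, Tape.mk', Tape.nth]

theorem wordContent_append {Γ : Type} [Inhabited Γ] (l : List Γ) (s : Γ) :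
    Function.update (wordContent l) l.length s = wordContent (l ++ [s]) := by
  funext i
  rw [Function.update_apply]
  by_cases hi : 0 ≤ i
  · obtain ⟨n, rfl⟩ := Int.eq_ofNat_of_zero_le hi
    simp only [wordContent, hi, if_true, Int.toNat_natCast, Nat.cast_inj]
    rcases lt_trichotomy n l.length with h | h | h
    · rw [if_neg h.ne, List.getI_append _ _ _ h]
    · subst h; simp [List.getI_append_right]
    · rw [if_neg h.ne', List.getI_eq_default _ h.le, List.getI_eq_default _ (by simp; omega)]
  · rw [if_neg (by omega)]; simp [wordContent, hi]

/-! ### The guess-and-sweep machine -/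

namespace Sweep

variable {σ Γ H : Type}

/-- The tape symbols: input letters, block letters, the delimiters of blocks, stack symbols, and
the digits of a clock. -/
inductive Sym (σ Γ S : Type) (b : ℕ) : Type
  | blank
  | inp (a : σ)
  | blk (g : Γ)
  | lft
  | sep
  | rgt
  | stk (s : S)
  | dig (d : Fin b)

instance {σ Γ S : Type} {b : ℕ} : Inhabited (Sym σ Γ S b) := ⟨.blank⟩

instance {σ Γ S : Type} {b : ℕ} [Finite σ] [Finite Γ] [Finite S] : Finite (Sym σ Γ S b) :=
  Finite.of_injective
    (fun q : Sym σ Γ S b => match q with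
      | .blank => (Sum.inl 0 : Fin 4 ⊕ σ ⊕ Γ ⊕ S ⊕ Fin b)
      | .lft => Sum.inl 1
      | .sep => Sum.inl 2
      | .rgt => Sum.inl 3
      | .inp a => Sum.inr (Sum.inl a)
      | .blk g => Sum.inr (Sum.inr (Sum.inl g))
      | .stk s => Sum.inr (Sum.inr (Sum.inr (Sum.inl s)))
      | .dig d => Sum.inr (Sum.inr (Sum.inr (Sum.inr d))))
    (by rintro (_ | _ | _ | _ | _ | _ | _ | _) (_ | _ | _ | _ | _ | _ | _ | _) <;> simp)

/-- The tapes: the input tape, the stack, and one tape for every block head. -/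
inductive TapeIdx (H : Type) : Type
  | inp
  | stk
  | hd (h : H)

instance {H : Type} [Finite H] : Finite (TapeIdx H) :=
  Finite.of_injective
    (fun q : TapeIdx H => match q with
      | .inp => (none : Option (Option H))
      | .stk => some none
      | .hd h => some (some h))
    (by rintro (_ | _ | _) (_ | _ | _) <;> simp)

/-- The states of the machine: writing the blocks, moving the heads to the blocks of the next
sweep (`wander`), sweeping, and accepting. -/
inductive State (Q S : Type) : Type
  | first
  | guess
  | wander (reset : Bool)
  | sweep (q : Q)
  | push (q : Q) (s : S)
  | done

instance {Q S : Type} [Finite Q] [Finite S] : Finite (State Q S) :=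
  Finite.of_injective
    (fun q : State Q S => match q with
      | .first => (Sum.inl 0 : Fin 3 ⊕ Bool ⊕ Q ⊕ (Q × S))
      | .guess => Sum.inl 1
      | .done => Sum.inl 2
      | .wander r => Sum.inr (Sum.inl r)
      | .sweep q => Sum.inr (Sum.inr (Sum.inl q))
      | .push q s => Sum.inr (Sum.inr (Sum.inr (q, s))))
    (by rintro (_ | _ | _ | _ | _ | _) (_ | _ | _ | _ | _ | _) <;> simp)

/-- The symbols at the right end of a block. -/
def IsR {S : Type} {b : ℕ} (s : Sym σ Γ S b) : Prop := s = .sep ∨ s = .rgt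

/-- The symbols at the left end of a block. -/
def IsL {S : Type} {b : ℕ} (s : Sym σ Γ S b) : Prop := s = .lft ∨ s = .sep

/-- The stack symbol in a cell of the stack tape. -/
def topOf {S : Type} {b : ℕ} : Sym σ Γ S b → Option S
  | .stk s => some s
  | _ => none

/-- The content of the stack tape, with the top of the stack at position `0`. -/
def stkContent {S : Type} {b : ℕ} (st : List S) (k : ℤ) : Sym σ Γ S b :=
  if k ≤ 0 then (st[(-k).toNat]?).elim .blank .stk else .blank

theorem topOf_stkContent {S : Type} {b : ℕ} (st : List S) :
    topOf (stkContent st 0 : Sym σ Γ S b) = st.head? := by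
  cases st <;> simp [stkContent, topOf]

theorem stkContent_zero_eq_blank {S : Type} {b : ℕ} {st : List S} :
    (stkContent st 0 : Sym σ Γ S b) = .blank ↔ st = [] := by
  cases st <;> simp [stkContent]

theorem stk_pop {S : Type} {b : ℕ} (st : List S) :
    (fun k => Function.update (stkContent st : ℤ → Sym σ Γ S b) 0 .blank (k + -1)) =
      stkContent st.tail := by
  funext k
  rw [Function.update_apply]
  by_cases hk : k ≤ 0
  · have h1 : (-(k + -1)).toNat = (-k).toNat + 1 := by omega
    rw [if_neg (by omega)]
    simp only [stkContent, hk, if_true, h1, show k + -1 ≤ 0 by omega]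
    cases st <;> simp
  · by_cases h1 : k = 1
    · subst h1; simp [stkContent]
    · rw [if_neg (by omega)]
      simp [stkContent, hk, show ¬ (k + -1 ≤ 0) by omega]

theorem stk_push {S : Type} {b : ℕ} (st : List S) (s : S) :
    (fun k => Function.update (stkContent st : ℤ → Sym σ Γ S b) 1 (.stk s) (k + 1)) =
      stkContent (s :: st) := by
  funext k
  rw [Function.update_apply]
  by_cases hk : k ≤ 0
  · by_cases h0 : k = 0
    · subst h0; simp [stkContent]
    · have h1 : (-k).toNat = (-(k + 1)).toNat + 1 := by omega
      rw [if_neg (by omega)]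
      simp [stkContent, hk, h1, show k + 1 ≤ 0 by omega]
  · rw [if_neg (by omega)]
    simp [stkContent, hk, show ¬ (k + 1 ≤ 0) by omega]

variable [Finite σ] [Finite Γ] [Finite H] (P : PDA (σ × (H → Γ))) (b : ℕ) (main uni : H)

/-- The moves of the machine: from state `q`, reading `rd`, to state `q'`, moving the input head
by `i`, with the actions `s` on the stack and `a` on the block tapes. -/
inductive Move : State P.Q P.Stk → (TapeIdx H → Sym σ Γ P.Stk b) → State P.Q P.Stk → Option Dir →
    Sym σ Γ P.Stk b × Option Dir → (H → Sym σ Γ P.Stk b × Option Dir) → Prop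
  | first (rd) : Move .first rd .guess none (rd .stk, none) (fun _ => (.lft, some Dir.right))
  | letter (rd) (g : Γ) :
    Move .guess rd .guess none (rd .stk, none) (fun _ => (.blk g, some Dir.right))
  | sep (rd) : Move .guess rd .guess none (rd .stk, none) (fun _ => (.sep, some Dir.right))
  | last (rd) : Move .guess rd (.wander false) none (rd .stk, none) (fun _ => (.rgt, none))
  | wander (rd) (r r' : Bool) (i : Option Dir) (d : H → Option Dir)
      (hmain : ((∃ g, rd (.hd main) = .blk g) ∧ d main = some Dir.right) ∨
        ((∀ g, rd (.hd main) ≠ .blk g) ∧ d main = none))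
      (huni : (r = true ∧ r' = true ∧ d uni = some Dir.right) ∨
        (r = true ∧ r' = false ∧ rd (.hd uni) = .rgt ∧ d uni = none) ∨
        (r = false ∧ r' = false ∧ d uni = none)) :
    Move (.wander r) rd (.wander r') i (rd .stk, none) (fun h => (rd (.hd h), d h))
  | start (rd) (q : P.Q) (hq : q ∈ P.start) (hx : rd .inp = .blank)
      (hr : ∀ h, IsR (rd (.hd h))) :
    Move (.wander false) rd (.sweep q) (some Dir.left) (rd .stk, none)
      (fun h => (rd (.hd h), some Dir.left))
  | nop (rd) (q q' : P.Q) (a : σ) (g : H → Γ) (hx : rd .inp = .inp a)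
      (hg : ∀ h, rd (.hd h) = .blk (g h)) (hd : (q', .nop) ∈ P.δ q (a, g) (topOf (rd .stk))) :
    Move (.sweep q) rd (.sweep q') (some Dir.left) (rd .stk, none)
      (fun h => (rd (.hd h), some Dir.left))
  | pop (rd) (q q' : P.Q) (a : σ) (g : H → Γ) (hx : rd .inp = .inp a)
      (hg : ∀ h, rd (.hd h) = .blk (g h)) (hd : (q', .pop) ∈ P.δ q (a, g) (topOf (rd .stk))) :
    Move (.sweep q) rd (.sweep q') (some Dir.left) (.blank, some Dir.left)
      (fun h => (rd (.hd h), some Dir.left))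
  | push (rd) (q q' : P.Q) (a : σ) (g : H → Γ) (s : P.Stk) (hx : rd .inp = .inp a)
      (hg : ∀ h, rd (.hd h) = .blk (g h)) (hd : (q', .push s) ∈ P.δ q (a, g) (topOf (rd .stk))) :
    Move (.sweep q) rd (.push q' s) (some Dir.left) (rd .stk, some Dir.right)
      (fun h => (rd (.hd h), some Dir.left))
  | write (rd) (q : P.Q) (s : P.Stk) :
    Move (.push q s) rd (.sweep q) none (.stk s, none) (fun h => (rd (.hd h), none))
  | next (rd) (q : P.Q) (hq : q ∈ P.acc) (hx : rd .inp = .blank) (hs : rd .stk = .blank)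
      (hl : ∀ h, IsL (rd (.hd h))) (hu : rd (.hd uni) = .sep) (d : H → Option Dir)
      (hd : d main = some Dir.right) (hd' : ∀ h, h ≠ main → d h = none) :
    Move (.sweep q) rd (.wander false) none (rd .stk, none) (fun h => (rd (.hd h), d h))
  | reset (rd) (q : P.Q) (hq : q ∈ P.acc) (hx : rd .inp = .blank) (hs : rd .stk = .blank)
      (hl : ∀ h, IsL (rd (.hd h))) (hu : rd (.hd uni) = .lft) (hm : rd (.hd main) = .sep) :
    Move (.sweep q) rd (.wander true) none (rd .stk, none) (fun h => (rd (.hd h), none))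
  | done (rd) (q : P.Q) (hq : q ∈ P.acc) (hx : rd .inp = .blank) (hs : rd .stk = .blank)
      (hl : ∀ h, IsL (rd (.hd h))) (hu : rd (.hd uni) = .lft) (hm : rd (.hd main) = .lft) :
    Move (.sweep q) rd .done none (rd .stk, none) (fun h => (rd (.hd h), none))

/-- The actions on all tapes. -/
def acts {S : Type} (rd : TapeIdx H → Sym σ Γ S b) (i : Option Dir) (s : Sym σ Γ S b × Option Dir)
    (a : H → Sym σ Γ S b × Option Dir) : TapeIdx H → Sym σ Γ S b × Option Dir
  | .inp => (rd .inp, i)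
  | .stk => s
  | .hd h => a h

/-- The machine writes the same list of blocks on all block tapes. Then it goes through all pairs
of blocks on the tapes `main` and `uni`; for every pair it chooses blocks on the other tapes and
checks with `P` the columns of the input and the chosen blocks. -/
noncomputable def machine : NTM σ where
  State := State P.Q P.Stk
  finite_state := by
    have := P.finite_Q
    have := P.finite_Stk
    infer_instance
  Symb := Sym σ Γ P.Stk b
  finite_symb := by
    have := P.finite_Stk
    infer_instance
  inhabited_symb := inferInstance
  TapeIdx := TapeIdx H
  finite_tapeIdx := inferInstance
  decEq_tapeIdx := Classical.decEq _
  inputTape := .inp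
  inputSymb := ⟨.inp, fun _ _ h => by injection h⟩
  inputSymb_ne_blank := fun a h => by cases h
  start := .first
  accept := {.done}
  trans q rd := {A | ∃ q' i s a, Move P b main uni q rd q' i s a ∧ A = (q', acts b rd i s a)}

variable {P b main uni}

theorem machine_trans_done (rd) : (machine P b main uni).trans State.done rd = ∅ := by
  refine Set.eq_empty_iff_forall_notMem.2 ?_
  rintro A ⟨q', i, s, a, h, -⟩
  cases h

/-- The configuration has the input word, a stack tape and block tapes with the given contents
and head positions. -/
structure Rep (c : (machine P b main uni).Cfg) (xc : ℤ → Sym σ Γ P.Stk b) (hx : ℤ)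
    (sc : ℤ → Sym σ Γ P.Stk b) (sp : ℤ) (w : ℤ → Sym σ Γ P.Stk b) (p : H → ℤ) : Prop where
  inp : TapeAt (c.tape TapeIdx.inp) xc hx
  stk : TapeAt (c.tape TapeIdx.stk) sc sp
  hd : ∀ h, TapeAt (c.tape (TapeIdx.hd h)) w (p h)

/-- The symbols under the heads. -/
def reads {S : Type} (xc : ℤ → Sym σ Γ S b) (hx : ℤ) (sc : ℤ → Sym σ Γ S b) (sp : ℤ)
    (w : ℤ → Sym σ Γ S b) (p : H → ℤ) : TapeIdx H → Sym σ Γ S b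
  | .inp => xc hx
  | .stk => sc sp
  | .hd h => w (p h)

variable {c c' : (machine P b main uni).Cfg} {xc : ℤ → Sym σ Γ P.Stk b} {hx : ℤ}
  {sc : ℤ → Sym σ Γ P.Stk b} {sp : ℤ} {w : ℤ → Sym σ Γ P.Stk b} {p : H → ℤ}

theorem Rep.reads (h : Rep c xc hx sc sp w p) :
    (fun k => (c.tape k).head) = Sweep.reads xc hx sc sp w p := by
  funext k
  rcases k with _ | _ | i
  · exact h.inp.head
  · exact h.stk.head
  · exact (h.hd i).head

/-- The configuration after a move. -/
noncomputable def after (c : (machine P b main uni).Cfg) (q' : State P.Q P.Stk) (i : Option Dir)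
    (s : Sym σ Γ P.Stk b × Option Dir) (a : H → Sym σ Γ P.Stk b × Option Dir) :
    (machine P b main uni).Cfg :=
  ⟨q', fun k => (machine P b main uni).actTape (c.tape k)
    (acts b (fun k => (c.tape k).head) i s a k)⟩

theorem Rep.step_iff (h : Rep c xc hx sc sp w p) :
    (machine P b main uni).Step c c' ↔ ∃ q' i s a,
      Move P b main uni c.state (Sweep.reads xc hx sc sp w p) q' i s a ∧ c' = after c q' i s a := by
  rw [← h.reads]
  constructor
  · rintro ⟨A, ⟨q', i, s, a, hm, rfl⟩, rfl⟩
    exact ⟨q', i, s, a, hm, rfl⟩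
  · rintro ⟨q', i, s, a, hm, rfl⟩
    exact ⟨_, ⟨q', i, s, a, hm, rfl⟩, rfl⟩

theorem Rep.after_write (h : Rep c xc hx sc sp w p) (q' : State P.Q P.Stk) (i : Option Dir)
    (s : Sym σ Γ P.Stk b × Option Dir) (d : Option Dir) (t : Sym σ Γ P.Stk b) {n : ℤ}
    (hp : ∀ k, p k = n) :
    Rep (after c q' i s (fun _ => (t, d))) xc (hx + dirShift i) (Function.update sc sp s.1)
      (sp + dirShift s.2) (Function.update w n t) (fun _ => n + dirShift d) where
  inp := by
    have := h.inp.act_self i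
    rwa [← h.inp.head] at this
  stk := h.stk.act s.1 s.2
  hd k := by
    have := (h.hd k).act t d
    rw [hp k] at this
    exact this

theorem Rep.after_move (h : Rep c xc hx sc sp w p) (q' : State P.Q P.Stk) (i : Option Dir)
    (s : Sym σ Γ P.Stk b × Option Dir) (d : H → Option Dir) :
    Rep (after c q' i s (fun k => (w (p k), d k))) xc (hx + dirShift i)
      (Function.update sc sp s.1) (sp + dirShift s.2) w (fun k => p k + dirShift (d k)) where
  inp := by
    have := h.inp.act_self i
    rwa [← h.inp.head] at this
  stk := h.stk.act s.1 s.2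
  hd k := (h.hd k).act_self (d k)

theorem TapeAt.shift {Γ : Type} [Inhabited Γ] {T : Tape Γ} {c : ℤ → Γ} {i : ℤ}
    (h : TapeAt T c i) : TapeAt T (fun k => c (k + i)) 0 := by
  intro k; simpa using h k

theorem Rep.pop {st : List P.Stk} (h : Rep c xc hx (Function.update (stkContent st) 0 .blank)
    (0 + dirShift (some Dir.left)) w p) : Rep c xc hx (stkContent st.tail) 0 w p :=
  ⟨h.inp, by rw [← stk_pop]; exact TapeAt.shift (by simpa [dirShift] using h.stk), h.hd⟩

theorem Rep.push {st : List P.Stk} {s : P.Stk}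
    (h : Rep c xc hx (Function.update (stkContent st) 1 (.stk s)) 1 w p) :
    Rep c xc hx (stkContent (s :: st)) 0 w p :=
  ⟨h.inp, by rw [← stk_push]; exact TapeAt.shift h.stk, h.hd⟩

theorem Rep.cons_pos {x₀ : ℤ} {p₀ : H → ℤ} {cs : List (σ × (H → Γ))}
    (h : Rep c xc (x₀ - 1 - (cs.length : ℤ) + -1) sc sp w (fun h => p₀ h - 1 - cs.length + -1))
    (y : σ × (H → Γ)) :
    Rep c xc (x₀ - 1 - ((y :: cs).length : ℤ)) sc sp w
      (fun h => p₀ h - 1 - ((y :: cs).length : ℤ)) := by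
  have e : ∀ z : ℤ, z - 1 - ((y :: cs).length : ℤ) = z - 1 - (cs.length : ℤ) + -1 := by
    intro z; simp only [List.length_cons, Nat.cast_add, Nat.cast_one]; ring
  simp only [e]
  exact h

theorem init_inp (x : List σ) :
    ((machine P b main uni).init x).tape TapeIdx.inp = Tape.mk₁ (x.map Sym.inp) := if_pos rfl

theorem init_stk (x : List σ) :
    ((machine P b main uni).init x).tape TapeIdx.stk = Tape.mk₁ [] :=
  if_neg (by intro h; cases h)

theorem init_hd (x : List σ) (h : H) :
    ((machine P b main uni).init x).tape (TapeIdx.hd h) = Tape.mk₁ [] :=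
  if_neg (by intro h; cases h)

end Sweep
end NTM

/-! ### Soundness of the machine -/

namespace NTM
open Turing
namespace Sweep

variable {σ Γ H : Type} {P : PDA (σ × (H → Γ))} {b : ℕ} {main uni : H}

/-- The content of the input tape. -/
def inpContent (P : PDA (σ × (H → Γ))) (b : ℕ) (x : List σ) : ℤ → Sym σ Γ P.Stk b :=
  wordContent (x.map .inp)

/-- The block that ends before position `r` consists of the first `m` letters of `B`. -/
def BlkAt {S : Type} (w : ℤ → Sym σ Γ S b) (r : ℤ) (m : ℕ) (B : ℕ → Γ) : Prop :=
  ∀ k < m, w (r - m + k) = .blk (B k)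

/-- A successful sweep over the blocks that end at `r` and `u`. -/
def GoodAt (P : PDA (σ × (H → Γ))) (main uni : H) (x : List σ) (w : ℤ → Sym σ Γ P.Stk b)
    (r u : ℤ) : Prop :=
  ∃ V : H → ℕ → Γ, (∀ h, ∃ t, IsR (w t) ∧ BlkAt w t x.length (V h)) ∧
    BlkAt w r x.length (V main) ∧ BlkAt w u x.length (V uni) ∧ P.Accepts (sweepCols x V)

/-- Delimiters are where they are expected after the blocks have been written up to position
`n`. -/
structure Guessed {S : Type} (w : ℤ → Sym σ Γ S b) (n : ℤ) : Prop where
  pos : 0 < n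
  lft : ∀ i, w i = .lft ↔ i = 0
  rgt : ∀ i, w i ≠ .rgt
  isR : ∀ i, IsR (w i) → 0 < i ∧ i < n

/-- Delimiters are where they are expected on a tape that ends at position `e`. -/
structure Content {S : Type} (w : ℤ → Sym σ Γ S b) (e : ℤ) : Prop where
  lft : ∀ i, w i = .lft ↔ i = 0
  rgt : ∀ i, w i = .rgt ↔ i = e
  isR : ∀ i, IsR (w i) → 0 < i ∧ i ≤ e

/-- The columns `cs` have been read in a sweep that started at the given positions. -/
def ColsAt {S : Type} (xc : ℤ → Sym σ Γ S b) (x₀ : ℤ) (w : ℤ → Sym σ Γ S b) (p₀ : H → ℤ)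
    (cs : List (σ × (H → Γ))) : Prop :=
  ∀ i (hi : i < cs.length), xc (x₀ - cs.length + i) = .inp cs[i].1 ∧
    ∀ h, w (p₀ h - cs.length + i) = .blk (cs[i].2 h)

theorem ColsAt.cons {S : Type} {xc : ℤ → Sym σ Γ S b} {x₀ : ℤ} {w : ℤ → Sym σ Γ S b}
    {p₀ : H → ℤ} {cs : List (σ × (H → Γ))} (h : ColsAt xc x₀ w p₀ cs) {a : σ} {g : H → Γ}
    (ha : xc (x₀ - 1 - cs.length) = .inp a) (hg : ∀ h, w (p₀ h - 1 - cs.length) = .blk (g h)) :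
    ColsAt xc x₀ w p₀ ((a, g) :: cs) := by
  rintro (_ | i) hi
  · refine ⟨?_, fun h => ?_⟩
    · simp only [List.getElem_cons_zero]; rw [← ha]; congr 1; simp; ring
    · simp only [List.getElem_cons_zero]; rw [← hg]; congr 1; simp; ring
  · obtain ⟨h1, h2⟩ := h i (by simpa using hi)
    refine ⟨?_, fun h => ?_⟩
    · simp only [List.getElem_cons_succ]; rw [← h1]; congr 1; simp; ring
    · simp only [List.getElem_cons_succ]; rw [← h2]; congr 1; simp; ring

/-- The pairs of blocks that come before the pair `(r, u)`. -/
def DoneUpTo (P : PDA (σ × (H → Γ))) (main uni : H) (x : List σ) (w : ℤ → Sym σ Γ P.Stk b)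
    (r u : ℤ) : Prop :=
  ∀ r' u', IsR (w r') → IsR (w u') → (r < r' ∨ r' = r ∧ u < u') → GoodAt P main uni x w r' u'

theorem update_stk {st : List P.Stk} {sp : ℤ} :
    Function.update (stkContent st : ℤ → Sym σ Γ P.Stk b) sp (stkContent st sp) =
      stkContent st := by simp

theorem Guessed.step {S : Type} {w : ℤ → Sym σ Γ S b} {n : ℤ} (hw : Guessed w n)
    {s : Sym σ Γ S b} (h1 : s ≠ .lft) (h2 : s ≠ .rgt) :
    Guessed (Function.update w n s) (n + 1) := by
  have := hw.pos
  refine ⟨by omega, fun i => ?_, fun i => ?_, fun i => ?_⟩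
  · rw [Function.update_apply]; split_ifs with h
    · subst h; simp [h1, this.ne']
    · exact hw.lft i
  · rw [Function.update_apply]; split_ifs with h
    · exact h2
    · exact hw.rgt i
  · rw [Function.update_apply]; split_ifs with h
    · intro; omega
    · intro hi; have := hw.isR i hi; omega

theorem Guessed.finish {S : Type} {w : ℤ → Sym σ Γ S b} {n : ℤ} (hw : Guessed w n) :
    Content (Function.update w n .rgt) n := by
  have := hw.pos
  refine ⟨fun i => ?_, fun i => ?_, fun i => ?_⟩
  · rw [Function.update_apply]; split_ifs with h
    · subst h; simp [this.ne']
    · exact hw.lft i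
  · rw [Function.update_apply]; split_ifs with h
    · simp [h]
    · simp [h, hw.rgt i]
  · rw [Function.update_apply]; split_ifs with h
    · intro; omega
    · intro hi; have := hw.isR i hi; omega

theorem not_isR_blk {S : Type} {s : Sym σ Γ S b} (h : IsR s) (g : Γ) : s ≠ .blk g := by
  rcases h with rfl | rfl <;> simp

theorem inpContent_ne_blank {x : List σ} {i : ℤ} :
    inpContent P b x i ≠ .blank ↔ 0 ≤ i ∧ i < x.length := by
  by_cases hi : 0 ≤ i
  · obtain ⟨n, rfl⟩ := Int.eq_ofNat_of_zero_le hi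
    by_cases hn : n < x.length
    · simp [inpContent, wordContent, hn, List.getI_eq_getElem]
    · simp only [inpContent, wordContent, hi, if_true, Int.toNat_natCast, true_and, Nat.cast_lt, hn,
        iff_false, not_not]
      rw [List.getI_eq_default _ (by simpa using hn)]; rfl
  · simp only [inpContent, wordContent, hi, if_false, false_and, iff_false, not_not]; rfl

/-- A finished sweep checks the blocks to the left of its starting positions. -/
theorem goodAt_of_sweep (hP : ∀ q ∈ P.start, q ∉ P.acc) {x : List σ}
    {w : ℤ → Sym σ Γ P.Stk b} {q : P.Q} {x₀ : ℤ} {p₀ : H → ℤ} {cs : List (σ × (H → Γ))}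
    (hx₀ : inpContent P b x x₀ = .blank) (hr : ∀ h, IsR (w (p₀ h)))
    (hcs : ColsAt (inpContent P b x) x₀ w p₀ cs) (hrun : P.Run cs q []) (hq : q ∈ P.acc)
    (hl : inpContent P b x (x₀ - 1 - cs.length) = .blank) :
    GoodAt P main uni x w (p₀ main) (p₀ uni) ∧ cs ≠ [] := by
  have hne : cs ≠ [] := by
    rintro rfl
    cases hrun with
    | nil h => exact hP q h hq
  have hpos : 0 < cs.length := List.length_pos_iff.2 hne
  have h1 : ∀ i, i < cs.length → 0 ≤ x₀ - cs.length + i ∧ x₀ - cs.length + i < x.length := by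
    intro i hi
    rw [← inpContent_ne_blank (P := P) (b := b), (hcs i hi).1]; simp
  have h2 := h1 0 hpos
  have h3 := h1 (cs.length - 1) (by omega)
  have h4 : ¬ (0 ≤ x₀ ∧ x₀ < x.length) := by
    rw [← inpContent_ne_blank (P := P) (b := b)]; simpa using hx₀
  have h5 : ¬ (0 ≤ x₀ - 1 - cs.length ∧ x₀ - 1 - cs.length < x.length) := by
    rw [← inpContent_ne_blank (P := P) (b := b)]; simpa using hl
  have hlen : cs.length = x.length := by omega
  have hx₀' : x₀ = x.length := by omega
  let V : H → ℕ → Γ := fun h i => if hi : i < cs.length then cs[i].2 h else cs[0].2 h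
  have hV : ∀ h, BlkAt w (p₀ h) x.length (V h) := by
    intro h k hk
    have hk' : k < cs.length := by omega
    have := (hcs k hk').2 h
    simp only [V, hk', dif_pos]
    rw [← this, hlen]
  refine ⟨⟨V, fun h => ⟨_, hr h, hV h⟩, hV main, hV uni, q, hq, ?_⟩, hne⟩
  have : sweepCols x V = cs := by
    apply List.ext_getElem (by simp [sweepCols, hlen])
    intro i h1 h2
    have h3 := (hcs i h2).1
    have h4 : i < x.length := by omega
    have h5 : inpContent P b x (x₀ - cs.length + i) = .inp x[i] := by
      have : x₀ - cs.length + i = (i : ℕ) := by omega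
      rw [this]
      simp [inpContent, wordContent, h4, List.getI_eq_getElem]
    rw [h5] at h3
    injection h3 with h3
    simp only [sweepCols, List.getElem_mapIdx]
    ext1
    · exact h3
    · funext h; simp [V, h2]
  rwa [this]

theorem ColsAt.blk {S : Type} {xc : ℤ → Sym σ Γ S b} {x₀ : ℤ} {w : ℤ → Sym σ Γ S b}
    {p₀ : H → ℤ} {cs : List (σ × (H → Γ))} (hcs : ColsAt xc x₀ w p₀ cs) (h : H) (i : ℤ)
    (h1 : p₀ h - 1 - cs.length < i) (h2 : i < p₀ h) : ∃ g, w i = .blk g := by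
  obtain ⟨n, hn⟩ := Int.eq_ofNat_of_zero_le (show 0 ≤ i - (p₀ h - cs.length) by omega)
  have := (hcs n (by omega)).2 h
  exact ⟨_, by rw [← this]; congr 1; omega⟩

/-- After a sweep, the next pair of blocks is due. -/
theorem DoneUpTo.next {x : List σ} {w : ℤ → Sym σ Γ P.Stk b} {x₀ : ℤ} {p₀ : H → ℤ}
    {cs : List (σ × (H → Γ))} (hD : DoneUpTo P main uni x w (p₀ main) (p₀ uni))
    (hcs : ColsAt (inpContent P b x) x₀ w p₀ cs)
    (hgood : GoodAt P main uni x w (p₀ main) (p₀ uni)) :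
    DoneUpTo P main uni x w (p₀ main) (p₀ uni - 1 - cs.length) := by
  intro r' u' h1 h2 h3
  rcases h3 with h3 | ⟨rfl, h3⟩
  · exact hD _ _ h1 h2 (Or.inl h3)
  · rcases lt_trichotomy (p₀ uni) u' with h | h | h
    · exact hD _ _ h1 h2 (Or.inr ⟨rfl, h⟩)
    · rwa [← h]
    · obtain ⟨g, hg⟩ := hcs.blk uni u' h3 h
      exact absurd hg (not_isR_blk h2 g)

/-- After a sweep over the first block of the tape `uni`, the next block of the tape `main` is
due. -/
theorem DoneUpTo.reset {x : List σ} {w : ℤ → Sym σ Γ P.Stk b} {x₀ : ℤ} {p₀ : H → ℤ} {e : ℤ}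
    (hw : Content w e) {cs : List (σ × (H → Γ))}
    (hD : DoneUpTo P main uni x w (p₀ main) (p₀ uni - 1 - cs.length))
    (hcs : ColsAt (inpContent P b x) x₀ w p₀ cs) (hu : w (p₀ uni - 1 - cs.length) = .lft)
    (r' u' : ℤ) (h1 : IsR (w r')) (h2 : IsR (w u')) (h3 : p₀ main - 1 - cs.length < r') :
    GoodAt P main uni x w r' u' := by
  have h0 := (hw.lft _).1 hu
  rw [h0] at hD
  rcases lt_trichotomy (p₀ main) r' with h | h | h
  · exact hD _ _ h1 h2 (Or.inl h)
  · exact hD _ _ h1 h2 (Or.inr ⟨h.symm, (hw.isR _ h2).1⟩)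
  · obtain ⟨g, hg⟩ := hcs.blk main r' h3 h
    exact absurd hg (not_isR_blk h1 g)

variable [Finite σ] [Finite Γ] [Finite H]

/-- The invariant of the machine on input `x`. -/
inductive Inv (x : List σ) : (machine P b main uni).Cfg → Prop
  | first {c} (hs : c.state = State.first)
      (h : Rep c (inpContent P b x) 0 (stkContent []) 0 (fun _ => .blank) (fun _ => 0)) : Inv x c
  | guess {c} {w : ℤ → Sym σ Γ P.Stk b} {n : ℤ} (hs : c.state = State.guess)
      (h : Rep c (inpContent P b x) 0 (stkContent []) 0 w (fun _ => n)) (hw : Guessed w n) : Inv x c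
  | wander {c} {w : ℤ → Sym σ Γ P.Stk b} {e : ℤ} {r : Bool} {hx : ℤ} {p : H → ℤ} {t : ℤ}
      (hs : c.state = State.wander r) (h : Rep c (inpContent P b x) hx (stkContent []) 0 w p)
      (hw : Content w e) (ht : IsR (w t)) (hle : p main ≤ t)
      (hblk : ∀ i, p main ≤ i → i < t → ∃ g, w i = .blk g)
      (hu : r = false → IsR (w (p uni)) ∧ DoneUpTo P main uni x w t (p uni))
      (hu' : r = true → DoneUpTo P main uni x w t e) : Inv x c
  | sweep {c} {w : ℤ → Sym σ Γ P.Stk b} {e : ℤ} {q : P.Q} {x₀ : ℤ} {p₀ : H → ℤ}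
      {cs : List (σ × (H → Γ))} {st : List P.Stk} (hs : c.state = State.sweep q)
      (h : Rep c (inpContent P b x) (x₀ - 1 - cs.length) (stkContent st) 0 w
        (fun h => p₀ h - 1 - cs.length))
      (hw : Content w e) (hx₀ : inpContent P b x x₀ = .blank) (hr : ∀ h, IsR (w (p₀ h)))
      (hcs : ColsAt (inpContent P b x) x₀ w p₀ cs) (hP : P.Run cs q st)
      (hD : DoneUpTo P main uni x w (p₀ main) (p₀ uni)) : Inv x c
  | push {c} {w : ℤ → Sym σ Γ P.Stk b} {e : ℤ} {q : P.Q} {s : P.Stk} {x₀ : ℤ} {p₀ : H → ℤ}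
      {cs : List (σ × (H → Γ))} {st : List P.Stk} (hs : c.state = State.push q s)
      (h : Rep c (inpContent P b x) (x₀ - 1 - cs.length) (stkContent st) 1 w
        (fun h => p₀ h - 1 - cs.length))
      (hw : Content w e) (hx₀ : inpContent P b x x₀ = .blank) (hr : ∀ h, IsR (w (p₀ h)))
      (hcs : ColsAt (inpContent P b x) x₀ w p₀ cs) (hP : P.Run cs q (s :: st))
      (hD : DoneUpTo P main uni x w (p₀ main) (p₀ uni)) : Inv x c
  | done {c} {w : ℤ → Sym σ Γ P.Stk b} {e : ℤ} (hs : c.state = State.done) (hw : Content w e)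
      (he : IsR (w e)) (hD : ∀ r u, IsR (w r) → IsR (w u) → GoodAt P main uni x w r u) : Inv x c

theorem inv_init (x : List σ) : Inv x ((machine P b main uni).init x) := by
  have hblank : (wordContent ([] : List (Sym σ Γ P.Stk b))) = fun _ => .blank := by
    funext i; simp [wordContent]; rfl
  have hstk : (stkContent ([] : List P.Stk) : ℤ → Sym σ Γ P.Stk b) = fun _ => .blank := by
    funext i; simp [stkContent]
  refine .first rfl ⟨?_, ?_, fun h => ?_⟩
  · rw [init_inp]; exact tapeAt_mk₁ (x.map Sym.inp)
  · rw [init_stk, hstk, ← hblank]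
    exact tapeAt_mk₁ ([] : List (Sym σ Γ P.Stk b))
  · rw [init_hd, ← hblank]
    exact tapeAt_mk₁ ([] : List (Sym σ Γ P.Stk b))

/-- The moves of the machine preserve the invariant. The heads for blocks that are not `main` or
`uni` may be anywhere; the tests of the delimiters at the ends of a sweep make sure that they have
been at whole blocks. -/
theorem inv_step (hmu : main ≠ uni) (hP : ∀ q ∈ P.start, q ∉ P.acc) {x : List σ}
    {c c' : (machine P b main uni).Cfg} (hi : Inv x c) (hs : (machine P b main uni).Step c c') :
    Inv x c' := by
  cases hi with
  | first hst h =>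
    rw [h.step_iff, hst] at hs
    obtain ⟨q', i, s, a, hm, rfl⟩ := hs
    cases hm
    refine .guess (n := 0 + 1) rfl (by
      simpa [reads, dirShift_none, dirShift_right] using h.after_write State.guess none
        (stkContent [] 0, none) (some Dir.right) .lft (n := 0) (fun _ => rfl)) ⟨by omega,
        fun i => ?_, fun i => ?_, fun i => ?_⟩
    · rw [Function.update_apply]; split_ifs with h <;> simp [h]
    · rw [Function.update_apply]; split_ifs with h <;> simp
    · rw [Function.update_apply]; split_ifs with h <;> simp [IsR]
  | @guess w n hst h hw =>
    rw [h.step_iff, hst] at hs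
    obtain ⟨q', i, s, a, hm, rfl⟩ := hs
    cases hm with
    | letter _ g =>
      refine .guess (n := n + 1) rfl (by
        simpa [reads, dirShift_none, dirShift_right] using h.after_write State.guess none
          (stkContent [] 0, none) (some Dir.right) (.blk g) (fun _ => rfl))
          (hw.step (by simp) (by simp))
    | sep =>
      refine .guess (n := n + 1) rfl (by
        simpa [reads, dirShift_none, dirShift_right] using h.after_write State.guess none
          (stkContent [] 0, none) (some Dir.right) .sep (fun _ => rfl))
          (hw.step (by simp) (by simp))
    | last =>
      have hc := hw.finish
      have hR : IsR ((Function.update w n Sym.rgt) n) := by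
        rw [Function.update_self]; exact Or.inr rfl
      refine .wander (t := n) (r := false) rfl (by
        simpa [reads, dirShift_none, dirShift_right] using h.after_write (State.wander false) none
          (stkContent [] 0, none) none .rgt (fun _ => rfl)) hc hR le_rfl
          (fun i h1 h2 => absurd h1 (by omega)) (fun _ => ⟨hR, ?_⟩) (by simp)
      intro r' u' h1 h2 h3
      have := hc.isR _ h1
      have := hc.isR _ h2
      omega
  | @wander w e r hx p t hst h hw ht hle hblk hu hu' =>
    rw [h.step_iff, hst] at hs
    obtain ⟨q', i, s, a, hm, rfl⟩ := hs
    cases hm with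
    | wander _ _ r' i d hmain huni =>
      have hrep := h.after_move (State.wander r') i (stkContent [] 0, none) d
      simp only [update_stk, dirShift_none, add_zero] at hrep
      have hm : p main + dirShift (d main) ≤ t ∧ p main ≤ p main + dirShift (d main) := by
        rcases hmain with ⟨⟨g, hg⟩, hd⟩ | ⟨hg, hd⟩
        · have : p main ≠ t := by
            rintro h'
            rw [← h'] at ht
            exact not_isR_blk ht g hg
          rw [hd]; simp only [dirShift_right]; omega
        · rw [hd]; simp only [dirShift_none]; omega
      refine .wander (t := t) rfl hrep hw ht hm.1 (fun i h1 h2 => hblk i (hm.2.trans h1) h2) ?_ ?_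
      · rintro rfl
        rcases huni with ⟨-, h1, -⟩ | ⟨h1, -, h2, h3⟩ | ⟨h1, -, h3⟩
        · simp at h1
        · have h4 : p uni = e := (hw.rgt _).1 h2
          rw [h3]
          simp only [dirShift_none, add_zero]
          exact ⟨Or.inr h2, by rw [h4]; exact hu' h1⟩
        · rw [h3]; simp only [dirShift_none, add_zero]; exact hu h1
      · rintro rfl
        rcases huni with ⟨h1, -, -⟩ | ⟨-, h1, -⟩ | ⟨-, h1, -⟩
        · exact hu' h1
        · simp at h1
        · simp at h1
    | start _ q hq hx' hr =>
      have hrep := h.after_move (State.sweep q) (some Dir.left) (stkContent [] 0, none)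
        (fun _ => some Dir.left)
      simp only [update_stk, dirShift_none, dirShift_left, add_zero] at hrep
      have hpt : p main = t := by
        by_contra hne
        obtain ⟨g, hg⟩ := hblk (p main) le_rfl (by omega)
        exact not_isR_blk (hr main) g hg
      refine .sweep (cs := []) (x₀ := hx) (p₀ := p) rfl (by
        simpa [sub_eq_add_neg, reads] using hrep) hw hx' hr (by intro i hi; simp at hi) (.nil hq) ?_
      rw [hpt]
      exact (hu rfl).2
  | @sweep w e q x₀ p₀ cs st hst h hw hx₀ hr hcs hrun hD =>
    rw [h.step_iff, hst] at hs
    obtain ⟨q', i, s, a, hm, rfl⟩ := hs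
    cases hm with
    | nop _ _ q' a g hx hg hd =>
      have hrep := h.after_move (State.sweep q') (some Dir.left) (stkContent st 0, none)
        (fun _ => some Dir.left)
      simp only [update_stk, dirShift_none, dirShift_left, add_zero] at hrep
      simp only [reads, topOf_stkContent] at hd hx hg
      refine .sweep (cs := (a, g) :: cs) (x₀ := x₀) (p₀ := p₀) rfl
        (hrep.cons_pos _) hw hx₀ hr (hcs.cons hx hg) (.cons hrun hd) hD
    | pop _ _ q' a g hx hg hd =>
      have hrep := h.after_move (State.sweep q') (some Dir.left) (.blank, some Dir.left)
        (fun _ => some Dir.left)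
      have hrep := hrep.pop
      simp only [dirShift_left] at hrep
      simp only [reads, topOf_stkContent] at hd hx hg
      refine .sweep (cs := (a, g) :: cs) (x₀ := x₀) (p₀ := p₀) rfl
        (hrep.cons_pos _) hw hx₀ hr (hcs.cons hx hg) (.cons hrun hd) hD
    | push _ _ q' a g s hx hg hd =>
      have hrep := h.after_move (State.push q' s) (some Dir.left) (stkContent st 0, some Dir.right)
        (fun _ => some Dir.left)
      simp only [update_stk, dirShift_left, dirShift_right, zero_add] at hrep
      simp only [reads, topOf_stkContent] at hd hx hg
      refine .push (cs := (a, g) :: cs) (x₀ := x₀) (p₀ := p₀) (st := st) rfl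
        (hrep.cons_pos _) hw hx₀ hr (hcs.cons hx hg) (.cons hrun hd) hD
    | next _ _ hq hx hs hl hus d hd hd' =>
      simp only [reads] at hx hs hl hus
      obtain rfl := stkContent_zero_eq_blank.1 hs
      obtain ⟨hgood, hne⟩ := goodAt_of_sweep (main := main) (uni := uni) hP hx₀ hr hcs hrun hq hx
      have hpos : 0 < cs.length := List.length_pos_iff.2 hne
      have hrep := h.after_move (State.wander false) none (stkContent [] 0, none) d
      simp only [update_stk, dirShift_none, add_zero] at hrep
      have hm : p₀ main - 1 - (cs.length : ℤ) + dirShift (d main) = p₀ main - cs.length := by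
        rw [hd]; simp only [dirShift_right]; ring
      refine .wander (t := p₀ main) rfl hrep hw (hr main) (by rw [hm]; omega) ?_ (fun _ => ?_)
        (by simp)
      · intro i h1 h2
        rw [hm] at h1
        exact hcs.blk main i (by omega) h2
      · rw [hd' uni hmu.symm]
        simp only [dirShift_none, add_zero]
        exact ⟨Or.inl hus, hD.next hcs hgood⟩
    | reset _ _ hq hx hs hl hus hm =>
      simp only [reads] at hx hs hl hus hm
      obtain rfl := stkContent_zero_eq_blank.1 hs
      obtain ⟨hgood, hne⟩ := goodAt_of_sweep (main := main) (uni := uni) hP hx₀ hr hcs hrun hq hx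
      have hrep := h.after_move (State.wander true) none (stkContent [] 0, none) (fun _ => none)
      simp only [update_stk, dirShift_none, add_zero] at hrep
      refine .wander (t := p₀ main - 1 - cs.length) rfl hrep hw (Or.inl hm) le_rfl
        (fun i h1 h2 => absurd h1 (by omega)) (by simp) (fun _ => ?_)
      intro r' u' h1 h2 h3
      rcases h3 with h3 | ⟨-, h3⟩
      · exact (hD.next hcs hgood).reset hw hcs hus r' u' h1 h2 h3
      · exact absurd (hw.isR _ h2).2 (by omega)
    | done _ _ hq hx hs hl hus hm =>
      simp only [reads] at hx hs hl hus hm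
      obtain rfl := stkContent_zero_eq_blank.1 hs
      obtain ⟨hgood, hne⟩ := goodAt_of_sweep (main := main) (uni := uni) hP hx₀ hr hcs hrun hq hx
      refine .done rfl hw (Or.inr ((hw.rgt _).2 rfl)) (fun r' u' h1 h2 => ?_)
      refine (hD.next hcs hgood).reset hw hcs hus r' u' h1 h2 ?_
      have := (hw.lft _).1 hm
      have := (hw.isR _ h1).1
      omega
  | @push w e q s x₀ p₀ cs st hst h hw hx₀ hr hcs hrun hD =>
    rw [h.step_iff, hst] at hs
    obtain ⟨q', i, s, a, hm, rfl⟩ := hs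
    cases hm
    have hrep := h.after_move (State.sweep q) none (.stk s, none) (fun _ => none)
    simp only [dirShift_none, add_zero] at hrep
    exact .sweep rfl hrep.push hw hx₀ hr hcs hrun hD
  | done hst hw he hD =>
    obtain ⟨A, hA, -⟩ := hs
    rw [hst, machine_trans_done] at hA
    exact hA.elim

theorem inv_run (hmu : main ≠ uni) (hP : ∀ q ∈ P.start, q ∉ P.acc) {x : List σ} {m : ℕ}
    {c c' : (machine P b main uni).Cfg} (hr : (machine P b main uni).Run m c c') (hi : Inv x c) :
    Inv x c' := by
  induction hr with
  | refl => exact hi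
  | tail _ hs ih => exact inv_step hmu hP (ih hi) hs

/-- If the machine accepts, then there is a set of blocks as required. -/
theorem machine_sound (hmu : main ≠ uni) (hP : ∀ q ∈ P.start, q ∉ P.acc) {x : List σ}
    (h : (machine P b main uni).Accepts x) :
    ∃ D : Set (ℕ → Γ), D.Nonempty ∧ ∀ B ∈ D, ∀ C ∈ D, ∃ V : H → ℕ → Γ, V main = B ∧ V uni = C ∧
      (∀ h, V h ∈ D) ∧ P.Accepts (sweepCols x V) := by
  classical
  obtain ⟨m, c, hrun, -, hc⟩ := h
  have hi := inv_run hmu hP hrun (inv_init x)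
  replace hc : c.state = State.done := hc
  cases hi with
  | first hs => rw [hs] at hc; cases hc
  | guess hs => rw [hs] at hc; cases hc
  | wander hs => rw [hs] at hc; cases hc
  | sweep hs => rw [hs] at hc; cases hc
  | push hs => rw [hs] at hc; cases hc
  | @done w e hs hw he hD =>
    refine ⟨{B | ∃ t, IsR (w t) ∧ BlkAt w t x.length B}, ?_, ?_⟩
    · obtain ⟨V, -, h, -⟩ := hD e e he he
      exact ⟨_, e, he, h⟩
    · clear hrun
      rintro B ⟨r, hr, hB⟩ C ⟨u, hu, hC⟩
      obtain ⟨V, hV, hm, hu', hacc⟩ := hD r u hr hu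
      let V' : H → ℕ → Γ := Function.update (Function.update V uni C) main B
      refine ⟨V', by simp [V'], by simp [V', Function.update_of_ne hmu.symm], fun h => ?_, ?_⟩
      · by_cases h1 : h = main
        · subst h1; simp only [V', Function.update_self]; exact ⟨r, hr, hB⟩
        · by_cases h2 : h = uni
          · subst h2
            simp only [V', Function.update_of_ne h1, Function.update_self]; exact ⟨u, hu, hC⟩
          · simp only [V', Function.update_of_ne h1, Function.update_of_ne h2]; exact hV h
      · rw [sweepCols_congr (V' := V)]
        · exact hacc
        · intro h k hk
          by_cases h1 : h = main
          · subst h1; simp only [V', Function.update_self]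
            have := (hm k hk).symm.trans (hB k hk); injection this with this; exact this.symm
          · by_cases h2 : h = uni
            · subst h2
              simp only [V', Function.update_of_ne h1, Function.update_self]
              have := (hu' k hk).symm.trans (hC k hk); injection this with this; exact this.symm
            · simp only [V', Function.update_of_ne h1, Function.update_of_ne h2]

end Sweep
end NTM

/-! ### Runs of the machine -/

namespace NTM
open Turing

/-- Some run of at most `k` steps leads from `c` to `c'`. -/
def Reaches {σ : Type} (M : NTM σ) (k : ℕ) (c c' : M.Cfg) : Prop := ∃ j ≤ k, M.Run j c c'

theorem Reaches.trans {σ : Type} {M : NTM σ} {k l : ℕ} {c d e : M.Cfg} (h : Reaches M k c d)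
    (h' : Reaches M l d e) : Reaches M (k + l) c e := by
  obtain ⟨i, hi, h⟩ := h
  obtain ⟨j, hj, h'⟩ := h'
  exact ⟨i + j, by omega, run_trans h h'⟩

theorem Reaches.step {σ : Type} {M : NTM σ} {k : ℕ} {c d e : M.Cfg} (h : Reaches M k c d)
    (h' : M.Step d e) : Reaches M (k + 1) c e := by
  obtain ⟨i, hi, h⟩ := h
  exact ⟨i + 1, by omega, .tail h h'⟩

theorem Reaches.mono {σ : Type} {M : NTM σ} {k l : ℕ} {c d : M.Cfg} (h : Reaches M k c d)
    (hkl : k ≤ l) : Reaches M l c d := by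
  obtain ⟨i, hi, h⟩ := h
  exact ⟨i, by omega, h⟩

theorem Reaches.refl {σ : Type} {M : NTM σ} (c : M.Cfg) (k : ℕ) : Reaches M k c c :=
  ⟨0, by omega, .refl c⟩

namespace Sweep

variable {σ Γ H : Type} {P : PDA (σ × (H → Γ))} {b : ℕ} {main uni : H}

/-- The direction from `a` to `t`. -/
def dirTo (a t : ℤ) : Option Dir :=
  if a < t then some Dir.right else if t < a then some Dir.left else none

theorem dirTo_self (a : ℤ) : dirTo a a = none := by simp [dirTo]

theorem dirTo_bound {a t : ℤ} {K : ℕ} (h : |t - a| ≤ (K + 1 : ℕ)) :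
    |t - (a + dirShift (dirTo a t))| ≤ K := by
  rw [abs_le] at h ⊢
  push_cast at h
  unfold dirTo
  split_ifs <;> simp only [dirShift_none, dirShift_left, dirShift_right] <;> constructor <;> omega

theorem ColsAt.uncons {xc w : ℤ → Sym σ Γ P.Stk b} {x₀ : ℤ} {p₀ : H → ℤ}
    {y : σ × (H → Γ)} {cs : List (σ × (H → Γ))} (h : ColsAt xc x₀ w p₀ (y :: cs)) : ColsAt xc x₀ w p₀ cs ∧
      xc (x₀ - 1 - cs.length) = .inp y.1 ∧ ∀ h, w (p₀ h - 1 - cs.length) = .blk (y.2 h) := by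
  refine ⟨fun i hi => ?_, ?_, fun k => ?_⟩
  · obtain ⟨h1, h2⟩ := h (i + 1) (by simpa using hi)
    simp only [List.getElem_cons_succ, List.length_cons] at h1 h2
    refine ⟨?_, fun k => ?_⟩
    · rw [← h1]; congr 1; push_cast; ring
    · rw [← h2]; congr 1; push_cast; ring
  · obtain ⟨h1, h2⟩ := h 0 (by simp)
    simp only [List.getElem_cons_zero, List.length_cons] at h1 h2
    rw [← h1]; congr 1; push_cast; ring
  · obtain ⟨h1, h2⟩ := h 0 (by simp)
    simp only [List.getElem_cons_zero, List.length_cons] at h1 h2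
    rw [← h2]; congr 1; push_cast; ring

section runs
variable [Finite σ] [Finite Γ] [Finite H]
variable {xc : ℤ → Sym σ Γ P.Stk b} {w : ℤ → Sym σ Γ P.Stk b}

/-- Between two sweeps, the heads can be moved to any blocks. -/
theorem wander_reach (p' : H → ℤ) (hx' : ℤ) (hend : ∀ g, w (p' main) ≠ .blk g) : ∀ (K : ℕ)
    (c : (machine P b main uni).Cfg) (hx : ℤ) (p : H → ℤ), c.state = State.wander false →
    Rep c xc hx (stkContent []) 0 w p → |hx' - hx| ≤ K → (∀ h, |p' h - p h| ≤ K) →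
    p uni = p' uni → p main ≤ p' main → (∀ j, p main ≤ j → j < p' main → ∃ g, w j = .blk g) →
    ∃ c', Reaches (machine P b main uni) K c c' ∧ c'.state = State.wander false ∧
      Rep c' xc hx' (stkContent []) 0 w p'
  | 0, c, hx, p, hc, h, h1, h2, h3, h4, h5 => by
    obtain rfl : hx' = hx := by
      rw [abs_le] at h1; omega
    obtain rfl : p' = p := by
      funext i
      have := abs_le.1 (h2 i); omega
    exact ⟨c, .refl c _, hc, h⟩
  | K + 1, c, hx, p, hc, h, h1, h2, h3, h4, h5 => by
    let d : H → Option Dir := fun i => dirTo (p i) (p' i)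
    have hrep := h.after_move (State.wander false) (dirTo hx hx') (stkContent [] 0, none) d
    simp only [update_stk, dirShift_none, add_zero] at hrep
    have hstep : (machine P b main uni).Step c (after c (State.wander false) (dirTo hx hx')
        (stkContent [] 0, none) (fun k => (w (p k), d k))) := by
      rw [h.step_iff, hc]
      refine ⟨_, _, _, _, .wander _ false false (dirTo hx hx') d ?_ ?_, rfl⟩
      · rcases h4.lt_or_eq with h6 | h6
        · exact Or.inl ⟨h5 _ le_rfl h6, by simp [d, dirTo, h6]⟩
        · refine Or.inr ⟨fun g => ?_, by simp [d, dirTo, h6]⟩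
          simp only [reads, h6]; exact hend g
      · exact Or.inr (Or.inr ⟨rfl, rfl, by simp [d, h3, dirTo_self]⟩)
    have hmain : p main ≤ p main + dirShift (d main) ∧ p main + dirShift (d main) ≤ p' main := by
      simp only [d, dirTo]
      split_ifs <;> simp only [dirShift_none, dirShift_left, dirShift_right] <;> omega
    obtain ⟨c', h6, h7, h8⟩ := wander_reach p' hx' hend K _ _ _ rfl hrep (dirTo_bound h1)
      (fun i => dirTo_bound (h2 i)) (by simp [d, h3, dirTo_self, dirShift_none])
      hmain.2 (fun j h6 h7 => h5 j (hmain.1.trans h6) h7)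
    refine ⟨c', ?_, h7, h8⟩
    rw [add_comm]
    exact Reaches.trans ⟨1, le_rfl, .tail (.refl _) hstep⟩ h6

/-- The head `uni` can be moved back to the right end of its tape. -/
theorem reset_reach (hmu : main ≠ uni) {e : ℤ} (he : w e = .rgt) : ∀ (K : ℕ)
    (c : (machine P b main uni).Cfg) (hx : ℤ) (p : H → ℤ), c.state = State.wander true →
    Rep c xc hx (stkContent []) 0 w p → p uni = e - K → (∀ g, w (p main) ≠ .blk g) →
    ∃ (c' : (machine P b main uni).Cfg) (p' : H → ℤ), Reaches (machine P b main uni) (K + 1) c c' ∧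
      c'.state = State.wander false ∧
      Rep c' xc hx (stkContent []) 0 w p' ∧ p' uni = e ∧ ∀ h, h ≠ uni → p' h = p h
  | 0, c, hx, p, hc, h, h1, h2 => by
    classical
    have hrep := h.after_move (State.wander false) none (stkContent [] 0, none) (fun _ => none)
    simp only [update_stk, dirShift_none, add_zero] at hrep
    have h1' : p uni = e := by simpa using h1
    refine ⟨_, p, ⟨1, le_rfl, .tail (.refl _) (h.step_iff.2 ?_)⟩, rfl, hrep, h1', fun _ _ => rfl⟩
    rw [hc]
    refine ⟨_, _, _, _, .wander _ true false none (fun _ => none) (Or.inr ⟨h2, rfl⟩)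
      (Or.inr (Or.inl ⟨rfl, rfl, ?_, rfl⟩)), rfl⟩
    simp only [reads]; rw [h1', he]
  | K + 1, c, hx, p, hc, h, h1, h2 => by
    classical
    let d : H → Option Dir := fun i => if i = uni then some Dir.right else none
    have hrep := h.after_move (State.wander true) none (stkContent [] 0, none) d
    simp only [update_stk, dirShift_none, add_zero] at hrep
    have hstep : (machine P b main uni).Step c (after c (State.wander true) none
        (stkContent [] 0, none) (fun k => (w (p k), d k))) := by
      rw [h.step_iff, hc]
      exact ⟨_, _, _, _, .wander _ true true none d (Or.inr ⟨h2, by simp [d, hmu]⟩)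
        (Or.inl ⟨rfl, rfl, by simp [d]⟩), rfl⟩
    have hd : ∀ i, i ≠ uni → p i + dirShift (d i) = p i := by
      intro i hi; simp [d, hi, dirShift_none]
    obtain ⟨c', p', h6, h7, h8, h9, h10⟩ := reset_reach hmu he K _ _ _ rfl hrep
      (by simp only [d, if_true, h1, dirShift_right]; push_cast; ring) (by rwa [hd main hmu])
    refine ⟨c', p', ?_, h7, h8, h9, fun i hi => (h10 i hi).trans (hd i hi)⟩
    rw [add_comm]
    exact Reaches.trans ⟨1, le_rfl, .tail (.refl _) hstep⟩ h6

/-- A run of the automaton is a sweep of the machine. -/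
theorem sweep_reach {c : (machine P b main uni).Cfg} {x₀ : ℤ} {p₀ : H → ℤ}
    (hc : c.state = State.wander false) (h : Rep c xc x₀ (stkContent []) 0 w p₀)
    (hx₀ : xc x₀ = .blank) (hr : ∀ h, IsR (w (p₀ h))) {cs : List (σ × (H → Γ))} {q : P.Q}
    {st : List P.Stk} (hrun : P.Run cs q st) (hcs : ColsAt xc x₀ w p₀ cs) :
    ∃ c', Reaches (machine P b main uni) (2 * cs.length + 1) c c' ∧ c'.state = State.sweep q ∧
      Rep c' xc (x₀ - 1 - cs.length) (stkContent st) 0 w (fun h => p₀ h - 1 - cs.length) := by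
  induction hrun with
  | @nil q hq =>
    have hrep := h.after_move (State.sweep q) (some Dir.left) (stkContent [] 0, none)
      (fun _ => some Dir.left)
    simp only [update_stk, dirShift_none, dirShift_left, add_zero] at hrep
    refine ⟨_, ⟨1, by simp, .tail (.refl _) (h.step_iff.2 ?_)⟩, rfl, by
      simpa [sub_eq_add_neg] using hrep⟩
    rw [hc]
    exact ⟨_, _, _, _, .start _ q hq hx₀ hr, rfl⟩
  | @cons y cs q q' st op hrun hs ih =>
    obtain ⟨hcs', hy1, hy2⟩ := hcs.uncons
    obtain ⟨c₁, h1, h2, h3⟩ := ih hcs'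
    cases op with
    | nop =>
      have hrep := h3.after_move (State.sweep q') (some Dir.left) (stkContent st 0, none)
        (fun _ => some Dir.left)
      simp only [update_stk, dirShift_none, dirShift_left, add_zero] at hrep
      refine ⟨_, (h1.step (h3.step_iff.2 ?_)).mono (by simp), rfl, hrep.cons_pos y⟩
      rw [h2]
      exact ⟨_, _, _, _, .nop _ q q' y.1 y.2 hy1 hy2 (by
        simpa only [reads, topOf_stkContent] using hs), rfl⟩
    | pop =>
      have hrep := (h3.after_move (State.sweep q') (some Dir.left) (.blank, some Dir.left)
        (fun _ => some Dir.left)).pop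
      simp only [dirShift_left] at hrep
      refine ⟨_, (h1.step (h3.step_iff.2 ?_)).mono (by simp), rfl, hrep.cons_pos y⟩
      rw [h2]
      exact ⟨_, _, _, _, .pop _ q q' y.1 y.2 hy1 hy2 (by
        simpa only [reads, topOf_stkContent] using hs), rfl⟩
    | push s =>
      have hrep := h3.after_move (State.push q' s) (some Dir.left) (stkContent st 0, some Dir.right)
        (fun _ => some Dir.left)
      simp only [update_stk, dirShift_left, dirShift_right, zero_add] at hrep
      have hrep₂ := hrep.after_move (State.sweep q') none (.stk s, none) (fun _ => none)
      simp only [dirShift_none, add_zero] at hrep₂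
      refine ⟨_, ((h1.step (h3.step_iff.2 ?_)).step (hrep.step_iff.2 ?_)).mono (by simp; omega),
        rfl, hrep₂.push.cons_pos y⟩
      · rw [h2]
        exact ⟨_, _, _, _, .push _ q q' y.1 y.2 s hy1 hy2 (by
          simpa only [reads, topOf_stkContent] using hs), rfl⟩
      · exact ⟨_, _, _, _, .write _ q' s, rfl⟩

end runs

/-- The symbol at position `n` of a tape that holds the first `m` letters of the blocks
`B 0, …, B (N - 1)`. -/
def cellAt (S : Type) (b N m : ℕ) (B : ℕ → ℕ → Γ) (n : ℕ) : Sym σ Γ S b :=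
  if n = 0 then .lft else if n = N * (m + 1) then .rgt else
    if n % (m + 1) = 0 then .sep else .blk (B (n / (m + 1)) (n % (m + 1) - 1))

/-- The content of such a tape. -/
def blocksContent (S : Type) (b N m : ℕ) (B : ℕ → ℕ → Γ) : ℤ → Sym σ Γ S b :=
  wordContent ((List.range (N * (m + 1) + 1)).map (cellAt S b N m B))

theorem wordContent_range {Γ : Type} [Inhabited Γ] (f : ℕ → Γ) {n k : ℕ} (h : k < n) :
    wordContent ((List.range n).map f) (k : ℤ) = f k := by
  simp [wordContent, List.getI_eq_getElem, h]

theorem blocksContent_eq {S : Type} {N m : ℕ} {B : ℕ → ℕ → Γ} {k : ℕ} (h : k ≤ N * (m + 1)) :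
    (blocksContent S b N m B (k : ℤ) : Sym σ Γ S b) = cellAt S b N m B k :=
  wordContent_range _ (by omega)

theorem blocksContent_blk {S : Type} {N m : ℕ} {B : ℕ → ℕ → Γ} {i k : ℕ} (hi : i < N)
    (hk : k < m) : (blocksContent S b N m B ((i * (m + 1) + 1 + k : ℕ) : ℤ) : Sym σ Γ S b) =
      .blk (B i k) := by
  have h1 : i * (m + 1) + 1 + k < (i + 1) * (m + 1) := by nlinarith
  have h2 : (i + 1) * (m + 1) ≤ N * (m + 1) := Nat.mul_le_mul_right _ hi
  have h3 : (i * (m + 1) + 1 + k) % (m + 1) = 1 + k := by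
    rw [add_assoc, Nat.mul_add_mod', Nat.mod_eq_of_lt (by omega)]
  have h4 : (i * (m + 1) + 1 + k) / (m + 1) = i := by
    rw [add_assoc, mul_comm, Nat.mul_add_div (by omega), Nat.div_eq_of_lt (by omega)]; rfl
  rw [blocksContent_eq (by omega), cellAt, if_neg (by omega), if_neg (by omega), h3, h4,
    if_neg (by omega)]
  congr 2; omega

theorem blocksContent_delim {S : Type} {N m : ℕ} {B : ℕ → ℕ → Γ} {i : ℕ} (hi : i ≤ N) :
    (blocksContent S b N m B ((i * (m + 1) : ℕ) : ℤ) : Sym σ Γ S b) =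
      if i = 0 then .lft else if i = N then .rgt else .sep := by
  rw [blocksContent_eq (Nat.mul_le_mul_right _ hi), cellAt]
  simp

end Sweep
end NTM

/-! ### Languages that are certified by sets of blocks -/

namespace NTM
open Turing
namespace Sweep

variable {σ Γ H : Type} {P : PDA (σ × (H → Γ))} {b : ℕ} {main uni : H}

/-- The blocks `B` are numbered by `Fin N`, and the sweep over the `i`-th and the `u`-th block
can be completed by further blocks. -/
def Covers (P : PDA (σ × (H → Γ))) (main uni : H) (x : List σ) (N : ℕ) (B : ℕ → ℕ → Γ) : Prop :=
  ∀ i < N, ∀ u < N, ∃ k : H → ℕ, (∀ h, k h < N) ∧ k main = i ∧ k uni = u ∧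
    P.Accepts (sweepCols x fun h => B (k h))

theorem inpContent_lt {x : List σ} {k : ℕ} (hk : k < x.length) :
    inpContent P b x (k : ℤ) = .inp x[k] := by
  simp [inpContent, wordContent, hk, List.getI_eq_getElem]

/-- The columns of a sweep on tapes with a list of blocks. -/
theorem colsAt_blocks {x : List σ} {N : ℕ} {B : ℕ → ℕ → Γ} {k : H → ℕ} (hk : ∀ h, k h < N) :
    ColsAt (inpContent P b x) x.length (blocksContent P.Stk b N x.length B)
      (fun h => ((k h + 1) * (x.length + 1) : ℕ)) (sweepCols x fun h => B (k h)) := by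
  intro i hi
  simp only [sweepCols, List.length_mapIdx] at hi
  simp only [sweepCols, List.length_mapIdx, List.getElem_mapIdx]
  refine ⟨?_, fun h => ?_⟩
  · rw [sub_self, zero_add]; exact inpContent_lt hi
  · rw [← blocksContent_blk (hk h) hi]
    congr 1; push_cast; ring

/-- A set of blocks has few members up to agreement on the first `m` positions. -/
theorem exists_covers [Finite Γ] {x : List σ} {D : Set (ℕ → Γ)} (hne : D.Nonempty)
    (hD : ∀ B ∈ D, ∀ C ∈ D, ∃ V : H → ℕ → Γ, V main = B ∧ V uni = C ∧
      (∀ h, V h ∈ D) ∧ P.Accepts (sweepCols x V)) :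
    ∃ N, 0 < N ∧ N ≤ Nat.card Γ ^ x.length ∧ ∃ B, Covers P main uni x N B := by
  let r : (ℕ → Γ) → Fin x.length → Γ := fun B k => B k
  let e := Finite.equivFin (r '' D)
  have hr : ∀ y : r '' D, ∃ B ∈ D, r B = y := fun y => y.2
  choose f hf1 hf2 using hr
  have : Nonempty (r '' D) := (hne.image r).to_subtype
  obtain ⟨B₀, hB₀⟩ := hne
  refine ⟨Nat.card (r '' D), Nat.card_pos, ?_, fun i => if h : i < Nat.card (r '' D) then
    f (e.symm ⟨i, h⟩) else B₀, ?_⟩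
  · have := Finite.card_subtype_le (fun y => y ∈ r '' D)
    rwa [Nat.card_fun, Nat.card_fin] at this
  · intro i hi u hu
    obtain ⟨V, h1, h2, h3, h4⟩ := hD _ (hf1 (e.symm ⟨i, hi⟩)) _ (hf1 (e.symm ⟨u, hu⟩))
    have hfe : ∀ j hj, (⟨r (f (e.symm ⟨j, hj⟩)), Set.mem_image_of_mem r (hf1 _)⟩ : r '' D) =
        e.symm ⟨j, hj⟩ := fun j hj => Subtype.ext (hf2 _)
    refine ⟨fun h => e ⟨r (V h), Set.mem_image_of_mem r (h3 h)⟩, fun h => (e _).2, ?_, ?_, ?_⟩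
    · simp only [h1, hfe, Equiv.apply_symm_apply]
    · simp only [h2, hfe, Equiv.apply_symm_apply]
    · convert h4 using 1
      refine sweepCols_congr fun h k hk => ?_
      simp only [Fin.is_lt, dif_pos, Fin.eta, Equiv.symm_apply_apply]
      exact congrFun (hf2 ⟨r (V h), Set.mem_image_of_mem r (h3 h)⟩) ⟨k, hk⟩

variable [Finite σ] [Finite Γ] [Finite H]

/-- Any list of blocks can be written. -/
theorem guess_run {x : List σ} {N : ℕ} {B : ℕ → ℕ → Γ} : ∀ j : ℕ, j + 1 ≤ N * (x.length + 1) →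
    ∃ c, (machine P b main uni).Run (j + 1) ((machine P b main uni).init x) c ∧
      c.state = State.guess ∧ Rep c (inpContent P b x) 0 (stkContent []) 0
        (wordContent ((List.range (j + 1)).map (cellAt P.Stk b N x.length B))) fun _ => (j + 1 : ℕ)
  | 0, hj => by
    have hstk : (stkContent ([] : List P.Stk) : ℤ → Sym σ Γ P.Stk b) = wordContent [] := by
      funext i; simp [stkContent, wordContent]; rfl
    have h : Rep ((machine P b main uni).init x) (inpContent P b x) 0 (stkContent []) 0
        (wordContent []) (fun _ => ((0 : ℕ) : ℤ)) := by
      refine ⟨?_, ?_, fun h => ?_⟩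
      · rw [init_inp]; exact tapeAt_mk₁ (x.map Sym.inp)
      · rw [init_stk, hstk]; exact tapeAt_mk₁ _
      · rw [init_hd]; exact tapeAt_mk₁ _
    have hrep := h.after_write State.guess none (stkContent [] 0, none) (some Dir.right) .lft
      (fun _ => rfl)
    simp only [update_stk, dirShift_none, dirShift_right, add_zero] at hrep
    have e := wordContent_append ([] : List (Sym σ Γ P.Stk b)) .lft
    simp only [List.length_nil, List.nil_append] at e
    rw [e] at hrep
    exact ⟨_, .tail (.refl _) (h.step_iff.2 ⟨_, _, _, _, .first _, rfl⟩), rfl, hrep⟩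
  | j + 1, hj => by
    obtain ⟨c, h1, h2, h3⟩ := guess_run (x := x) (N := N) (B := B) j (by omega)
    have key : ∀ s : Sym σ Γ P.Stk b, cellAt P.Stk b N x.length B (j + 1) = s →
        Move P b main uni State.guess (reads (inpContent P b x) 0 (stkContent []) 0
          (wordContent ((List.range (j + 1)).map (cellAt P.Stk b N x.length B)))
          fun _ => ((j + 1 : ℕ) : ℤ)) .guess none (stkContent [] 0, none)
          (fun _ => (s, some Dir.right)) →
        ∃ c, (machine P b main uni).Run (j + 1 + 1) ((machine P b main uni).init x) c ∧
          c.state = State.guess ∧ Rep c (inpContent P b x) 0 (stkContent []) 0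
            (wordContent ((List.range (j + 1 + 1)).map (cellAt P.Stk b N x.length B)))
            fun _ => (j + 1 + 1 : ℕ) := by
      intro s hs hm
      have hrep := h3.after_write State.guess none (stkContent [] 0, none) (some Dir.right) s
        (fun _ => rfl)
      simp only [update_stk, dirShift_none, dirShift_right, add_zero] at hrep
      have e := wordContent_append
        ((List.range (j + 1)).map (cellAt P.Stk b N x.length B : ℕ → Sym σ Γ P.Stk b)) s
      simp only [List.length_map, List.length_range] at e
      rw [e] at hrep
      refine ⟨_, h1.tail (h3.step_iff.2 ⟨_, _, _, _, by rw [h2]; exact hm, rfl⟩), rfl, ?_⟩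
      rw [List.range_succ (n := j + 1), List.map_append, List.map_singleton, hs]
      exact_mod_cast hrep
    by_cases hd : (j + 1) % (x.length + 1) = 0
    · exact key .sep (by simp only [cellAt]; rw [if_neg (by omega), if_neg (by omega), if_pos hd])
        (.sep _)
    · exact key (.blk _)
        (by simp only [cellAt]; rw [if_neg (by omega), if_neg (by omega), if_neg hd]) (.letter _ _)

theorem guess_reach {x : List σ} {N : ℕ} {B : ℕ → ℕ → Γ} (hN : 0 < N) :
    ∃ c, (machine P b main uni).Run (N * (x.length + 1) + 1) ((machine P b main uni).init x) c ∧
      c.state = State.wander false ∧ Rep c (inpContent P b x) 0 (stkContent []) 0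
        (blocksContent P.Stk b N x.length B) fun _ => (N * (x.length + 1) : ℕ) := by
  obtain ⟨n, hn⟩ : ∃ n, N * (x.length + 1) = n + 1 :=
    ⟨N * (x.length + 1) - 1, by
    have : 0 < N * (x.length + 1) := by positivity
    omega⟩
  obtain ⟨c, h1, h2, h3⟩ := guess_run (P := P) (b := b) (main := main) (uni := uni) (B := B) n hn.ge
  have hrep := h3.after_write (State.wander false) none (stkContent [] 0, none) none .rgt
    (fun _ => rfl)
  simp only [update_stk, dirShift_none, add_zero] at hrep
  have e := wordContent_append
    ((List.range (n + 1)).map (cellAt P.Stk b N x.length B : ℕ → Sym σ Γ P.Stk b)) .rgt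
  simp only [List.length_map, List.length_range] at e
  rw [e] at hrep
  rw [hn]
  refine ⟨_, h1.tail (h3.step_iff.2 ⟨_, _, _, _, by rw [h2]; exact .last _, rfl⟩), rfl, ?_⟩
  rw [blocksContent, hn, List.range_succ (n := n + 1), List.map_append, List.map_singleton,
    cellAt, if_neg (by omega), if_pos hn.symm]
  exact hrep

/-- One sweep, and the preparation of the next. The state of the search is given by the positions
of the main block `i` and the other distinguished block `u`. -/
theorem cycle_reach (hmu : main ≠ uni) {x : List σ} {N : ℕ} {B : ℕ → ℕ → Γ}
    (hB : Covers P main uni x N B) {T : ℕ}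
    (hT : T = 2 * (N * (x.length + 1)) + 3 * x.length + 4) : ∀ (t i u : ℕ), t = i * N + u →
    i < N → u < N → ∀ (c : (machine P b main uni).Cfg) (hx : ℤ) (p : H → ℤ),
    c.state = State.wander false →
    Rep c (inpContent P b x) hx (stkContent []) 0 (blocksContent P.Stk b N x.length B) p →
    -1 ≤ hx → hx ≤ x.length → (∀ h, 0 ≤ p h) → (∀ h, p h ≤ (N * (x.length + 1) : ℕ)) →
    (i * (x.length + 1) : ℕ) < p main → p main ≤ ((i + 1) * (x.length + 1) : ℕ) →
    p uni = ((u + 1) * (x.length + 1) : ℕ) →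
    ∃ c', Reaches (machine P b main uni) ((t + 1) * T) c c' ∧ c'.state = State.done := by
  intro t
  induction t using Nat.strong_induction_on with
  | _ t ih =>
  intro i u ht hi hu c hx p hc h hx1 hx2 hp1 hp2 hm1 hm2 hu1
  obtain ⟨k, hk, hki, hku, q, hq, hrun⟩ := hB i hi u hu
  set m := x.length with hm
  have hle : ∀ a < N, (a + 1) * (m + 1) ≤ N * (m + 1) := fun a ha => Nat.mul_le_mul_right _ ha
  have hpos : ∀ a, (((a + 1) * (m + 1) : ℕ) : ℤ) - 1 - m = ((a * (m + 1) : ℕ) : ℤ) := by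
    intro a; push_cast; ring
  have hdelim : ∀ a < N, ∀ g, blocksContent P.Stk b N m B (((a + 1) * (m + 1) : ℕ) : ℤ) ≠
      (.blk g : Sym σ Γ P.Stk b) := by
    intro a ha g
    rw [blocksContent_delim (by omega), if_neg (by omega)]
    split_ifs <;> simp
  have hxm : inpContent P b x m = .blank := by
    by_contra hcon; have := (inpContent_ne_blank.1 hcon).2; omega
  have hx0 : inpContent P b x (-1) = .blank := by
    by_contra hcon; have := (inpContent_ne_blank.1 hcon).1; omega
  obtain ⟨c₁, r1, s1, h1⟩ := wander_reach (fun h => ((k h + 1) * (m + 1) : ℕ)) m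
    (by rw [hki]; exact hdelim i hi)
    (N * (m + 1) + m + 1) c hx p hc h (by rw [abs_le]; push_cast; constructor <;> nlinarith)
    (fun a => by
      have e1 := hle (k a) (hk a)
      have e2 := hp1 a
      have e3 := hp2 a
      rw [abs_le]
      constructor <;> omega)
    (by rw [hku]; exact hu1) (by rw [hki]; exact hm2)
    (by
      simp only [hki]
      intro j hj1 hj2
      obtain ⟨n, hn⟩ := Int.eq_ofNat_of_zero_le (show 0 ≤ j - (i * (m + 1) : ℕ) - 1 by omega)
      have : ((i + 1) * (m + 1) : ℕ) = i * (m + 1) + (m + 1) := by ring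
      refine ⟨B i n, ?_⟩
      rw [← blocksContent_blk (N := N) (m := m) (k := n) hi (by omega)]
      congr 1; omega)
  have hcs := colsAt_blocks (P := P) (b := b) (x := x) (B := B) hk
  obtain ⟨c₂, r2, s2, h2⟩ := sweep_reach s1 h1 hxm (fun a => by
    rw [blocksContent_delim (hk a), if_neg (by omega)]
    split_ifs <;> simp [IsR]) hrun hcs
  have hlen : (sweepCols x fun h => B (k h)).length = m := by simp [sweepCols, hm]
  rw [hlen] at r2 h2
  simp only [hpos, show (m : ℤ) - 1 - m = -1 by ring] at h2
  have hl : ∀ a, IsL (blocksContent P.Stk b N m B ((k a * (m + 1) : ℕ) : ℤ) : Sym σ Γ P.Stk b) := by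
    intro a
    have := hk a
    rw [blocksContent_delim (by omega)]
    split_ifs <;> first | omega | simp [IsL]
  have hst : (stkContent [] 0 : Sym σ Γ P.Stk b) = .blank := stkContent_zero_eq_blank.2 rfl
  have hdl : ∀ a, a < N → (blocksContent P.Stk b N m B ((a * (m + 1) : ℕ) : ℤ) : Sym σ Γ P.Stk b) =
      if a = 0 then .lft else .sep := by
    intro a ha
    rw [blocksContent_delim ha.le]
    split_ifs <;> first | omega | rfl
  have r12 := r1.trans r2
  have hTT : (t + 1) * T = t * T + T := by ring
  rcases Nat.eq_zero_or_pos u with hu0 | hu0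
  · rcases Nat.eq_zero_or_pos i with hi0 | hi0
    · refine ⟨_, (r12.step (h2.step_iff.2 ⟨_, _, _, _, by
        rw [s2]
        exact .done _ q hq hx0 hst hl (by simp only [reads]; rw [hku, hdl u hu, if_pos hu0])
          (by simp only [reads]; rw [hki, hdl i hi, if_pos hi0]), rfl⟩)).mono ?_, rfl⟩
      rw [hTT]
      omega
    · have hrep := h2.after_move (State.wander true) none (stkContent [] 0, none) (fun _ => none)
      simp only [update_stk, dirShift_none, add_zero] at hrep
      have r3 := r12.step (h2.step_iff.2 ⟨_, _, _, _, by
        rw [s2]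
        exact .reset _ q hq hx0 hst hl (by simp only [reads]; rw [hku, hdl u hu, if_pos hu0])
          (by simp only [reads]; rw [hki, hdl i hi, if_neg hi0.ne']), rfl⟩)
      have he : (blocksContent P.Stk b N m B ((N * (m + 1) : ℕ) : ℤ) : Sym σ Γ P.Stk b) = .rgt := by
        rw [blocksContent_delim le_rfl, if_neg (by omega), if_pos rfl]
      obtain ⟨c₃, p₃, r4, s4, h4, h5, h6⟩ := reset_reach hmu he (N * (m + 1)) _ _ _ rfl hrep
        (by simp only [hku, hu0]; simp)
        (fun g => by rw [hki, hdl i hi, if_neg hi0.ne']; simp)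
      obtain ⟨i, rfl⟩ : ∃ i', i = i' + 1 := ⟨i - 1, by omega⟩
      obtain ⟨N, rfl⟩ : ∃ N', N = N' + 1 := ⟨N - 1, by omega⟩
      have ht' : t = (i * (N + 1) + N) + 1 := by rw [ht, hu0]; ring
      have h3m : p₃ main = ((i + 1) * (m + 1) : ℕ) := by rw [h6 main hmu, hki]
      obtain ⟨c', r7, h7⟩ := ih (i * (N + 1) + N) (by omega) i N rfl (by omega) (by omega) c₃ _ p₃
        s4 h4 (by omega) (by omega)
        (fun a => by
          by_cases ha : a = uni
          · rw [ha, h5]; positivity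
          · rw [h6 a ha]; positivity)
        (fun a => by
          by_cases ha : a = uni
          · rw [ha, h5]
          · rw [h6 a ha]
            exact_mod_cast Nat.mul_le_mul_right _ (hk a).le)
        (by
          rw [h3m, Nat.cast_lt]
          exact Nat.mul_lt_mul_of_pos_right (Nat.lt_succ_self _) (Nat.succ_pos _))
        h3m.le (by rw [h5])
      refine ⟨c', ((r3.trans r4).trans r7).mono ?_, h7⟩
      rw [hTT, ht']
      omega
  · obtain ⟨u, rfl⟩ : ∃ u', u = u' + 1 := ⟨u - 1, by omega⟩
    classical
    let d : H → Option Dir := fun a => if a = main then some Dir.right else none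
    have hrep := h2.after_move (State.wander false) none (stkContent [] 0, none) d
    simp only [update_stk, dirShift_none, add_zero] at hrep
    have r3 := r12.step (h2.step_iff.2 ⟨_, _, _, _, by
      rw [s2]
      exact .next _ q hq hx0 hst hl
        (by simp only [reads]; rw [hku, hdl _ hu, if_neg (by omega)]) d (by simp [d])
        (fun a ha => by simp [d, ha]), rfl⟩)
    have hd1 : ∀ a, 0 ≤ dirShift (d a) ∧ dirShift (d a) ≤ 1 := by
      intro a; simp only [d]; split_ifs <;> simp [dirShift_right, dirShift_none]
    have hd2 : dirShift (d main) = 1 := by simp [d, dirShift_right]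
    have hd3 : dirShift (d uni) = 0 := by simp [d, hmu.symm, dirShift_none]
    have hk' : ∀ a, k a * (m + 1) + 1 ≤ (k a + 1) * (m + 1) := by intro a; nlinarith
    obtain ⟨c', r7, h7⟩ := ih (i * N + u) (by omega) i u rfl hi (by omega) _ _ _ rfl hrep
      (by omega) (by omega)
      (fun a => by have := hd1 a; omega)
      (fun a => by have := hd1 a; have := hle _ (hk a); have := hk' a; omega)
      (by rw [hd2, hki]; omega)
      (by rw [hd2, ← hki]; have := hk' main; omega)
      (by rw [hd3, hku, add_zero])
    refine ⟨c', (r3.trans r7).mono ?_, h7⟩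
    rw [hTT, show t = i * N + u + 1 by omega]
    omega

/-- If all pairs of blocks are covered, then the machine accepts. -/
theorem machine_complete (hmu : main ≠ uni) {x : List σ} {N : ℕ} {B : ℕ → ℕ → Γ} (hN : 0 < N)
    (hB : Covers P main uni x N B) : ∃ j c, j ≤ 8 * N ^ 3 * (x.length + 1) ∧
      (machine P b main uni).Run j ((machine P b main uni).init x) c ∧ c.state = State.done := by
  obtain ⟨c, h1, h2, h3⟩ := guess_reach (P := P) (b := b) (main := main) (uni := uni) (x := x)
    (B := B) hN
  obtain ⟨N, rfl⟩ : ∃ N', N = N' + 1 := ⟨N - 1, by omega⟩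
  obtain ⟨c', ⟨j, hj, h4⟩, h5⟩ := cycle_reach hmu hB rfl (N * (N + 1) + N) N N rfl (by omega)
    (by omega) c 0 _ h2 h3 (by omega) (by omega) (fun _ => by positivity) (fun _ => le_rfl)
    (by rw [Nat.cast_lt]; nlinarith) le_rfl rfl
  refine ⟨_, c', ?_, run_trans h1 h4, h5⟩
  set m := x.length
  have e1 : (N * (N + 1) + N + 1) = (N + 1) ^ 2 := by ring
  rw [e1] at hj
  have e2 : 2 * ((N + 1) * (m + 1)) + 3 * m + 4 ≤ 6 * ((N + 1) * (m + 1)) := by nlinarith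
  have e3 := hj.trans (Nat.mul_le_mul_left _ e2)
  have e4 : (N + 1) * (m + 1) ≤ (N + 1) ^ 3 * (m + 1) :=
    Nat.mul_le_mul_right _ (Nat.le_self_pow (by omega) _)
  have e5 : (N + 1) ^ 2 * (6 * ((N + 1) * (m + 1))) = 6 * ((N + 1) ^ 3 * (m + 1)) := by ring
  have e6 : 1 ≤ (N + 1) ^ 3 * (m + 1) := Nat.one_le_iff_ne_zero.2 (by positivity)
  rw [mul_assoc]
  omega

end Sweep

/-- A language is in `NExpTime` if membership of `x` can be certified by a set of blocks, that is,
of words over a finite alphabet of the length of `x`, such that for every pair of blocks there are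
further blocks with which it passes a test by a pushdown automaton. The automaton scans the input
and all these blocks synchronously. -/
theorem mem_NExpTime_of_sweep {σ Γ H : Type} [Finite σ] [Finite Γ] [Finite H]
    (P : PDA (σ × (H → Γ))) (hP : ∀ q ∈ P.start, q ∉ P.acc) {main uni : H} (hmu : main ≠ uni)
    {A : Language σ} (hA : ∀ x, x ∈ A ↔ ∃ D : Set (ℕ → Γ), D.Nonempty ∧ ∀ B ∈ D, ∀ C ∈ D,
      ∃ V : H → ℕ → Γ, V main = B ∧ V uni = C ∧ (∀ h, V h ∈ D) ∧ P.Accepts (sweepCols x V)) :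
    A ∈ NExpTime σ := by
  set g := Nat.card Γ with hg
  refine mem_NExpTime_of_bounded_accept (b := 16 * g ^ 3)
    (Sweep.machine P (16 * g ^ 3 + 1) main uni) (dig := fun d => Sweep.Sym.dig d) A
    (fun d d' h => by injection h) (fun d h => by cases h) ?_ ?_ ?_
  · rintro s rfl rd
    exact Sweep.machine_trans_done rd
  · intro x hx
    exact (hA x).2 (Sweep.machine_sound hmu hP hx)
  · intro x hx
    obtain ⟨D, hne, hD⟩ := (hA x).1 hx
    have : Nonempty Γ := hne.elim fun B _ => ⟨B 0⟩
    have hg0 : 0 < g := Nat.card_pos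
    obtain ⟨N, hN, hNg, B, hB⟩ := Sweep.exists_covers hne hD
    obtain ⟨j, c, h1, h2, h3⟩ := Sweep.machine_complete (b := 16 * g ^ 3 + 1) hmu hN hB
    refine ⟨j, c, h1.trans_lt ?_, h2, h3⟩
    set m := x.length
    have hm : m + 1 ≤ 2 ^ m := Nat.lt_two_pow_self
    calc 8 * N ^ 3 * (m + 1) ≤ 8 * (g ^ m) ^ 3 * 2 ^ m := by gcongr
      _ = 8 * (2 * g ^ 3) ^ m := by rw [mul_pow, ← pow_mul, ← pow_mul, mul_comm m 3]; ring
      _ ≤ 8 * (16 * g ^ 3 + 1) ^ m := by gcongr; omega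
      _ < (16 * g ^ 3 + 1) * (16 * g ^ 3 + 1) ^ m := by
        gcongr
        have : 0 < g ^ 3 := by positivity
        omega
      _ = (16 * g ^ 3 + 1) ^ (m + 1) := by ring

end NTM

/-! ### Occurrences of subexpressions -/

namespace MLALC

variable {n : ℕ}

/-- A concept or a formula. -/
inductive Node (n : ℕ) : Type
  | c (C : Concept n)
  | f (φ : Formula n)

/-- The code of a concept or formula. -/
def Node.encode : Node n → List (Letter n)
  | .c C => C.encode
  | .f φ => φ.encode

/-- `Occ φ e p d`: the expression `e` occurs in `φ`, its code starts at position `p` of the code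
of `φ`, and `d` is the number of modal operators in the scope of which it lies. -/
inductive Occ (φ : Formula n) : Node n → ℕ → ℕ → Prop
  | root : Occ φ (.f φ) 0 0
  | neg {C p d} (h : Occ φ (.c (.neg C)) p d) : Occ φ (.c C) (p + 1) d
  | inter_left {C D p d} (h : Occ φ (.c (.inter C D)) p d) : Occ φ (.c C) (p + 1) d
  | inter_right {C D p d} (h : Occ φ (.c (.inter C D)) p d) :
    Occ φ (.c D) (p + 1 + C.encode.length) d
  | ex {r C p d} (h : Occ φ (.c (.ex r C)) p d) : Occ φ (.c C) (p + 2 + r.length) d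
  | box {i C p d} (h : Occ φ (.c (.box i C)) p d) : Occ φ (.c C) (p + 1) (d + 1)
  | incl_left {C D p d} (h : Occ φ (.f (.incl C D)) p d) : Occ φ (.c C) (p + 1) d
  | incl_right {C D p d} (h : Occ φ (.f (.incl C D)) p d) :
    Occ φ (.c D) (p + 1 + C.encode.length) d
  | fneg {ψ p d} (h : Occ φ (.f (.neg ψ)) p d) : Occ φ (.f ψ) (p + 1) d
  | and_left {ψ χ p d} (h : Occ φ (.f (.and ψ χ)) p d) : Occ φ (.f ψ) (p + 1) d
  | and_right {ψ χ p d} (h : Occ φ (.f (.and ψ χ)) p d) :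
    Occ φ (.f χ) (p + 1 + ψ.encode.length) d
  | fbox {i ψ p d} (h : Occ φ (.f (.box i ψ)) p d) : Occ φ (.f ψ) (p + 1) (d + 1)

theorem encodeName_length (a : List Bool) : (encodeName n a).length = a.length + 1 := by
  simp [encodeName]

theorem prefix_drop_cons {α : Type} {x l : List α} {a : α} {p : ℕ} (h : a :: l <+: x.drop p) :
    x[p]? = some a ∧ l <+: x.drop (p + 1) := by
  obtain ⟨s, hs⟩ := h
  refine ⟨?_, s, ?_⟩
  · have := congrArg List.head? hs
    simpa [List.head?_drop] using this.symm
  · have := congrArg List.tail hs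
    simpa [List.tail_drop] using this

theorem prefix_drop_append {α : Type} {x l l' : List α} {p : ℕ} (h : l ++ l' <+: x.drop p) :
    l <+: x.drop p ∧ l' <+: x.drop (p + l.length) := by
  obtain ⟨s, hs⟩ := h
  refine ⟨⟨l' ++ s, by simpa using hs⟩, s, ?_⟩
  rw [← List.drop_drop, ← hs]
  simp

/-- The letters of an occurrence are where its position says. -/
theorem Occ.prefix {φ : Formula n} {e : Node n} {p d : ℕ} (h : Occ φ e p d) :
    e.encode <+: φ.encode.drop p := by
  induction h with
  | root => simp [Node.encode]
  | neg _ ih => exact (prefix_drop_cons ih).2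
  | inter_left _ ih => exact (prefix_drop_append (prefix_drop_cons ih).2).1
  | inter_right _ ih => exact (prefix_drop_append (prefix_drop_cons ih).2).2
  | @ex r C p d _ ih =>
    have := (prefix_drop_append (prefix_drop_cons ih).2).2
    rw [encodeName_length] at this
    rwa [show p + 2 + r.length = p + 1 + (r.length + 1) by omega]
  | box _ ih => exact (prefix_drop_cons ih).2
  | incl_left _ ih => exact (prefix_drop_append (prefix_drop_cons ih).2).1
  | incl_right _ ih => exact (prefix_drop_append (prefix_drop_cons ih).2).2
  | fneg _ ih => exact (prefix_drop_cons ih).2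
  | and_left _ ih => exact (prefix_drop_append (prefix_drop_cons ih).2).1
  | and_right _ ih => exact (prefix_drop_append (prefix_drop_cons ih).2).2
  | fbox _ ih => exact (prefix_drop_cons ih).2

theorem Node.encode_ne_nil (e : Node n) : e.encode ≠ [] := by
  rcases e with (_ | _ | _ | _ | _) | (_ | _ | _ | _) <;>
    simp [Node.encode, Concept.encode, Formula.encode]

theorem Occ.lt_length {φ : Formula n} {e : Node n} {p d : ℕ} (h : Occ φ e p d) :
    p < φ.encode.length := by
  by_contra hp
  have := h.prefix
  rw [List.drop_eq_nil_of_le (by omega), List.prefix_nil] at this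
  exact e.encode_ne_nil this

theorem Occ.depth_le {φ : Formula n} {e : Node n} {p d : ℕ} (h : Occ φ e p d) : d ≤ p := by
  induction h <;> omega

theorem encodeName_inj {a a' : List Bool} {s s' : List (Letter n)}
    (h : encodeName n a ++ s = encodeName n a' ++ s') : a = a' ∧ s = s' := by
  induction a generalizing a' with
  | nil => cases a' <;> simp_all [encodeName]
  | cons b a ih =>
    cases a' with
    | nil => simp [encodeName] at h
    | cons b' a' =>
      simp only [encodeName, List.map_cons, List.cons_append, List.cons.injEq,
        Letter.bit.injEq] at h
      obtain ⟨h1, h2⟩ := ih h.2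
      exact ⟨by rw [h.1, h1], h2⟩

/-- Polish notation is uniquely readable. -/
theorem Concept.encode_inj {C C' : Concept n} {s s' : List (Letter n)}
    (h : C.encode ++ s = C'.encode ++ s') : C = C' ∧ s = s' := by
  induction C generalizing C' s s' with
  | name A =>
    cases C' <;> simp only [Concept.encode, List.cons_append, List.cons.injEq, reduceCtorEq,
      false_and] at h
    obtain ⟨rfl, h2⟩ := encodeName_inj h.2
    exact ⟨rfl, h2⟩
  | neg C ih =>
    cases C' <;> simp only [Concept.encode, List.cons_append, List.cons.injEq, reduceCtorEq,
      false_and] at h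
    obtain ⟨rfl, h2⟩ := ih h.2
    exact ⟨rfl, h2⟩
  | inter C D ih ih' =>
    cases C' <;> simp only [Concept.encode, List.cons_append, List.cons.injEq, reduceCtorEq,
      false_and, List.append_assoc] at h
    obtain ⟨rfl, h2⟩ := ih h.2
    obtain ⟨rfl, h3⟩ := ih' h2
    exact ⟨rfl, h3⟩
  | ex r C ih =>
    cases C' <;> simp only [Concept.encode, List.cons_append, List.cons.injEq, reduceCtorEq,
      false_and, List.append_assoc] at h
    obtain ⟨rfl, h2⟩ := encodeName_inj h.2
    obtain ⟨rfl, h3⟩ := ih h2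
    exact ⟨rfl, h3⟩
  | box i C ih =>
    cases C' <;> simp only [Concept.encode, List.cons_append, List.cons.injEq, reduceCtorEq,
      false_and, Letter.cBox.injEq] at h
    obtain ⟨rfl, h2⟩ := ih h.2
    exact ⟨by rw [h.1], h2⟩

theorem Formula.encode_inj {ψ ψ' : Formula n} {s s' : List (Letter n)}
    (h : ψ.encode ++ s = ψ'.encode ++ s') : ψ = ψ' ∧ s = s' := by
  induction ψ generalizing ψ' s s' with
  | incl C D =>
    cases ψ' <;> simp only [Formula.encode, List.cons_append, List.cons.injEq, reduceCtorEq,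
      false_and, List.append_assoc] at h
    obtain ⟨rfl, h2⟩ := Concept.encode_inj h.2
    obtain ⟨rfl, h3⟩ := Concept.encode_inj h2
    exact ⟨rfl, h3⟩
  | neg ψ ih =>
    cases ψ' <;> simp only [Formula.encode, List.cons_append, List.cons.injEq, reduceCtorEq,
      false_and] at h
    obtain ⟨rfl, h2⟩ := ih h.2
    exact ⟨rfl, h2⟩
  | and ψ χ ih ih' =>
    cases ψ' <;> simp only [Formula.encode, List.cons_append, List.cons.injEq, reduceCtorEq,
      false_and, List.append_assoc] at h
    obtain ⟨rfl, h2⟩ := ih h.2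
    obtain ⟨rfl, h3⟩ := ih' h2
    exact ⟨rfl, h3⟩
  | box i ψ ih =>
    cases ψ' <;> simp only [Formula.encode, List.cons_append, List.cons.injEq, reduceCtorEq,
      false_and, Letter.fBox.injEq] at h
    obtain ⟨rfl, h2⟩ := ih h.2
    exact ⟨by rw [h.1], h2⟩

theorem Node.encode_inj {e e' : Node n} {s s' : List (Letter n)}
    (h : e.encode ++ s = e'.encode ++ s') : e = e' := by
  cases e with
  | c C =>
    cases e' with
    | c C' => rw [(Concept.encode_inj h).1]
    | f ψ => cases C <;> cases ψ <;> simp [Node.encode, Concept.encode, Formula.encode] at h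
  | f ψ =>
    cases e' with
    | f ψ' => rw [(Formula.encode_inj h).1]
    | c C => cases C <;> cases ψ <;> simp [Node.encode, Concept.encode, Formula.encode] at h

/-- The position of an occurrence determines the expression. -/
theorem Occ.unique {φ : Formula n} {e e' : Node n} {p d d' : ℕ} (h : Occ φ e p d)
    (h' : Occ φ e' p d') : e = e' := by
  obtain ⟨s, hs⟩ := h.prefix
  obtain ⟨s', hs'⟩ := h'.prefix
  exact Node.encode_inj (hs.trans hs'.symm)

/-- An occurrence of a boxed formula (`s = true`) or concept (`s = false`). -/
def OccBox (φ : Formula n) (i : Fin n) : Bool → ℕ → ℕ → Prop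
  | true, p, d => ∃ ψ, Occ φ (.f (.box i ψ)) p d
  | false, p, d => ∃ C, Occ φ (.c (.box i C)) p d

theorem OccBox.lt_length {φ : Formula n} {i : Fin n} {s : Bool} {p d : ℕ} (h : OccBox φ i s p d) :
    d < φ.encode.length := by
  cases s <;> obtain ⟨e, h⟩ := h <;> exact h.depth_le.trans_lt h.lt_length

end MLALC

/-! ### Quasimodels -/

namespace MLALC

variable {n : ℕ}

/-- A quasimodel for `φ`: a set of types, which are truth assignments to the positions of the code
of `φ` at which a subexpression starts. A type belongs to an object at a world. It knows the modal
depth `lev` of the world and the identity `id` of the world. Types with the same identity agree on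
formulas; `eps B i` says that the empty set is a neighbourhood, and `tgt B i` is the identity of a
world which, for the system `C`, belongs to all neighbourhoods that are required to exist. The
relation `imp` says which boxed expressions have, in all cases, stronger arguments than others.
A box at position `p` has its argument at position `p + 1`. -/
structure Quasi (L : Log) (φ : Formula n) (Id : Type) where
  T : Type
  mark : T → ℕ → Prop
  lev : T → ℕ
  id : T → Id
  tgt : T → Fin n → Id
  eps : T → Fin n → Prop
  imp : ℕ → ℕ → Prop
  root : ∃ B, lev B = 0 ∧ mark B 0
  name : ∀ B A p p', Occ φ (.c (.name A)) p (lev B) → Occ φ (.c (.name A)) p' (lev B) →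
    (mark B p ↔ mark B p')
  neg : ∀ B C p d, Occ φ (.c (.neg C)) p d → (mark B p ↔ ¬ mark B (p + 1))
  inter : ∀ B C D p d, Occ φ (.c (.inter C D)) p d →
    (mark B p ↔ mark B (p + 1) ∧ mark B (p + 1 + C.encode.length))
  fneg : ∀ B ψ p d, Occ φ (.f (.neg ψ)) p d → (mark B p ↔ ¬ mark B (p + 1))
  fand : ∀ B ψ χ p d, Occ φ (.f (.and ψ χ)) p d →
    (mark B p ↔ mark B (p + 1) ∧ mark B (p + 1 + ψ.encode.length))
  incl : ∀ B C D p d, Occ φ (.f (.incl C D)) p d → mark B p → mark B (p + 1) →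
    mark B (p + 1 + C.encode.length)
  not_incl : ∀ B C D p, Occ φ (.f (.incl C D)) p (lev B) → ¬ mark B p →
    ∃ W, id W = id B ∧ lev W = lev B ∧ mark W (p + 1) ∧ ¬ mark W (p + 1 + C.encode.length)
  ex : ∀ B r C p, Occ φ (.c (.ex r C)) p (lev B) → mark B p →
    ∃ W, id W = id B ∧ lev W = lev B ∧ mark W (p + 2 + r.length) ∧
      ∀ C' p', Occ φ (.c (.ex r C')) p' (lev B) → mark W (p' + 2 + r.length) → mark B p'
  key_mark : ∀ B B', id B = id B' → ∀ ψ p, Occ φ (.f ψ) p (lev B) → Occ φ (.f ψ) p (lev B') →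
    (mark B p ↔ mark B' p)
  key_eps : ∀ B B', id B = id B' → ∀ i, eps B i ↔ eps B' i
  key_tgt : ∀ B B', id B = id B' → ∀ i, tgt B i = tgt B' i
  box_EN : L = .E ∨ L = .N → ∀ B i s p, OccBox φ i s p (lev B) →
    (mark B p ↔ eps B i) ∨ ∃ W, lev W = lev B + 1 ∧ mark W (p + 1)
  box_M : L = .M → ∀ B i s p, OccBox φ i s p (lev B) → mark B p →
    eps B i ∨ ∃ W, lev W = lev B + 1 ∧ mark W (p + 1)
  not_box_M : L = .M → ∀ B i s p, OccBox φ i s p (lev B) → ¬ mark B p → ¬ eps B i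
  not_box_C : L = .C → ∀ B i s p, OccBox φ i s p (lev B) → ¬ mark B p → eps B i →
    ∃ W, lev W = lev B + 1 ∧ mark W (p + 1)
  joint : L = .C → ∀ B i s p, OccBox φ i s p (lev B) → ¬ eps B i →
    ∃ W, lev W = lev B + 1 ∧ id W = tgt B i ∧
      ∀ s' p', OccBox φ i s' p' (lev B) → mark B p' → mark W (p' + 1)
  unit : L = .N → ∀ B i s p, OccBox φ i s p (lev B) → ¬ mark B p →
    ∃ W, lev W = lev B + 1 ∧ (s = true → ¬ mark W (p + 1))
  imp_or : L ≠ .M → ∀ B i s p s' p', OccBox φ i s p (lev B) → OccBox φ i s' p' (lev B) →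
    (s = true → s' = true) → (L ≠ .C → s = s') → ¬ imp p p' →
    ∃ W, lev W = lev B + 1 ∧ mark W (p + 1) ∧ ¬ mark W (p' + 1)
  sep_EN : L = .E ∨ L = .N → ∀ B i s p p', OccBox φ i s p (lev B) → OccBox φ i s p' (lev B) →
    ¬ mark B p → mark B p' → imp p p' →
    ∃ W, lev W = lev B + 1 ∧ mark W (p' + 1) ∧ ¬ mark W (p + 1)
  sep_M : L = .M → ∀ B i s p s' p', OccBox φ i s p (lev B) → OccBox φ i s' p' (lev B) →
    ¬ mark B p → mark B p' → (s' = true → s = true) →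
    ∃ W, lev W = lev B + 1 ∧ mark W (p' + 1) ∧ ¬ mark W (p + 1)
  sep_C : L = .C → ∀ B i s p p', OccBox φ i s p (lev B) → OccBox φ i s p' (lev B) →
    ¬ mark B p → mark B p' → imp p p' → ∃ W, lev W = lev B + 1 ∧ ¬ mark W (p + 1) ∧
      ∀ s' k, OccBox φ i s' k (lev B) → mark B k → imp p k → (s = true → s' = true) →
        mark W (k + 1)

/-! ### The model of a quasimodel -/

namespace Quasi

/-- The worlds of the model form a tree. A child of the world `u` either contains no object of `u`
(`free`), or exactly one object of `u`, which is given by the world `b` and the type `B` of its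
birth (`priv`), or all objects of `u` (`joint`). The type `W` describes the new world. -/
inductive World (T : Type) (n : ℕ) : Type
  | root
  | free (u : World T n) (W : T)
  | priv (u b : World T n) (B W : T)
  | joint (u : World T n) (i : Fin n)

variable {L : Log} {φ : Formula n} {Id : Type} (Q : Quasi L φ Id)

/-- The requirements on the type of an object at a `joint` child. -/
def IsJoint (i : Fin n) (B W : Q.T) : Prop :=
  Q.lev W = Q.lev B + 1 ∧ Q.id W = Q.tgt B i ∧
    ∀ s p, OccBox φ i s p (Q.lev B) → Q.mark B p → Q.mark W (p + 1)

open Classical in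
/-- The type, at a `joint` child, of an object of type `B`. -/
noncomputable def jointType (i : Fin n) (B : Q.T) : Q.T :=
  if h : ∃ W, Q.IsJoint i B W then h.choose else B

theorem isJoint_jointType {i : Fin n} {B : Q.T} (h : ∃ W, Q.IsJoint i B W) :
    Q.IsJoint i B (Q.jointType i B) := by
  rw [jointType, dif_pos h]; exact h.choose_spec

/-- A type of the root. -/
noncomputable def rootType : Q.T := Q.root.choose

/-- A type which determines the truth of formulas at a world. -/
noncomputable def rep : World Q.T n → Q.T
  | .root => Q.rootType
  | .free _ W => W
  | .priv _ _ _ W => W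
  | .joint u i => Q.jointType i (rep u)

open Classical in
/-- The type of an object that is born at a world with type `R`. -/
noncomputable def born (R B : Q.T) : Option Q.T :=
  if Q.id B = Q.id R ∧ Q.lev B = Q.lev R then some B else none

open Classical in
/-- The type of an object at a world, if it exists there. Objects are pairs of the world and the
type of their birth. In addition, there is a fictitious object `none`, which stands for the world
itself and serves to treat formulas like concepts. -/
noncomputable def ty : World Q.T n → Option (World Q.T n × Q.T) → Option Q.T
  | w, none => some (Q.rep w)
  | .root, some (b, B) => if b = .root then Q.born (Q.rep .root) B else none
  | .free u W, some (b, B) => if b = .free u W then Q.born (Q.rep (.free u W)) B else none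
  | .priv u b' B' W, some (b, B) =>
    if b = .priv u b' B' W then Q.born (Q.rep (.priv u b' B' W)) B
    else if b = b' ∧ B = B' then some W else none
  | .joint u i, some (b, B) =>
    if b = .joint u i then Q.born (Q.rep (.joint u i)) B
    else (ty u (some (b, B))).map (Q.jointType i)

theorem ty_none (w : World Q.T n) : Q.ty w none = some (Q.rep w) := by
  cases w <;> rfl

theorem ty_born (w : World Q.T n) (B : Q.T) : Q.ty w (some (w, B)) = Q.born (Q.rep w) B := by
  cases w <;> simp [ty]

theorem born_eq_some {R B B' : Q.T} :
    Q.born R B = some B' ↔ B' = B ∧ Q.id B = Q.id R ∧ Q.lev B = Q.lev R := by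
  unfold born
  split_ifs with h
  · simp [h, eq_comm]
  · simp [h]

theorem ty_self (w : World Q.T n) : Q.ty w (some (w, Q.rep w)) = some (Q.rep w) := by
  rw [ty_born, born_eq_some]; simp

/-- The world at which an object is born is not larger than the present world; in particular, the
objects of a world are different from those that are born at its children. -/
theorem sizeOf_birth {w b : World Q.T n} {B B' : Q.T} (h : Q.ty w (some (b, B)) = some B') :
    sizeOf b ≤ sizeOf w := by
  induction w generalizing B' with
  | root =>
    simp only [ty] at h
    split_ifs at h with h1
    rw [h1]
  | free u W _ =>
    simp only [ty] at h
    split_ifs at h with h1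
    rw [h1]
  | priv u b' C W _ _ =>
    simp only [ty] at h
    split_ifs at h with h1 h2
    · rw [h1]
    · rw [h2.1]; simp only [World.priv.sizeOf_spec]; omega
  | joint u i ih =>
    simp only [ty] at h
    split_ifs at h with h1
    · rw [h1]
    · obtain ⟨C, hC, -⟩ := Option.map_eq_some_iff.1 h
      have := ih hC
      simp only [World.joint.sizeOf_spec]; omega

/-- The objects of a world have types that fit to the world. -/
def Good (w : World Q.T n) : Prop :=
  ∀ h B, Q.ty w h = some B → Q.id B = Q.id (Q.rep w) ∧ Q.lev B = Q.lev (Q.rep w)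

/-- The children of a world. -/
inductive Child (w : World Q.T n) : World Q.T n → Prop
  | free {W} (h : Q.lev W = Q.lev (Q.rep w) + 1) : Child w (.free w W)
  | priv {b B W B'} (h : Q.lev W = Q.lev (Q.rep w) + 1) (hB : Q.ty w (some (b, B)) = some B') :
    Child w (.priv w b B W)
  | joint {i s p} (hL : L = .C) (he : ¬ Q.eps (Q.rep w) i)
    (hp : OccBox φ i s p (Q.lev (Q.rep w))) : Child w (.joint w i)

theorem good_root : Q.Good .root := by
  rintro (_ | ⟨b, B⟩) B' h
  · rw [ty_none] at h; injection h with h; simp [h]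
  · simp only [ty] at h
    split_ifs at h
    obtain ⟨rfl, h⟩ := Q.born_eq_some.1 h
    exact h

variable {Q}

theorem Good.isJoint {w : World Q.T n} (hw : Q.Good w) {i : Fin n} {s : Bool} {p : ℕ}
    (hL : L = .C) (he : ¬ Q.eps (Q.rep w) i) (hp : OccBox φ i s p (Q.lev (Q.rep w)))
    {h : Option (World Q.T n × Q.T)} {B : Q.T} (hB : Q.ty w h = some B) :
    Q.IsJoint i B (Q.jointType i B) := by
  obtain ⟨h1, h2⟩ := hw h B hB
  exact Q.isJoint_jointType (Q.joint hL B i s p (by rwa [h2]) (by rwa [Q.key_eps _ _ h1]))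

/-- The types of the objects fit to the world, one level further down. -/
theorem Good.child {w v : World Q.T n} (hw : Q.Good w) (hv : Q.Child w v) :
    Q.Good v ∧ Q.lev (Q.rep v) = Q.lev (Q.rep w) + 1 := by
  cases hv with
  | free hW =>
    refine ⟨?_, hW⟩
    rintro (_ | ⟨b, B⟩) B' h
    · rw [ty_none] at h; injection h with h; simp [h]
    · simp only [ty] at h
      split_ifs at h
      obtain ⟨rfl, h⟩ := Q.born_eq_some.1 h
      exact h
  | priv hW _ =>
    refine ⟨?_, hW⟩
    rintro (_ | ⟨b, B⟩) B' h
    · rw [ty_none] at h; injection h with h; simp [h]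
    · simp only [ty] at h
      split_ifs at h
      · obtain ⟨rfl, h⟩ := Q.born_eq_some.1 h
        exact h
      · injection h with h; simp [h, rep]
  | joint hL he hp =>
    have h0 := hw.isJoint hL he hp (Q.ty_none w)
    refine ⟨?_, h0.1⟩
    rintro (_ | ⟨b, B⟩) B' h
    · rw [ty_none] at h; injection h with h; simp [h]
    · simp only [ty] at h
      split_ifs at h
      · obtain ⟨rfl, h⟩ := Q.born_eq_some.1 h
        exact h
      · obtain ⟨C, hC, rfl⟩ := Option.map_eq_some_iff.1 h
        obtain ⟨h1, h2⟩ := hw _ _ hC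
        have h3 := hw.isJoint hL he hp hC
        refine ⟨?_, ?_⟩
        · rw [h3.2.1, rep, h0.2.1, Q.key_tgt _ _ h1]
        · rw [h3.1, rep, h0.1, h2]

theorem ty_joint {w : World Q.T n} {i : Fin n} {h : Option (World Q.T n × Q.T)} {B : Q.T}
    (hB : Q.ty w h = some B) : Q.ty (.joint w i) h = some (Q.jointType i B) := by
  rcases h with _ | ⟨b, C⟩
  · rw [ty_none] at hB ⊢; injection hB with hB; rw [← hB, rep]
  · have : b ≠ .joint w i := by
      rintro rfl
      have := Q.sizeOf_birth hB
      simp only [World.joint.sizeOf_spec] at this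
      omega
    simp [ty, this, hB]

variable (Q) in
/-- A child with type `W` that contains no object of `w` except `h`. -/
def only (w : World Q.T n) : Option (World Q.T n × Q.T) → Q.T → World Q.T n
  | none, W => .free w W
  | some (b, B), W => .priv w b B W

section only

variable {w : World Q.T n} {h : Option (World Q.T n × Q.T)} {B W : Q.T}

theorem child_only (hB : Q.ty w h = some B) (hW : Q.lev W = Q.lev (Q.rep w) + 1) :
    Q.Child w (Q.only w h W) := by
  rcases h with _ | ⟨b, C⟩
  · exact .free hW
  · exact .priv hW hB

theorem ty_only_none : Q.ty (Q.only w h W) none = some W := by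
  rw [ty_none]; rcases h with _ | ⟨b, C⟩ <;> rfl

theorem ty_only_self (hB : Q.ty w h = some B) : Q.ty (Q.only w h W) h = some W := by
  rcases h with _ | ⟨b, C⟩
  · exact ty_only_none
  · have : b ≠ .priv w b C W := by
      intro hb
      have := congrArg sizeOf hb
      simp only [World.priv.sizeOf_spec] at this
      omega
    simp only [only, ty, if_neg this, and_self, if_true]

theorem ty_only_of_ne {o : World Q.T n × Q.T} {B' : Q.T} (ho : Q.ty w (some o) = some B')
    (hne : h ≠ some o) : Q.ty (Q.only w h W) (some o) = none := by
  obtain ⟨b', C'⟩ := o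
  have hs := Q.sizeOf_birth ho
  rcases h with _ | ⟨b, C⟩
  · have : b' ≠ .free w W := by
      rintro rfl; simp only [World.free.sizeOf_spec] at hs; omega
    simp [only, ty, this]
  · have : b' ≠ .priv w b C W := by
      rintro rfl; simp only [World.priv.sizeOf_spec] at hs; omega
    simp only [only, ty, if_neg this]
    rw [if_neg]
    rintro ⟨rfl, rfl⟩
    exact hne rfl

end only

variable (Q) in
/-- The children of `w` at which the argument of the box at position `p` is true of `h`. -/
def ext (w : World Q.T n) (h : Option (World Q.T n × Q.T)) (p : ℕ) : Set (World Q.T n) :=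
  {v | Q.Child w v ∧ ∃ B, Q.ty v h = some B ∧ Q.mark B (p + 1)}

variable (Q) in
/-- The sets of children that are required to be neighbourhoods. -/
def pos (w : World Q.T n) (i : Fin n) : Set (Set (World Q.T n)) :=
  {α | ∃ h p B, Q.ty w h = some B ∧ OccBox φ i h.isNone p (Q.lev B) ∧ Q.mark B p ∧
    α = Q.ext w h p}

/-- The closure of `S` under the operations that belong to the system `L`. -/
def closure {X : Type} (L : Log) (V : Set X) (S : Set (Set X)) : Set (Set X) :=
  match L with
  | .E => S
  | .M => {β | ∃ α ∈ S, α ⊆ β}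
  | .C => {β | ∃ F ⊆ S, F.Finite ∧ F.Nonempty ∧ β = ⋂₀ F}
  | .N => insert V S

theorem subset_closure {X : Type} (L : Log) (V : Set X) (S : Set (Set X)) :
    S ⊆ closure L V S := by
  intro α hα
  cases L with
  | E => exact hα
  | M => exact ⟨α, hα, subset_rfl⟩
  | C => exact ⟨{α}, by simpa using hα, Set.finite_singleton α, Set.singleton_nonempty α, by simp⟩
  | N => exact Or.inr hα

section separation

variable {w : World Q.T n} {h h' : Option (World Q.T n × Q.T)} {B B' W : Q.T} {p p' : ℕ}

theorem mem_ext_only_self (hB : Q.ty w h = some B) (hW : Q.lev W = Q.lev (Q.rep w) + 1) :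
    Q.only w h W ∈ Q.ext w h p ↔ Q.mark W (p + 1) := by
  simp [ext, child_only hB hW, ty_only_self hB]

theorem mem_ext_only_none (hB : Q.ty w h = some B) (hW : Q.lev W = Q.lev (Q.rep w) + 1) :
    Q.only w h W ∈ Q.ext w none p ↔ Q.mark W (p + 1) := by
  simp [ext, child_only hB hW, ty_only_none]

theorem notMem_ext_only {o : World Q.T n × Q.T} (ho : Q.ty w (some o) = some B')
    (hne : h ≠ some o) : Q.only w h W ∉ Q.ext w (some o) p := by
  simp [ext, ty_only_of_ne ho hne]

/-- Truth sets of different objects differ unless both are empty. -/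
theorem not_mark_of_ext_eq (hB : Q.ty w h = some B) (hB' : Q.ty w h' = some B') (hne : h ≠ h')
    (he : Q.ext w h p = Q.ext w h' p') (hW : Q.lev W = Q.lev (Q.rep w) + 1) :
    ¬ Q.mark W (p + 1) := by
  intro hp
  have h1 := (mem_ext_only_self hB hW).2 hp
  rw [he] at h1
  rcases h' with _ | o'
  · rcases h with _ | o
    · exact hne rfl
    · rw [mem_ext_only_none hB hW] at h1
      have h2 := (mem_ext_only_self (Q.ty_none w) hW).2 h1
      rw [← he] at h2
      exact notMem_ext_only hB (by simp) h2
  · exact notMem_ext_only hB' hne h1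

/-- For `E` and `N`, the truth sets of true and false boxes are different. -/
theorem Good.ext_ne (hw : Q.Good w) (hL : L = .E ∨ L = .N) {i : Fin n}
    (hB : Q.ty w h = some B) (hp : OccBox φ i h.isNone p (Q.lev B)) (hm : ¬ Q.mark B p)
    (hB' : Q.ty w h' = some B') (hp' : OccBox φ i h'.isNone p' (Q.lev B')) (hm' : Q.mark B' p') :
    Q.ext w h p ≠ Q.ext w h' p' := by
  intro he
  obtain ⟨i1, l1⟩ := hw h B hB
  obtain ⟨i2, l2⟩ := hw h' B' hB'
  by_cases hne : h = h'
  · subst hne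
    obtain rfl : B = B' := Option.some_inj.1 (hB.symm.trans hB')
    by_cases hi : Q.imp p p'
    · obtain ⟨W, w1, w2, w3⟩ := Q.sep_EN hL B i _ p p' hp hp' hm hm' hi
      rw [l1] at w1
      have := (mem_ext_only_self hB w1).2 w2
      rw [← he, mem_ext_only_self hB w1] at this
      exact w3 this
    · obtain ⟨W, w1, w2, w3⟩ := Q.imp_or (by rcases hL with rfl | rfl <;> simp) B i _ p _ p' hp hp'
        (fun h => h) (fun _ => rfl) hi
      rw [l1] at w1
      have := (mem_ext_only_self hB w1).2 w2
      rw [he, mem_ext_only_self hB w1] at this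
      exact w3 this
  · rcases Q.box_EN hL B i _ p hp with h1 | ⟨W, w1, w2⟩
    · rcases Q.box_EN hL B' i _ p' hp' with h2 | ⟨W, w1, w2⟩
      · exact hm (h1.2 ((Q.key_eps _ _ (i1.trans i2.symm) i).2 (h2.1 hm')))
      · exact not_mark_of_ext_eq hB' hB (Ne.symm hne) he.symm (by rw [w1, l2]) w2
    · exact not_mark_of_ext_eq hB hB' hne he (by rw [w1, l1]) w2

/-- For `M`, the truth set of a false box contains no truth set of a true box. -/
theorem Good.not_ext_subset (hw : Q.Good w) (hL : L = .M) {i : Fin n}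
    (hB : Q.ty w h = some B) (hp : OccBox φ i h.isNone p (Q.lev B)) (hm : ¬ Q.mark B p)
    (hB' : Q.ty w h' = some B') (hp' : OccBox φ i h'.isNone p' (Q.lev B')) (hm' : Q.mark B' p') :
    ¬ Q.ext w h' p' ⊆ Q.ext w h p := by
  intro he
  obtain ⟨i1, l1⟩ := hw h B hB
  obtain ⟨i2, l2⟩ := hw h' B' hB'
  have h1 := Q.not_box_M hL B i _ p hp hm
  rw [Q.key_eps _ _ (i1.trans i2.symm) i] at h1
  obtain ⟨W, w1, w2⟩ := (Q.box_M hL B' i _ p' hp' hm').resolve_left h1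
  rw [l2] at w1
  have h2 := he ((mem_ext_only_self hB' w1).2 w2)
  rcases h with _ | o
  · -- a boxed formula has the same truth value in both types
    obtain ⟨ψ, hψ⟩ := _root_.id hp
    rw [Q.key_mark _ _ (i1.trans i2.symm) _ _ hψ (by rwa [l2, ← l1])] at hm
    rw [l1, ← l2] at hp
    obtain ⟨W, w1, w2, w3⟩ := Q.sep_M hL B' i _ p _ p' hp hp' hm hm' (fun _ => rfl)
    rw [l2] at w1
    have h2 := he ((mem_ext_only_self hB' w1).2 w2)
    rw [mem_ext_only_none hB' w1] at h2
    exact w3 h2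
  · by_cases hne : h' = some o
    · subst hne
      obtain rfl : B = B' := Option.some_inj.1 (hB.symm.trans hB')
      obtain ⟨W, w1, w2, w3⟩ := Q.sep_M hL B i _ p _ p' hp hp' hm hm' (fun h => h)
      rw [l1] at w1
      have h2 := he ((mem_ext_only_self hB' w1).2 w2)
      rw [mem_ext_only_self hB w1] at h2
      exact w3 h2
    · exact notMem_ext_only hB hne h2

/-- For `N`, the truth set of a false box is not the set of all children. -/
theorem Good.ext_ne_children (hw : Q.Good w) (hL : L = .N) {i : Fin n}
    (hB : Q.ty w h = some B) (hp : OccBox φ i h.isNone p (Q.lev B)) (hm : ¬ Q.mark B p) :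
    Q.ext w h p ≠ {v | Q.Child w v} := by
  intro he
  obtain ⟨i1, l1⟩ := hw h B hB
  obtain ⟨W, w1, w2⟩ := Q.unit hL B i _ p hp hm
  rw [l1] at w1
  have h1 : Q.only w none W ∈ {v | Q.Child w v} := child_only (Q.ty_none w) w1
  rw [← he] at h1
  rcases h with _ | o
  · rw [mem_ext_only_self (Q.ty_none w) w1] at h1
    exact w2 rfl h1
  · exact notMem_ext_only hB (by simp) h1

/-- For `C`, the truth set of a false box is not an intersection of truth sets of true boxes. -/
theorem Good.ext_ne_sInter (hw : Q.Good w) (hL : L = .C) {i : Fin n}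
    (hB : Q.ty w h = some B) (hp : OccBox φ i h.isNone p (Q.lev B)) (hm : ¬ Q.mark B p)
    {F : Set (Set (World Q.T n))} (hF : F ⊆ Q.pos w i) (hne : F.Nonempty) :
    Q.ext w h p ≠ ⋂₀ F := by
  intro he
  have hL' : L ≠ .M := by rw [hL]; simp
  obtain ⟨i1, l1⟩ := hw h B hB
  have mem : ∀ v, v ∈ Q.ext w h p ↔ ∀ α ∈ F, v ∈ α := fun v => by rw [he]; exact Set.mem_sInter
  -- the truth set is not empty
  obtain ⟨W, w1, w2⟩ : ∃ W, Q.lev W = Q.lev (Q.rep w) + 1 ∧ Q.mark W (p + 1) := by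
    by_cases heps : Q.eps B i
    · rw [← l1]; exact Q.not_box_C hL B i _ p hp hm heps
    · rw [Q.key_eps _ _ i1] at heps
      have hp2 := hp
      rw [l1] at hp2
      have hv : Q.Child w (.joint w i) := .joint hL heps hp2
      have h1 : World.joint w i ∈ Q.ext w h p := by
        rw [mem]
        intro α hα
        obtain ⟨g, q, D, hD, hq, hmq, rfl⟩ := hF hα
        have h2 := hw.isJoint hL heps hp2 hD
        exact ⟨hv, _, ty_joint hD, h2.2.2 _ q hq hmq⟩
      obtain ⟨-, W, h2, h3⟩ := h1
      obtain ⟨h4, h5⟩ := hw.child hv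
      exact ⟨W, by rw [(h4 _ _ h2).2, h5], h3⟩
  -- no other object is involved
  have hobj : ∀ g q D, Q.ty w g = some D → Q.ext w g q ∈ F → g = none ∨ g = h := by
    intro g q D hD hgq
    by_contra! hcon
    obtain ⟨o, rfl⟩ := Option.ne_none_iff_exists'.1 hcon.1
    exact notMem_ext_only hD (Ne.symm hcon.2)
      ((mem _).1 ((mem_ext_only_self hB w1).2 w2) _ hgq)
  have hmark : ∀ g q D, Q.ty w g = some D → OccBox φ i g.isNone q (Q.lev D) → Q.mark D q →
      Q.ext w g q ∈ F → OccBox φ i g.isNone q (Q.lev B) ∧ Q.mark B q ∧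
        (h.isNone = true → g.isNone = true) ∧
        ∀ W, Q.lev W = Q.lev (Q.rep w) + 1 →
          (Q.only w h W ∈ Q.ext w g q ↔ Q.mark W (q + 1)) := by
    intro g q D hD hq hmq hgq
    rcases hobj g q D hD hgq with rfl | rfl
    · obtain ⟨i2, l2⟩ := hw _ _ hD
      obtain ⟨ψ, hψ⟩ := _root_.id hq
      exact ⟨by rwa [l1, ← l2], by
          rwa [Q.key_mark _ _ (i1.trans i2.symm) _ _ (by rwa [l1, ← l2]) hψ],
        fun _ => rfl, fun W hW => mem_ext_only_none hB hW⟩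
    · obtain rfl : B = D := Option.some_inj.1 (hB.symm.trans hD)
      exact ⟨hq, hmq, fun h => h, fun W hW => mem_ext_only_self hB hW⟩
  have himp : ∀ g q D, Q.ty w g = some D → OccBox φ i g.isNone q (Q.lev D) → Q.mark D q →
      Q.ext w g q ∈ F → Q.imp p q := by
    intro g q D hD hq hmq hgq
    by_contra hi
    obtain ⟨h1, h2, h3, h4⟩ := hmark g q D hD hq hmq hgq
    obtain ⟨W, w1, w2, w3⟩ := Q.imp_or hL' B i _ p _ q hp h1 h3 (fun h => (h hL).elim) hi
    rw [l1] at w1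
    exact w3 ((h4 W w1).1 ((mem _).1 ((mem_ext_only_self hB w1).2 w2) _ hgq))
  by_cases hh : ∃ q, Q.ext w h q ∈ F ∧ OccBox φ i h.isNone q (Q.lev B) ∧ Q.mark B q
  · obtain ⟨q, hq1, hq2, hq3⟩ := hh
    obtain ⟨W, w1, w2, w3⟩ := Q.sep_C hL B i _ p q hp hq2 hm hq3 (himp h q B hB hq2 hq3 hq1)
    rw [l1] at w1
    refine w2 ((mem_ext_only_self hB w1).1 ((mem _).2 fun α hα => ?_))
    obtain ⟨g, k, D, hD, hk, hmk, rfl⟩ := hF hα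
    obtain ⟨h1, h2, h3, h4⟩ := hmark g k D hD hk hmk hα
    exact (h4 W w1).2 (w3 _ k h1 h2 (himp g k D hD hk hmk hα) h3)
  · -- only formulas are involved, so the object can be dropped
    have hnone : ∀ g q D, Q.ty w g = some D → OccBox φ i g.isNone q (Q.lev D) → Q.mark D q →
        Q.ext w g q ∈ F → g = none ∧ h ≠ none := by
      intro g q D hD hq hmq hgq
      have hne : g ≠ h := by
        rintro rfl
        obtain rfl : B = D := Option.some_inj.1 (hB.symm.trans hD)
        exact hh ⟨q, hgq, hq, hmq⟩
      have h1 := (hobj g q D hD hgq).resolve_right hne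
      exact ⟨h1, fun h2 => hne (h1.trans h2.symm)⟩
    have h1 : Q.only w none W ∈ Q.ext w h p := by
      rw [mem]
      intro α hα
      obtain ⟨g, k, D, hD, hk, hmk, rfl⟩ := hF hα
      obtain ⟨-, -, -, h4⟩ := hmark g k D hD hk hmk hα
      have h5 := (h4 W w1).1 ((mem _).1 ((mem_ext_only_self hB w1).2 w2) _ hα)
      rw [(hnone g k D hD hk hmk hα).1, mem_ext_only_self (Q.ty_none w) w1]
      exact h5
    obtain ⟨α, hα⟩ := hne
    obtain ⟨g, k, D, hD, hk, hmk, rfl⟩ := hF hα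
    obtain ⟨o, rfl⟩ := Option.ne_none_iff_exists'.1 (hnone g k D hD hk hmk hα).2
    exact notMem_ext_only hB (by simp) h1

/-- The truth set of a box that should be false does not become a neighbourhood. -/
theorem Good.ext_notMem_closure (hw : Q.Good w) {i : Fin n}
    (hB : Q.ty w h = some B) (hp : OccBox φ i h.isNone p (Q.lev B)) (hm : ¬ Q.mark B p) :
    Q.ext w h p ∉ closure L {v | Q.Child w v} (Q.pos w i) := by
  cases L with
  | E =>
    rintro ⟨h', p', B', hB', hp', hm', he⟩
    exact hw.ext_ne (Or.inl rfl) hB hp hm hB' hp' hm' he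
  | M =>
    rintro ⟨α, ⟨h', p', B', hB', hp', hm', rfl⟩, he⟩
    exact hw.not_ext_subset rfl hB hp hm hB' hp' hm' he
  | C =>
    rintro ⟨F, hF, -, hne, he⟩
    exact hw.ext_ne_sInter rfl hB hp hm hF hne he
  | N =>
    rintro (he | ⟨h', p', B', hB', hp', hm', he⟩)
    · exact hw.ext_ne_children rfl hB hp hm he
    · exact hw.ext_ne (Or.inr rfl) hB hp hm hB' hp' hm' he

end separation

variable (Q) in
/-- The frame: a set is a neighbourhood if its trace on the children is as required. -/
def frame : Frame n where
  World := World Q.T n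
  nonempty_world := ⟨.root⟩
  nbhd i w := {α | α ∩ {v | Q.Child w v} ∈ closure L {v | Q.Child w v} (Q.pos w i)}

variable (Q) in
theorem frameClass_frame : L.frameClass Q.frame := by
  cases L with
  | E => trivial
  | M =>
    rintro i w α β ⟨γ, h1, h2⟩ h
    exact ⟨γ, h1, h2.trans (Set.inter_subset_inter_left _ h)⟩
  | C =>
    rintro i w α β ⟨F, h1, h2, h3, h4⟩ ⟨F', h1', h2', h3', h4'⟩
    refine ⟨F ∪ F', Set.union_subset h1 h1', h2.union h2', h3.inl, ?_⟩
    rw [Set.sInter_union, ← h4, ← h4']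
    exact Set.inter_inter_distrib_right _ _ _
  | N => exact fun i w => Or.inl (Set.univ_inter _)

variable (Q) in
/-- The model. A pair of objects belongs to the interpretation of `r` unless this is excluded by
an existential restriction for `r` that should be false. -/
def model : Model Q.frame where
  Obj := World Q.T n × Q.T
  dom w := {o | ∃ B, Q.ty w (some o) = some B}
  dom_nonempty w := ⟨(w, Q.rep w), Q.rep w, Q.ty_self w⟩
  conceptInt w A := {o | ∃ B, Q.ty w (some o) = some B ∧
    ∃ p, Occ φ (.c (.name A)) p (Q.lev B) ∧ Q.mark B p}
  conceptInt_subset := fun _ _ _ ⟨B, h, _⟩ => ⟨B, h⟩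
  roleInt w r := {o | ∃ B B', Q.ty w (some o.1) = some B ∧ Q.ty w (some o.2) = some B' ∧
    ∀ C p, Occ φ (.c (.ex r C)) p (Q.lev B) → Q.mark B' (p + 2 + r.length) → Q.mark B p}
  roleInt_subset := fun _ _ _ ⟨B, B', h, h', _⟩ => ⟨⟨B, h⟩, ⟨B', h'⟩⟩

end Quasi

theorem Model.interp_subset {F : Frame n} (𝔐 : Model F) (C : Concept n) (w : F.World) :
    𝔐.interp C w ⊆ 𝔐.dom w := by
  induction C with
  | name A => exact 𝔐.conceptInt_subset w A
  | neg C _ => exact Set.sdiff_subset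
  | inter C D ih _ => exact Set.inter_subset_left.trans ih
  | ex r C _ => exact fun d h => h.1
  | box i C _ => exact fun d h => h.1

namespace Quasi

variable {L : Log} {φ : Formula n} {Id : Type} {Q : Quasi L φ Id}

theorem mem_nbhd_iff {w : World Q.T n} (hw : Q.Good w) {h : Option (World Q.T n × Q.T)} {B : Q.T}
    {i : Fin n} {p : ℕ} (hB : Q.ty w h = some B) (hp : OccBox φ i h.isNone p (Q.lev B))
    {α : Set (World Q.T n)} (hα : ∀ v, Q.Child w v → (v ∈ α ↔
      ∃ B, Q.ty v h = some B ∧ Q.mark B (p + 1))) :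
    α ∈ Q.frame.nbhd i w ↔ Q.mark B p := by
  have : α ∩ {v | Q.Child w v} = Q.ext w h p := by
    ext v
    constructor
    · rintro ⟨h1, h2⟩; exact ⟨h2, (hα v h2).1 h1⟩
    · rintro ⟨h1, h2⟩; exact ⟨(hα v h1).2 h2, h1⟩
  change α ∩ {v | Q.Child w v} ∈ closure L {v | Q.Child w v} (Q.pos w i) ↔ _
  rw [this]
  constructor
  · intro h1
    by_contra hm
    exact hw.ext_notMem_closure hB hp hm h1
  · intro hm
    exact subset_closure _ _ _ ⟨h, p, B, hB, hp, hm, rfl⟩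

/-- In the model, an object belongs to a concept if and only if the concept is marked in the type of
the object. -/
theorem mem_interp_iff (C : Concept n) : ∀ {p d : ℕ}, Occ φ (.c C) p d → ∀ {w : World Q.T n},
    Q.Good w → Q.lev (Q.rep w) = d → ∀ {o : World Q.T n × Q.T} {B : Q.T},
    Q.ty w (some o) = some B → (o ∈ Q.model.interp C w ↔ Q.mark B p) := by
  induction C with
  | name A =>
    intro p d hp w hw hd o B hB
    have hpB : Occ φ (.c (.name A)) p (Q.lev B) := by rwa [(hw _ _ hB).2, hd]
    constructor
    · rintro ⟨B', hB', p', hp', hm⟩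
      obtain rfl : B = B' := Option.some_inj.1 (hB.symm.trans hB')
      exact (Q.name B A _ _ hp' hpB).1 hm
    · intro hm
      exact ⟨B, hB, p, hpB, hm⟩
  | neg C ih =>
    intro p d hp w hw hd o B hB
    rw [Q.neg B C p d hp, ← ih hp.neg hw hd hB]
    exact ⟨fun h => h.2, fun h => ⟨⟨B, hB⟩, h⟩⟩
  | inter C D ih ih' =>
    intro p d hp w hw hd o B hB
    rw [Q.inter B C D p d hp, ← ih hp.inter_left hw hd hB, ← ih' hp.inter_right hw hd hB]
    rfl
  | ex r C ih =>
    intro p d hp w hw hd o B hB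
    obtain ⟨i1, l1⟩ := hw _ _ hB
    constructor
    · rintro ⟨-, e, he, B', B'', h1, h2, h3⟩
      obtain rfl : B = B' := Option.some_inj.1 (hB.symm.trans h1)
      exact h3 C p (by rwa [l1, hd]) ((ih hp.ex hw hd h2).1 he)
    · intro hm
      obtain ⟨W, w1, w2, w3, w4⟩ := Q.ex B r C p (by rwa [l1, hd]) hm
      have hW : Q.ty w (some (w, W)) = some W := by
        rw [ty_born, born_eq_some, w1, w2]; exact ⟨rfl, i1, l1⟩
      exact ⟨⟨B, hB⟩, (w, W), (ih hp.ex hw hd hW).2 w3, B, W, hB, hW, w4⟩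
  | box i C ih =>
    intro p d hp w hw hd o B hB
    obtain ⟨i1, l1⟩ := hw _ _ hB
    rw [← mem_nbhd_iff (i := i) (p := p) (α := {v | o ∈ Q.model.interp C v}) hw hB
      ⟨C, by rwa [l1, hd]⟩]
    · exact ⟨fun h => h.2, fun h => ⟨⟨B, hB⟩, h⟩⟩
    · intro v hv
      obtain ⟨g, hl⟩ := hw.child hv
      rw [hd] at hl
      constructor
      · intro h
        obtain ⟨B', hB'⟩ := Q.model.interp_subset C v h
        exact ⟨B', hB', (ih hp.box g hl hB').1 h⟩
      · rintro ⟨B', hB', hm⟩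
        exact (ih hp.box g hl hB').2 hm

/-- In the model, a formula holds if and only if it is marked in the type of the world. -/
theorem sat_iff (ψ : Formula n) : ∀ {p d : ℕ}, Occ φ (.f ψ) p d → ∀ {w : World Q.T n},
    Q.Good w → Q.lev (Q.rep w) = d → (Q.model.Sat ψ w ↔ Q.mark (Q.rep w) p) := by
  induction ψ with
  | incl C D =>
    intro p d hp w hw hd
    constructor
    · intro h
      by_contra hm
      obtain ⟨W, w1, w2, w3, w4⟩ := Q.not_incl (Q.rep w) C D p (by rwa [hd]) hm
      have hW : Q.ty w (some (w, W)) = some W := by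
        rw [ty_born, born_eq_some, w1, w2]; exact ⟨rfl, rfl, rfl⟩
      exact w4 ((mem_interp_iff D hp.incl_right hw hd hW).1
        (h ((mem_interp_iff C hp.incl_left hw hd hW).2 w3)))
    · intro hm o ho
      obtain ⟨B, hB⟩ := Q.model.interp_subset C w ho
      obtain ⟨i1, l1⟩ := hw _ _ hB
      rw [Q.key_mark _ _ i1.symm _ _ (by rwa [hd]) (by rwa [l1, hd])] at hm
      exact (mem_interp_iff D hp.incl_right hw hd hB).2
        (Q.incl B C D p d hp hm ((mem_interp_iff C hp.incl_left hw hd hB).1 ho))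
  | neg ψ ih =>
    intro p d hp w hw hd
    rw [Q.fneg _ ψ p d hp, ← ih hp.fneg hw hd]
    rfl
  | and ψ χ ih ih' =>
    intro p d hp w hw hd
    rw [Q.fand _ ψ χ p d hp, ← ih hp.and_left hw hd, ← ih' hp.and_right hw hd]
    rfl
  | box i ψ ih =>
    intro p d hp w hw hd
    refine mem_nbhd_iff (i := i) (p := p) (α := {v | Q.model.Sat ψ v}) hw (Q.ty_none w)
      ⟨ψ, by rwa [hd]⟩ ?_
    intro v hv
    obtain ⟨g, hl⟩ := hw.child hv
    rw [hd] at hl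
    rw [ty_none]
    exact (ih hp.fbox g hl).trans (by simp)

/-- A formula with a quasimodel is satisfiable. -/
theorem satisfiable (Q : Quasi L φ Id) : φ.Satisfiable L := by
  obtain ⟨h1, h2⟩ := Q.root.choose_spec
  exact ⟨Q.frame, Q.frameClass_frame, Q.model, .root, (sat_iff φ .root Q.good_root h1).2 h2⟩

end Quasi
end MLALC

/-! ### The quasimodel of a model -/

namespace MLALC

variable {n : ℕ}

/-- The truth of an expression at a world, for concepts with respect to an object. -/
def Model.holds {F : Frame n} (𝔐 : Model F) (w : F.World) (d : 𝔐.Obj) : Node n → Prop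
  | .c C => d ∈ 𝔐.interp C w
  | .f ψ => 𝔐.Sat ψ w

/-- The truth of the subexpression at position `p` of `φ`. -/
def Model.truth {F : Frame n} (𝔐 : Model F) (φ : Formula n) (w : F.World) (d : 𝔐.Obj) (p : ℕ) :
    Prop :=
  ∃ e k, Occ φ e p k ∧ 𝔐.holds w d e

theorem sInter_mem {X : Type} {N : Set (Set X)} (hN : ∀ α β, α ∈ N → β ∈ N → α ∩ β ∈ N)
    {A : Set (Set X)} (hA : A.Finite) (hne : A.Nonempty) (hAN : A ⊆ N) : ⋂₀ A ∈ N := by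
  induction A, hA using Set.Finite.induction_on with
  | empty => simp at hne
  | @insert α A _ _ ih =>
    rw [Set.sInter_insert]
    rw [Set.insert_subset_iff] at hAN
    rcases A.eq_empty_or_nonempty with rfl | h
    · simpa using hAN.1
    · exact hN _ _ hAN.1 (ih h hAN.2)

section ofModel

variable {F : Frame n} {𝔐 : Model F} {φ : Formula n}

theorem Occ.truth_iff {e : Node n} {p k : ℕ} (h : Occ φ e p k) (w : F.World) (d : 𝔐.Obj) :
    𝔐.truth φ w d p ↔ 𝔐.holds w d e := by
  constructor
  · rintro ⟨e', k', h', h1⟩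
    rwa [h.unique h']
  · intro h1
    exact ⟨e, k, h, h1⟩

theorem OccBox.truth_iff {i : Fin n} {s : Bool} {p k : ℕ} (h : OccBox φ i s p k) {w : F.World}
    {d : 𝔐.Obj} (hd : d ∈ 𝔐.dom w) :
    𝔐.truth φ w d p ↔ {v | 𝔐.truth φ v d (p + 1)} ∈ F.nbhd i w := by
  cases s with
  | true =>
    obtain ⟨ψ, h⟩ := h
    simp only [h.fbox.truth_iff, h.truth_iff]
    rfl
  | false =>
    obtain ⟨C, h⟩ := h
    simp only [h.box.truth_iff, h.truth_iff]
    exact ⟨fun h => h.2, fun h => ⟨hd, h⟩⟩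

theorem OccBox.truth_congr {i : Fin n} {p k : ℕ} (h : OccBox φ i true p k) {w : F.World}
    {d d' : 𝔐.Obj} (hd : 𝔐.truth φ w d (p + 1)) : 𝔐.truth φ w d' (p + 1) := by
  obtain ⟨ψ, h⟩ := h
  rw [h.fbox.truth_iff] at hd ⊢
  exact hd

theorem OccBox.mem_dom {i : Fin n} {p k : ℕ} (h : OccBox φ i false p k) {w : F.World}
    {d : 𝔐.Obj} (hd : 𝔐.truth φ w d (p + 1)) : d ∈ 𝔐.dom w := by
  obtain ⟨C, h⟩ := h
  rw [h.box.truth_iff] at hd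
  exact 𝔐.interp_subset C w hd

/-- An object can be replaced by one that exists at `w`. This does not matter for boxed concepts
with true argument, since they are true of existing objects only, nor for formulas. -/
theorem Model.exists_mem_dom (𝔐 : Model F) (w : F.World) (d : 𝔐.Obj) :
    ∃ d' ∈ 𝔐.dom w, d ∈ 𝔐.dom w → d' = d := by
  by_cases h : d ∈ 𝔐.dom w
  · exact ⟨d, h, fun _ => rfl⟩
  · obtain ⟨d', h'⟩ := 𝔐.dom_nonempty w
    exact ⟨d', h', fun h1 => (h h1).elim⟩

theorem OccBox.truth_of_mem_dom {i : Fin n} {s : Bool} {p k : ℕ} (h : OccBox φ i s p k)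
    {w : F.World} {d d' : 𝔐.Obj} (hd' : d ∈ 𝔐.dom w → d' = d) (hd : 𝔐.truth φ w d (p + 1)) :
    𝔐.truth φ w d' (p + 1) := by
  cases s with
  | true => exact h.truth_congr hd
  | false => rwa [hd' (h.mem_dom hd)]

/-- Only finitely many truth assignments are realized at a world. -/
theorem finite_truth (w : F.World) : {σ | ∃ d ∈ 𝔐.dom w, 𝔐.truth φ w d = σ}.Finite := by
  have : Function.Injective (fun (σ : {σ : ℕ → Prop | ∃ d ∈ 𝔐.dom w, 𝔐.truth φ w d = σ})
      (k : Fin φ.encode.length) => σ.1 k) := by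
    intro σ σ' hσ
    obtain ⟨d, -, hd⟩ := σ.2
    obtain ⟨d', -, hd'⟩ := σ'.2
    refine Subtype.ext (funext fun p => ?_)
    by_cases hp : p < φ.encode.length
    · exact congrFun hσ ⟨p, hp⟩
    · rw [← hd, ← hd']
      exact propext ⟨fun ⟨_, _, h, _⟩ => (hp h.lt_length).elim,
        fun ⟨_, _, h, _⟩ => (hp h.lt_length).elim⟩
  exact Set.finite_coe_iff.1 (Finite.of_injective _ this)

/-- At the world `v`, all boxes `□_i` that are true at `w` have true arguments. Objects of `w` with
the same truth assignment are represented by one of them. -/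
def IsCommon (𝔐 : Model F) (φ : Formula n) (i : Fin n) (w v : F.World) : Prop :=
  ∀ d ∈ 𝔐.dom w, ∃ d' : 𝔐.Obj, 𝔐.truth φ w d' = 𝔐.truth φ w d ∧
    ∀ s p k, OccBox φ i s p k → 𝔐.truth φ w d' p → 𝔐.truth φ v d' (p + 1)

/-- A frame that is closed under intersection is closed under finite intersections, and if the empty
set is not a neighbourhood, then the intersection of the finitely many truth sets is not empty. -/
theorem exists_isCommon (hF : F.ClosedUnderInter) {i : Fin n} {w : F.World}
    (he : ∅ ∉ F.nbhd i w) : ∃ v, IsCommon 𝔐 φ i w v := by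
  classical
  set M := {σ | ∃ d ∈ 𝔐.dom w, 𝔐.truth φ w d = σ} with hM
  obtain ⟨d₀, -⟩ := 𝔐.dom_nonempty w
  have : Nonempty 𝔐.Obj := ⟨d₀⟩
  choose! f hf1 hf2 using fun σ (hσ : σ ∈ M) => hσ
  let A : Set (Set F.World) := {α | ∃ σ ∈ M, ∃ p, (∃ s k, OccBox φ i s p k) ∧
    𝔐.truth φ w (f σ) p ∧ {v | 𝔐.truth φ v (f σ) (p + 1)} = α}
  have hfin : A.Finite := by
    refine ((finite_truth (𝔐 := 𝔐) (φ := φ) w).image2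
      (fun σ p => {v | 𝔐.truth φ v (f σ) (p + 1)}) (Set.finite_Iio φ.encode.length)).subset ?_
    rintro α ⟨σ, hσ, p, ⟨s, k, hp⟩, -, rfl⟩
    refine ⟨σ, hσ, p, ?_, rfl⟩
    cases s <;> obtain ⟨_, hp⟩ := hp <;> exact hp.lt_length
  have hAN : A ⊆ F.nbhd i w := by
    rintro α ⟨σ, hσ, p, ⟨s, k, hp⟩, h, rfl⟩
    exact (hp.truth_iff (hf1 σ hσ)).1 h
  obtain ⟨v, hv⟩ : ∃ v, ∀ α ∈ A, v ∈ α := by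
    rcases A.eq_empty_or_nonempty with h | h
    · exact ⟨w, by simp [h]⟩
    · have h1 := sInter_mem (hF i w) hfin h hAN
      rcases (⋂₀ A).eq_empty_or_nonempty with h2 | ⟨v, hv⟩
      · rw [h2] at h1; exact (he h1).elim
      · exact ⟨v, hv⟩
  refine ⟨v, fun d hd => ⟨f (𝔐.truth φ w d), hf2 _ ⟨d, hd, rfl⟩, fun s p k hp h => ?_⟩⟩
  exact hv _ ⟨_, ⟨d, hd, rfl⟩, p, ⟨s, k, hp⟩, h, rfl⟩

open Classical in
/-- A world as in `IsCommon`, if there is one. -/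
noncomputable def common (𝔐 : Model F) (φ : Formula n) (w : F.World) (i : Fin n) : F.World :=
  if h : ∃ v, IsCommon 𝔐 φ i w v then h.choose else w

/-- The truth assignment `τ` is realized. -/
def Realized (𝔐 : Model F) (φ : Formula n) (τ : ℕ → Prop) : Prop :=
  ∃ w, ∃ d ∈ 𝔐.dom w, 𝔐.truth φ w d = τ

variable (𝔐 φ) in
/-- The types of the quasimodel. Only those worlds are used that are reached by a short path of
common worlds from a world that is selected for a realized truth assignment `τ`; the identity of
a world consists of `τ` and the path. -/
structure ModelType where
  lev : ℕ
  τ : ℕ → Prop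
  real : Realized 𝔐 φ τ
  path : List (Fin n)
  path_le : path.length ≤ lev
  path_le' : path.length ≤ φ.encode.length
  obj : 𝔐.Obj
  mem : obj ∈ 𝔐.dom (path.foldl (common 𝔐 φ) real.choose)

namespace ModelType

/-- The world of a type. -/
noncomputable def world (B : ModelType 𝔐 φ) : F.World :=
  B.path.foldl (common 𝔐 φ) B.real.choose

/-- The truth assignment of a type. -/
def mark (B : ModelType 𝔐 φ) (p : ℕ) : Prop := 𝔐.truth φ B.world B.obj p

/-- The code of the identity of a world. -/
def code (τ : ℕ → Prop) (path : List (Fin n)) (k : ℕ) : Prop × Option (Fin n) := (τ k, path[k]?)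

theorem code_inj {τ τ' : ℕ → Prop} {l l' : List (Fin n)} (h : code τ l = code τ' l') :
    τ = τ' ∧ l = l' :=
  ⟨funext fun k => congrArg Prod.fst (congrFun h k),
    List.ext_getElem? fun k => congrArg Prod.snd (congrFun h k)⟩

theorem world_eq {B B' : ModelType 𝔐 φ} (h : code B.τ B.path = code B'.τ B'.path) :
    B.world = B'.world := by
  obtain ⟨h1, h2⟩ := code_inj h
  cases B; cases B'
  simp only at h1 h2
  subst h1; subst h2
  rfl

theorem mem_world (B : ModelType 𝔐 φ) : B.obj ∈ 𝔐.dom B.world := B.mem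

/-- The same world, with another object. -/
def withObj (B : ModelType 𝔐 φ) (d : 𝔐.Obj) (hd : d ∈ 𝔐.dom B.world) : ModelType 𝔐 φ :=
  { B with obj := d, mem := hd }

/-- Every realized truth assignment belongs to a type of every modal depth. -/
theorem exists_of_mem_dom {w : F.World} {d : 𝔐.Obj} (hd : d ∈ 𝔐.dom w) (l : ℕ) :
    ∃ B : ModelType 𝔐 φ, B.lev = l ∧ B.mark = 𝔐.truth φ w d := by
  have h : Realized 𝔐 φ (𝔐.truth φ w d) := ⟨w, d, hd, rfl⟩
  obtain ⟨h1, h2⟩ := h.choose_spec.choose_spec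
  exact ⟨⟨l, _, h, [], Nat.zero_le _, Nat.zero_le _, _, h1⟩, rfl, h2⟩

/-- A world at which the argument of one box is true and that of another box is false provides
a type. -/
theorem exists_separating (B : ModelType 𝔐 φ) {i : Fin n} {s s' : Bool} {p p' : ℕ}
    (hp : OccBox φ i s p B.lev) (hp' : OccBox φ i s' p' B.lev) (hs : s' = true → s = true)
    {v : F.World} (hv : 𝔐.truth φ v B.obj (p' + 1)) (hv' : ¬ 𝔐.truth φ v B.obj (p + 1)) :
    ∃ W : ModelType 𝔐 φ, W.lev = B.lev + 1 ∧ W.mark (p' + 1) ∧ ¬ W.mark (p + 1) := by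
  obtain ⟨d', hd', h5⟩ := 𝔐.exists_mem_dom v B.obj
  obtain ⟨W, h1, h2⟩ := exists_of_mem_dom (φ := φ) hd' (B.lev + 1)
  refine ⟨W, h1, by rw [h2]; exact hp'.truth_of_mem_dom h5 hv, fun h => hv' ?_⟩
  rw [h2] at h
  cases s with
  | true => exact hp.truth_congr h
  | false =>
    cases s' with
    | true => simp at hs
    | false => rwa [h5 (hp'.mem_dom hv)] at h

/-- A world as in `IsCommon` provides the type that is required by `Quasi.joint`. -/
theorem exists_common {L : Log} (hF : L.frameClass F) (hL : L = .C) (B : ModelType 𝔐 φ)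
    {i : Fin n} {s : Bool} {p : ℕ} (hp : OccBox φ i s p B.lev) (he : ∅ ∉ F.nbhd i B.world) :
    ∃ W : ModelType 𝔐 φ, W.lev = B.lev + 1 ∧ code W.τ W.path = code B.τ (B.path ++ [i]) ∧
      ∀ s' p', OccBox φ i s' p' B.lev → B.mark p' → W.mark (p' + 1) := by
  subst hL
  have h1 := hp.lt_length
  have h2 := B.path_le
  have h3 : IsCommon 𝔐 φ i B.world (common 𝔐 φ B.world i) := by
    have := exists_isCommon (𝔐 := 𝔐) (φ := φ) hF he
    rw [common, dif_pos this]
    exact this.choose_spec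
  obtain ⟨d, hd, h4⟩ := h3 _ B.mem_world
  obtain ⟨d', hd', h5⟩ := 𝔐.exists_mem_dom (common 𝔐 φ B.world i) d
  have h6 : (B.path ++ [i]).foldl (common 𝔐 φ) B.real.choose = common 𝔐 φ B.world i := by
    rw [List.foldl_append]; rfl
  refine ⟨⟨B.lev + 1, B.τ, B.real, B.path ++ [i], by simpa using h2, by simp; omega, d', by
    rwa [h6]⟩, rfl, rfl, fun s' p' hp' hm => ?_⟩
  have h7 := hp'.truth_of_mem_dom h5 (h4 _ _ _ hp' (by rw [hd]; exact hm))
  simp only [mark, world, h6]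
  exact h7

end ModelType

open ModelType in
/-- The quasimodel of a model. -/
noncomputable def Model.quasi {L : Log} (hF : L.frameClass F) (𝔐 : Model F) {w₀ : F.World}
    (h₀ : 𝔐.Sat φ w₀) : Quasi L φ (ℕ → Prop × Option (Fin n)) where
  T := ModelType 𝔐 φ
  mark := mark
  lev := ModelType.lev
  id B := code B.τ B.path
  tgt B i := code B.τ (B.path ++ [i])
  eps B i := ∅ ∈ F.nbhd i B.world
  imp p p' := ∀ w, ∀ d ∈ 𝔐.dom w, 𝔐.truth φ w d (p + 1) → 𝔐.truth φ w d (p' + 1)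
  root := by
    obtain ⟨d, hd⟩ := 𝔐.dom_nonempty w₀
    obtain ⟨B, h1, h2⟩ := exists_of_mem_dom (φ := φ) hd 0
    exact ⟨B, h1, by rw [h2, Occ.root.truth_iff]; exact h₀⟩
  name B A p p' h h' := by simp only [mark, h.truth_iff, h'.truth_iff]
  neg B C p d h := by
    simp only [mark, h.truth_iff, h.neg.truth_iff]
    exact ⟨fun h => h.2, fun h => ⟨B.mem_world, h⟩⟩
  inter B C D p d h := by
    simp only [mark, h.truth_iff, h.inter_left.truth_iff, h.inter_right.truth_iff]
    rfl
  fneg B ψ p d h := by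
    simp only [mark, h.truth_iff, h.fneg.truth_iff]
    rfl
  fand B ψ χ p d h := by
    simp only [mark, h.truth_iff, h.and_left.truth_iff, h.and_right.truth_iff]
    rfl
  incl B C D p d h := by
    simp only [mark, h.truth_iff, h.incl_left.truth_iff, h.incl_right.truth_iff]
    exact fun h h' => h h'
  not_incl B C D p h hm := by
    rw [mark, h.truth_iff] at hm
    obtain ⟨e, he, he'⟩ := Set.not_subset.1 hm
    exact ⟨B.withObj e (𝔐.interp_subset _ _ he), rfl, rfl, (h.incl_left.truth_iff _ _).2 he,
      fun h' => he' ((h.incl_right.truth_iff _ _).1 h')⟩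
  ex B r C p h hm := by
    rw [mark, h.truth_iff] at hm
    obtain ⟨-, e, he, her⟩ := hm
    refine ⟨B.withObj e (𝔐.interp_subset _ _ he), rfl, rfl, (h.ex.truth_iff _ _).2 he, ?_⟩
    intro C' p' h' hm'
    exact (h'.truth_iff _ _).2 ⟨B.mem_world, e, (h'.ex.truth_iff _ _).1 hm', her⟩
  key_mark B B' h ψ p hp _ := by
    simp only [mark, hp.truth_iff, world_eq h]
    rfl
  key_eps B B' h i := by rw [world_eq h]
  key_tgt B B' h i := by rw [(code_inj h).1, (code_inj h).2]
  box_EN hL B i s p hp := by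
    rcases Set.eq_empty_or_nonempty {v | 𝔐.truth φ v B.obj (p + 1)} with h | ⟨v, hv⟩
    · left
      rw [mark, hp.truth_iff B.mem_world, h]
    · right
      obtain ⟨d', hd', h5⟩ := 𝔐.exists_mem_dom v B.obj
      obtain ⟨W, h1, h2⟩ := exists_of_mem_dom (φ := φ) hd' (B.lev + 1)
      exact ⟨W, h1, by rw [h2]; exact hp.truth_of_mem_dom h5 hv⟩
  box_M hL B i s p hp hm := by
    rcases Set.eq_empty_or_nonempty {v | 𝔐.truth φ v B.obj (p + 1)} with h | ⟨v, hv⟩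
    · left
      rwa [mark, hp.truth_iff B.mem_world, h] at hm
    · right
      obtain ⟨d', hd', h5⟩ := 𝔐.exists_mem_dom v B.obj
      obtain ⟨W, h1, h2⟩ := exists_of_mem_dom (φ := φ) hd' (B.lev + 1)
      exact ⟨W, h1, by rw [h2]; exact hp.truth_of_mem_dom h5 hv⟩
  not_box_M hL B i s p hp hm he := by
    subst hL
    rw [mark, hp.truth_iff B.mem_world] at hm
    exact hm (hF i B.world _ _ he (Set.empty_subset _))
  not_box_C hL B i s p hp hm he := by
    rw [mark, hp.truth_iff B.mem_world] at hm
    rcases Set.eq_empty_or_nonempty {v | 𝔐.truth φ v B.obj (p + 1)} with h | ⟨v, hv⟩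
    · rw [h] at hm; exact (hm he).elim
    · obtain ⟨d', hd', h5⟩ := 𝔐.exists_mem_dom v B.obj
      obtain ⟨W, h1, h2⟩ := exists_of_mem_dom (φ := φ) hd' (B.lev + 1)
      exact ⟨W, h1, by rw [h2]; exact hp.truth_of_mem_dom h5 hv⟩
  joint hL B i s p hp he := exists_common hF hL B hp he
  unit hL B i s p hp hm := by
    subst hL
    rw [mark, hp.truth_iff B.mem_world] at hm
    obtain ⟨v, hv⟩ : ∃ v, v ∉ {v | 𝔐.truth φ v B.obj (p + 1)} := by
      by_contra! hcon
      rw [Set.eq_univ_of_forall hcon] at hm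
      exact hm (hF i B.world)
    obtain ⟨d', hd'⟩ := 𝔐.dom_nonempty v
    obtain ⟨W, h1, h2⟩ := exists_of_mem_dom (φ := φ) hd' (B.lev + 1)
    refine ⟨W, h1, fun hs hm' => hv ?_⟩
    subst hs
    rw [h2] at hm'
    exact hp.truth_congr hm'
  imp_or hL B i s p s' p' hp hp' hs hs' hi := by
    push Not at hi
    obtain ⟨w, d, hd, h1, h2⟩ := hi
    obtain ⟨W, h3, h4⟩ := exists_of_mem_dom (φ := φ) hd (B.lev + 1)
    exact ⟨W, h3, by rwa [h4], by rwa [h4]⟩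
  sep_EN hL B i s p p' hp hp' hm hm' hi := by
    rw [mark, hp.truth_iff B.mem_world] at hm
    rw [mark, hp'.truth_iff B.mem_world] at hm'
    by_contra hcon
    refine hm ?_
    convert hm' using 1
    refine Set.Subset.antisymm (fun v hv => ?_) (fun v hv => ?_)
    · obtain ⟨d', hd', h5⟩ := 𝔐.exists_mem_dom v B.obj
      have h1 := hi v d' hd' (hp.truth_of_mem_dom h5 hv)
      cases s with
      | true => exact hp'.truth_congr h1
      | false => rwa [h5 (hp.mem_dom hv)] at h1
    · by_contra hv'
      exact hcon (B.exists_separating hp hp' (fun h => h) hv hv')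
  sep_M hL B i s p s' p' hp hp' hm hm' hs := by
    subst hL
    rw [mark, hp.truth_iff B.mem_world] at hm
    rw [mark, hp'.truth_iff B.mem_world] at hm'
    by_contra hcon
    refine hm (hF i B.world _ _ hm' fun v hv => ?_)
    by_contra hv'
    exact hcon (B.exists_separating hp hp' hs hv hv')
  sep_C hL B i s p p' hp hp' hm hm' hi := by
    subst hL
    rw [mark, hp.truth_iff B.mem_world] at hm
    -- the intersection of the truth sets of all positive boxes that are implied by `p`
    let A : Set (Set F.World) := {α | ∃ s' k, OccBox φ i s' k B.lev ∧ B.mark k ∧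
      (∀ w, ∀ d ∈ 𝔐.dom w, 𝔐.truth φ w d (p + 1) → 𝔐.truth φ w d (k + 1)) ∧
      (s = true → s' = true) ∧ {v | 𝔐.truth φ v B.obj (k + 1)} = α}
    have hfin : A.Finite := by
      refine ((Set.finite_Iio φ.encode.length).image
        (fun k => {v | 𝔐.truth φ v B.obj (k + 1)})).subset ?_
      rintro α ⟨s', k, hk, -, -, -, rfl⟩
      refine ⟨k, ?_, rfl⟩
      cases s' <;> obtain ⟨_, hk⟩ := hk <;> exact hk.lt_length
    have hAN : ⋂₀ A ∈ F.nbhd i B.world := by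
      refine sInter_mem (hF i B.world) hfin ⟨_, s, p', hp', hm', hi, fun h => h, rfl⟩ ?_
      rintro α ⟨s', k, hk, hmk, -, -, rfl⟩
      rwa [mark, hk.truth_iff B.mem_world] at hmk
    have hsub : {v | 𝔐.truth φ v B.obj (p + 1)} ⊆ ⋂₀ A := by
      rintro v hv α ⟨s', k, hk, -, hik, hs, rfl⟩
      obtain ⟨d', hd', h5⟩ := 𝔐.exists_mem_dom v B.obj
      have h1 := hik v d' hd' (hp.truth_of_mem_dom h5 hv)
      cases s' with
      | true => exact hk.truth_congr h1
      | false =>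
        cases s with
        | true => simp at hs
        | false => rwa [h5 (hp.mem_dom hv)] at h1
    obtain ⟨v, hv, hv'⟩ : ∃ v ∈ ⋂₀ A, ¬ 𝔐.truth φ v B.obj (p + 1) := by
      by_contra! hcon
      rw [Set.Subset.antisymm hsub hcon] at hm
      exact hm hAN
    have hmem : ∀ s' k, OccBox φ i s' k B.lev → B.mark k →
        (∀ w, ∀ d ∈ 𝔐.dom w, 𝔐.truth φ w d (p + 1) → 𝔐.truth φ w d (k + 1)) →
        (s = true → s' = true) → 𝔐.truth φ v B.obj (k + 1) := by
      intro s' k hk hmk hik hs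
      exact hv _ ⟨s', k, hk, hmk, hik, hs, rfl⟩
    obtain ⟨d', hd', h5⟩ := 𝔐.exists_mem_dom v B.obj
    obtain ⟨W, h1, h2⟩ := exists_of_mem_dom (φ := φ) hd' (B.lev + 1)
    refine ⟨W, h1, fun h => hv' ?_, fun s' k hk hmk hik hs => ?_⟩
    · rw [h2] at h
      cases s with
      | true => exact hp.truth_congr h
      | false => rwa [h5 (hp'.mem_dom (hmem _ p' hp' hm' hi (fun h => h)))] at h
    · rw [h2]
      exact hk.truth_of_mem_dom h5 (hmem _ k hk hmk hik hs)

end ofModel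

/-- A satisfiable formula has a quasimodel in which the identities of worlds are words over a
finite alphabet that are determined by a prefix of the length of the formula. -/
theorem Formula.Satisfiable.exists_quasi {L : Log} {φ : Formula n} (h : φ.Satisfiable L) :
    ∃ Q : Quasi L φ (ℕ → Prop × Option (Fin n)),
      ∀ B B', (∀ k < φ.encode.length, Q.id B k = Q.id B' k) → Q.id B = Q.id B' := by
  obtain ⟨F, hF, 𝔐, w, hw⟩ := h
  refine ⟨𝔐.quasi hF hw, fun (B B' : ModelType 𝔐 φ) h => funext fun k => ?_⟩
  by_cases hk : k < φ.encode.length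
  · exact h k hk
  · have h1 : ∀ B : ModelType 𝔐 φ, ModelType.code B.τ B.path k = (False, none) := by
      intro B
      refine Prod.ext (eq_false ?_) (List.getElem?_eq_none (by have := B.path_le'; omega))
      obtain ⟨w, d, -, h2⟩ := B.real
      change ¬ B.τ k
      rw [← h2]
      rintro ⟨e, l, h3, -⟩
      exact hk h3.lt_length
    exact (h1 B).trans (h1 B').symm

end MLALC

/-! ### Conditions on adjacent columns -/

/-- The automaton guesses `θ`, and it checks in addition to `P` that `ok` holds of every letter and
the letter to the right of it, and that `fin` holds of the information whether a letter with `diff`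
occurs, and of the first letter. -/
def PDA.guess {Col Θ : Type} [Finite Col] [Finite Θ] (P : PDA Col)
    (ok : Θ → Col → Option Col → Prop) (diff : Col → Prop) (fin : Θ → Prop → Option Col → Prop) : PDA Col where
  Q := Θ × Prop × Option Col × P.Q
  finite_Q := by
    have := P.finite_Q
    infer_instance
  Stk := P.Stk
  finite_Stk := P.finite_Stk
  start := {q | ¬ q.2.1 ∧ q.2.2.1 = none ∧ q.2.2.2 ∈ P.start}
  acc := {q | fin q.1 q.2.1 q.2.2.1 ∧ q.2.2.2 ∈ P.acc}
  δ q c t := {A | A.1.1 = q.1 ∧ A.1.2.1 = (diff c ∨ q.2.1) ∧ A.1.2.2.1 = some c ∧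
    ok q.1 c q.2.2.1 ∧ (A.1.2.2.2, A.2) ∈ P.δ q.2.2.2 c t}

theorem PDA.Run.nil_inv {Col : Type} {P : PDA Col} {q : P.Q} {st : List P.Stk}
    (h : P.Run [] q st) : q ∈ P.start ∧ st = [] := by
  cases h with
  | nil h => exact ⟨h, rfl⟩

theorem PDA.Run.cons_inv {Col : Type} {P : PDA Col} {c : Col} {cs : List Col} {q : P.Q}
    {st : List P.Stk} (h : P.Run (c :: cs) q st) :
    ∃ q₀ st₀ op, P.Run cs q₀ st₀ ∧ (q, op) ∈ P.δ q₀ c st₀.head? ∧ st = op.app st₀ := by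
  cases h with
  | cons h hs => exact ⟨_, _, _, h, hs, rfl⟩

theorem PDA.run_guess_iff {Col Θ : Type} [Finite Col] [Finite Θ] {P : PDA Col}
    {ok : Θ → Col → Option Col → Prop} {diff : Col → Prop} {fin : Θ → Prop → Option Col → Prop}
    {cs : List Col} {θ : Θ} {s : Prop} {c : Option Col} {q : P.Q} {st : List P.Stk} :
    (P.guess ok diff fin).Run cs (θ, s, c, q) st ↔ P.Run cs q st ∧ s = (∃ a ∈ cs, diff a) ∧
      c = cs.head? ∧ ∀ k (h : k < cs.length), ok θ cs[k] cs[k + 1]? := by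
  induction cs generalizing s c q st with
  | nil =>
    constructor
    · intro h
      obtain ⟨⟨h1, h2, h3⟩, rfl⟩ := PDA.Run.nil_inv h
      exact ⟨.nil h3, by simpa using h1, h2, by simp⟩
    · rintro ⟨h1, rfl, rfl, -⟩
      obtain ⟨h, rfl⟩ := h1.nil_inv
      exact .nil ⟨by simp, rfl, h⟩
  | cons a cs ih =>
    constructor
    · intro h
      obtain ⟨⟨θ₀, s₀, c₀, q₀⟩, st₀, op, h, ⟨h1, h2, h3, h4, h5⟩, rfl⟩ := PDA.Run.cons_inv h
      simp only at h1 h2 h3 h4 h5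
      subst h1
      obtain ⟨i1, i2, i3, i4⟩ := ih.1 h
      refine ⟨.cons i1 h5, by rw [h2, i2]; simp, h3, ?_⟩
      rintro (_ | k) hk
      · rw [i3] at h4
        cases cs <;> simpa using h4
      · simpa using i4 k (by simpa using hk)
    · rintro ⟨h1, rfl, rfl, h4⟩
      obtain ⟨q₀, st₀, op, h, hs, rfl⟩ := h1.cons_inv
      refine .cons (P := P.guess ok diff fin) (ih.2 ⟨h, rfl, rfl, fun k hk => ?_⟩)
        ⟨rfl, by simp, rfl, ?_, hs⟩
      · exact h4 (k + 1) (by simpa using hk)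
      · have := h4 0 (by simp)
        cases cs <;> simpa using this

/-- Besides the run of `P`, the conditions on adjacent columns are tested, together with a condition
`fin` on the guess, the occurrence of a column with `diff`, and the first column. -/
theorem PDA.accepts_guess_iff {Col Θ : Type} [Finite Col] [Finite Θ] {P : PDA Col}
    {ok : Θ → Col → Option Col → Prop} {diff : Col → Prop} {fin : Θ → Prop → Option Col → Prop}
    {cs : List Col} : (P.guess ok diff fin).Accepts cs ↔ P.Accepts cs ∧ ∃ θ,
      (∀ k (h : k < cs.length), ok θ cs[k] cs[k + 1]?) ∧ fin θ (∃ a ∈ cs, diff a) cs.head? := by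
  constructor
  · rintro ⟨⟨θ, s, c, q⟩, ⟨h1, h2⟩, h3⟩
    obtain ⟨i1, rfl, rfl, i4⟩ := PDA.run_guess_iff.1 h3
    exact ⟨⟨q, h2, i1⟩, θ, i4, h1⟩
  · rintro ⟨⟨q, h2, i1⟩, θ, i4, h1⟩
    exact ⟨(θ, _, _, q), ⟨h1, h2⟩, PDA.run_guess_iff.2 ⟨i1, rfl, rfl, i4⟩⟩

/-! ### Cells and the local conditions -/

namespace MLALC

variable {n : ℕ}

/-- The letters of blocks. A block is a type, given by `mark`, together with auxiliary tracks:
`ch` holds the mark of the argument of a box or existential restriction (for an inclusion, whether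
it has a counterexample), `act` and `nxt` say that the position has the modal depth of the type or
the next one; `eps`, `id` and `tgt` are as in a quasimodel. The last four tracks do not concern
the type: `P1` and `P2` mark positions, `gt` is a row of the relation `imp`, and `nm` marks the
positions from which on a certain name is read. -/
structure Cell (n : ℕ) where
  mark : Prop
  ch : Prop
  act : Prop
  nxt : Prop
  eps : Fin n → Prop
  id : Prop × Option (Fin n)
  tgt : Fin n → Prop × Option (Fin n)
  P1 : Prop
  P2 : Prop
  gt : Prop
  nm : Prop

instance : Finite (Cell n) :=
  Finite.of_injective
    (fun c : Cell n => (c.mark, c.ch, c.act, c.nxt, c.eps, c.id, c.tgt, c.P1, c.P2, c.gt, c.nm))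
    (by rintro ⟨⟩ ⟨⟩ h; simpa using h)

instance : Finite (Letter n) :=
  Finite.of_injective
    (fun a : Letter n => match a with
      | .bit b => (Sum.inl b : Bool ⊕ Fin 8 ⊕ Fin n ⊕ Fin n)
      | .endName => .inr (.inl 0)
      | .cName => .inr (.inl 1)
      | .cNeg => .inr (.inl 2)
      | .cInter => .inr (.inl 3)
      | .cEx => .inr (.inl 4)
      | .fIncl => .inr (.inl 5)
      | .fNeg => .inr (.inl 6)
      | .fAnd => .inr (.inl 7)
      | .cBox i => .inr (.inr (.inl i))
      | .fBox i => .inr (.inr (.inr i)))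
    (by
      rintro (_ | _ | _ | _ | _ | _ | _ | _ | _ | _ | _)
        (_ | _ | _ | _ | _ | _ | _ | _ | _ | _ | _) <;>
        simp)

/-- The depth tracks are inherited by a subexpression that is not in the scope of a box. -/
def Down (g u : Cell n) : Prop := (g.act → u.act) ∧ (g.nxt → u.nxt)

/-- The local conditions on the tracks `f` at the occurrence of a concept at position `p`. -/
def LocC : Concept n → (ℕ → Cell n) → ℕ → Prop
  | .name _, _, _ => True
  | .neg C, f, p => ((f p).mark ↔ ¬ (f (p + 1)).mark) ∧ Down (f p) (f (p + 1)) ∧ LocC C f (p + 1)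
  | .inter C D, f, p =>
    ((f p).mark ↔ (f (p + 1)).mark ∧ (f (p + 1 + C.encode.length)).mark) ∧
      Down (f p) (f (p + 1)) ∧ Down (f p) (f (p + 1 + C.encode.length)) ∧
      LocC C f (p + 1) ∧ LocC D f (p + 1 + C.encode.length)
  | .ex r C, f, p => ((f p).ch ↔ (f (p + 2 + r.length)).mark) ∧
      Down (f p) (f (p + 2 + r.length)) ∧ LocC C f (p + 2 + r.length)
  | .box _ C, f, p => ((f p).ch ↔ (f (p + 1)).mark) ∧ ((f p).act → (f (p + 1)).nxt) ∧
      LocC C f (p + 1)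

/-- The local conditions on the tracks `f` at the occurrence of a formula at position `p`. -/
def LocF : Formula n → (ℕ → Cell n) → ℕ → Prop
  | .incl C D, f, p =>
    ((f p).ch ↔ (f (p + 1)).mark ∧ ¬ (f (p + 1 + C.encode.length)).mark) ∧
      ((f p).mark → ¬ (f p).ch) ∧
      Down (f p) (f (p + 1)) ∧ Down (f p) (f (p + 1 + C.encode.length)) ∧
      LocC C f (p + 1) ∧ LocC D f (p + 1 + C.encode.length)
  | .neg ψ, f, p => ((f p).mark ↔ ¬ (f (p + 1)).mark) ∧ Down (f p) (f (p + 1)) ∧ LocF ψ f (p + 1)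
  | .and ψ χ, f, p =>
    ((f p).mark ↔ (f (p + 1)).mark ∧ (f (p + 1 + ψ.encode.length)).mark) ∧
      Down (f p) (f (p + 1)) ∧ Down (f p) (f (p + 1 + ψ.encode.length)) ∧
      LocF ψ f (p + 1) ∧ LocF χ f (p + 1 + ψ.encode.length)
  | .box _ ψ, f, p => ((f p).ch ↔ (f (p + 1)).mark) ∧ ((f p).act → (f (p + 1)).nxt) ∧
      LocF ψ f (p + 1)

/-- The local conditions for a concept or a formula. -/
def LocN : Node n → (ℕ → Cell n) → ℕ → Prop
  | .c C => LocC C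
  | .f ψ => LocF ψ

/-- The sort of an expression. -/
def Node.isF : Node n → Bool
  | .c _ => false
  | .f _ => true

theorem Occ.locN {φ : Formula n} {f : ℕ → Cell n} (hφ : LocF φ f 0) {e : Node n} {p d : ℕ}
    (h : Occ φ e p d) : LocN e f p := by
  induction h with
  | root => exact hφ
  | neg _ ih => exact ih.2.2
  | inter_left _ ih => exact ih.2.2.2.1
  | inter_right _ ih => exact ih.2.2.2.2
  | ex _ ih => exact ih.2.2
  | box _ ih => exact ih.2.2
  | incl_left _ ih => exact ih.2.2.2.2.1
  | incl_right _ ih => exact ih.2.2.2.2.2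
  | fneg _ ih => exact ih.2.2
  | and_left _ ih => exact ih.2.2.2.1
  | and_right _ ih => exact ih.2.2.2.2
  | fbox _ ih => exact ih.2.2

/-- A property that is inherited downwards holds at all positions of modal depth `l` if it holds
at the topmost ones. -/
theorem Occ.of_top {φ : Formula n} {f : ℕ → Cell n} (hφ : LocF φ f 0) {R : ℕ → Prop} {l : ℕ}
    (hR : ∀ p p', Down (f p) (f p') → R p → R p') (h0 : l = 0 → R 0)
    (h1 : ∀ i s p d, OccBox φ i s p d → l = d + 1 → ((f p).act → (f (p + 1)).nxt) → R (p + 1))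
    {e : Node n} {p d : ℕ} (h : Occ φ e p d) (hd : d = l) : R p := by
  induction h with
  | root => exact h0 hd.symm
  | neg h ih => exact hR _ _ (h.locN hφ).2.1 (ih hd)
  | inter_left h ih => exact hR _ _ (h.locN hφ).2.1 (ih hd)
  | inter_right h ih => exact hR _ _ (h.locN hφ).2.2.1 (ih hd)
  | ex h ih => exact hR _ _ (h.locN hφ).2.1 (ih hd)
  | box h _ => exact h1 _ false _ _ ⟨_, h⟩ hd.symm (h.locN hφ).2.1
  | incl_left h ih => exact hR _ _ (h.locN hφ).2.2.1 (ih hd)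
  | incl_right h ih => exact hR _ _ (h.locN hφ).2.2.2.1 (ih hd)
  | fneg h ih => exact hR _ _ (h.locN hφ).2.1 (ih hd)
  | and_left h ih => exact hR _ _ (h.locN hφ).2.1 (ih hd)
  | and_right h ih => exact hR _ _ (h.locN hφ).2.2.1 (ih hd)
  | fbox h _ => exact h1 _ true _ _ ⟨_, h⟩ hd.symm (h.locN hφ).2.1

theorem OccBox.exists_occ {φ : Formula n} {i : Fin n} {s : Bool} {p d : ℕ} (h : OccBox φ i s p d) :
    ∃ e, Occ φ e p d := by
  cases s <;> obtain ⟨_, h⟩ := h <;> exact ⟨_, h⟩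

/-- The positions of modal depth `0` are active if the first position is. -/
theorem Occ.act_of_root {φ : Formula n} {f : ℕ → Cell n} (hφ : LocF φ f 0) (h0 : (f 0).act)
    {e : Node n} {p : ℕ} (h : Occ φ e p 0) : (f p).act :=
  h.of_top hφ (R := fun p => (f p).act) (fun _ _ h => h.1) (fun _ => h0)
    (fun _ _ _ _ _ h => by omega) rfl

/-- If all positions of modal depth `l` are active, then `nxt` holds at those of depth `l + 1`. -/
theorem Occ.nxt_of_act {φ : Formula n} {f : ℕ → Cell n} (hφ : LocF φ f 0) {l : ℕ}
    (hl : ∀ e p, Occ φ e p l → (f p).act) {e : Node n} {p : ℕ} (h : Occ φ e p (l + 1)) :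
    (f p).nxt := by
  refine h.of_top hφ (R := fun p => (f p).nxt) (fun _ _ h => h.2) (by omega) ?_ rfl
  intro i s p d hp hd hb
  obtain rfl : l = d := by omega
  obtain ⟨e, he⟩ := hp.exists_occ
  exact hb (hl e p he)

/-! ### The automaton for the local conditions -/

/-- The moves of the automaton that reads the code of a formula from right to left. Its memory,
which is a stack the top of which is kept in the state, holds the sorts and the cells of the
expressions that have been read and not yet been used; the bit in the state says that a name is
being read. -/
inductive LocStep : Bool × Option (Bool × Cell n) → Letter n → Cell n → Option (Bool × Cell n) →
    Bool × Option (Bool × Cell n) → StackOp (Bool × Cell n) → Prop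
  | endName (t g s) : LocStep (false, t) .endName g s (true, t) .nop
  | bit (t b g s) : LocStep (true, t) (.bit b) g s (true, t) .nop
  | name (g s) : LocStep (true, none) .cName g s (false, some (false, g)) .nop
  | name_push (u g s) : LocStep (true, some u) .cName g s (false, some (false, g)) (.push u)
  | ex (u g s) (h : g.ch ↔ u.mark) (hd : Down g u) :
    LocStep (true, some (false, u)) .cEx g s (false, some (false, g)) .nop
  | neg (u g s) (h : g.mark ↔ ¬ u.mark) (hd : Down g u) :
    LocStep (false, some (false, u)) .cNeg g s (false, some (false, g)) .nop
  | inter (u v g) (h : g.mark ↔ u.mark ∧ v.mark) (hd : Down g u) (hd' : Down g v) :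
    LocStep (false, some (false, u)) .cInter g (some (false, v)) (false, some (false, g)) .pop
  | box (i u g s) (h : g.ch ↔ u.mark) (hd : g.act → u.nxt) :
    LocStep (false, some (false, u)) (.cBox i) g s (false, some (false, g)) .nop
  | incl (u v g) (h : g.ch ↔ u.mark ∧ ¬ v.mark) (h' : g.mark → ¬ g.ch) (hd : Down g u)
      (hd' : Down g v) :
    LocStep (false, some (false, u)) .fIncl g (some (false, v)) (false, some (true, g)) .pop
  | fneg (u g s) (h : g.mark ↔ ¬ u.mark) (hd : Down g u) :
    LocStep (false, some (true, u)) .fNeg g s (false, some (true, g)) .nop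
  | fand (u v g) (h : g.mark ↔ u.mark ∧ v.mark) (hd : Down g u) (hd' : Down g v) :
    LocStep (false, some (true, u)) .fAnd g (some (true, v)) (false, some (true, g)) .pop
  | fbox (i u g s) (h : g.ch ↔ u.mark) (hd : g.act → u.nxt) :
    LocStep (false, some (true, u)) (.fBox i) g s (false, some (true, g)) .nop

/-- The automaton for the local conditions on the block at the head `main`. -/
def locPDA {H : Type} (main : H) : PDA (Letter n × (H → Cell n)) where
  Q := Bool × Option (Bool × Cell n)
  finite_Q := inferInstance
  Stk := Bool × Cell n
  finite_Stk := inferInstance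
  start := {(false, none)}
  acc := {q | ∃ g, q = (false, some (true, g))}
  δ q c t := {A | LocStep q c.1 (c.2 main) t A.1 A.2}

section loc

variable {H : Type} {main : H} {x : List (Letter n)} {V : H → ℕ → Cell n}

theorem drop_sweepCols {k : ℕ} {c : Letter n × (H → Cell n)} {cs : List (Letter n × (H → Cell n))}
    (h : c :: cs = (sweepCols x V).drop k) : x.drop k = c.1 :: x.drop (k + 1) ∧
      c.2 main = V main k ∧ cs = (sweepCols x V).drop (k + 1) := by
  have hk : k < x.length := by
    by_contra hk
    rw [List.drop_eq_nil_of_le (by simp [sweepCols]; omega)] at h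
    cases h
  rw [List.drop_eq_getElem_cons (by simpa [sweepCols] using hk)] at h
  injection h with h1 h2
  refine ⟨?_, ?_, h2⟩
  · rw [List.drop_eq_getElem_cons hk, h1]; simp [sweepCols]
  · rw [h1]; simp [sweepCols]

/-- The local conditions for the expressions `E`, the codes of which follow each other from
position `p` on. -/
def LocL : List (Node n) → (ℕ → Cell n) → ℕ → Prop
  | [], _, _ => True
  | e :: E, f, p => LocN e f p ∧ LocL E f (p + e.encode.length)

/-- The sorts and cells of the expressions `E`. -/
def infos : List (Node n) → (ℕ → Cell n) → ℕ → List (Bool × Cell n)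
  | [], _, _ => []
  | e :: E, f, p => (e.isF, f p) :: infos E f (p + e.encode.length)

theorem infos_eq_cons {E : List (Node n)} {f : ℕ → Cell n} {p : ℕ} {s : Bool} {u : Cell n}
    {S : List (Bool × Cell n)} (h : (s, u) :: S = infos E f p) :
    ∃ e E', E = e :: E' ∧ e.isF = s ∧ u = f p ∧ S = infos E' f (p + e.encode.length) := by
  cases E with
  | nil => cases h
  | cons e E =>
    simp only [infos, List.cons.injEq, Prod.mk.injEq] at h
    exact ⟨e, E, rfl, h.1.1.symm, h.1.2, h.2⟩

theorem exists_concept {e : Node n} (h : e.isF = false) : ∃ C, e = .c C := by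
  cases e with
  | c C => exact ⟨C, rfl⟩
  | f _ => cases h

theorem exists_formula {e : Node n} (h : e.isF = true) : ∃ ψ, e = .f ψ := by
  cases e with
  | f ψ => exact ⟨ψ, rfl⟩
  | c _ => cases h

/-- What the automaton knows after reading the part of the word from position `k` on. -/
def LocInv (x : List (Letter n)) (f : ℕ → Cell n) (k : ℕ) (q : Bool × Option (Bool × Cell n))
    (st : List (Bool × Cell n)) : Prop :=
  (q.2 = none → st = []) ∧ ∃ E : List (Node n), ∃ k', LocL E f k' ∧
    q.2.toList ++ st = infos E f k' ∧
    if q.1 then ∃ a : List Bool, k' = k + a.length + 1 ∧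
      x.drop k = a.map .bit ++ .endName :: E.flatMap Node.encode
    else k' = k ∧ x.drop k = E.flatMap Node.encode

/-- A run of the automaton parses the word that has been read. -/
theorem locInv_of_run {cs : List (Letter n × (H → Cell n))} {q : (locPDA (n := n) main).Q}
    {st : List (locPDA (n := n) main).Stk} (h : (locPDA (n := n) main).Run cs q st) :
    ∀ {k : ℕ}, cs = (sweepCols x V).drop k → LocInv x (V main) k q st := by
  induction h with
  | @nil q hq =>
    intro k hk
    obtain rfl : q = (false, none) := hq
    refine ⟨fun _ => rfl, [], k, trivial, rfl, ?_⟩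
    simpa [sweepCols] using hk.symm
  | @cons c cs q q' st op hrun hs ih =>
    intro k hk
    obtain ⟨h1, h2, h3⟩ := drop_sweepCols (main := main) hk
    obtain ⟨i1, E, k', i2, i3, i4⟩ := ih h3
    change LocStep q c.1 (c.2 main) st.head? q' op at hs
    obtain ⟨a, g⟩ := c
    simp only at h1 hs h2
    rw [h2] at hs
    obtain ⟨t, ht⟩ : ∃ t, t = st.head? := ⟨_, rfl⟩
    rw [← ht] at hs
    have flat : ∀ e : Node n, ∀ E : List (Node n), e.encode ++ E.flatMap Node.encode =
        (e :: E).flatMap Node.encode := fun e E => by simp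
    cases hs with
    | endName t g s =>
      obtain ⟨rfl, i5⟩ := i4
      exact ⟨i1, E, k + 1, i2, i3, [], rfl, by simp [h1, i5]⟩
    | bit t b g s =>
      obtain ⟨a, rfl, i5⟩ := i4
      exact ⟨i1, E, _, i2, i3, b :: a, by simp; omega, by simp [h1, i5]⟩
    | name g s =>
      obtain ⟨a, rfl, i5⟩ := i4
      obtain rfl := i1 rfl
      have i6 : x.drop k = (Node.c (.name a)).encode ++ E.flatMap Node.encode := by
        rw [h1, i5]; simp [Node.encode, Concept.encode, encodeName]
      have e2 : k + (Node.c (.name a) : Node n).encode.length = k + 1 + a.length + 1 := by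
        simp only [Node.encode, Concept.encode, List.length_cons, encodeName_length]; omega
      exact ⟨by simp, .c (.name a) :: E, k, ⟨trivial, by rw [e2]; exact i2⟩,
        by simp only [infos, e2]; rw [← i3]; rfl, rfl, by rw [i6, flat]⟩
    | name_push u g s =>
      obtain ⟨a, rfl, i5⟩ := i4
      have i6 : x.drop k = (Node.c (.name a)).encode ++ E.flatMap Node.encode := by
        rw [h1, i5]; simp [Node.encode, Concept.encode, encodeName]
      have e2 : k + (Node.c (.name a) : Node n).encode.length = k + 1 + a.length + 1 := by
        simp only [Node.encode, Concept.encode, List.length_cons, encodeName_length]; omega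
      exact ⟨by simp, .c (.name a) :: E, k, ⟨trivial, by rw [e2]; exact i2⟩,
        by simp only [infos, e2]; rw [← i3]; rfl, rfl, by rw [i6, flat]⟩
    | ex u g s h hd =>
      obtain ⟨a, rfl, i5⟩ := i4
      obtain ⟨e, E, rfl, j1, rfl, j2⟩ := infos_eq_cons i3
      obtain ⟨C, rfl⟩ := exists_concept j1
      have i6 : x.drop k = (Node.c (.ex a C)).encode ++ E.flatMap Node.encode := by
        rw [h1, i5]; simp [Node.encode, Concept.encode, encodeName]
      have e1 : k + 1 + a.length + 1 = k + 2 + a.length := by omega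
      have e2 : k + (Node.c (.ex a C)).encode.length =
          k + 2 + a.length + (Node.c C).encode.length := by
        simp only [Node.encode, Concept.encode, List.length_cons, List.length_append,
          encodeName_length]
        omega
      rw [e1] at h hd i2 j2
      exact ⟨by simp, .c (.ex a C) :: E, k, ⟨⟨h, hd, i2.1⟩, by rw [e2]; exact i2.2⟩,
        by simp only [infos, e2]; rw [← j2]; rfl, rfl, by rw [i6, flat]⟩
    | neg u g s h hd =>
      obtain ⟨rfl, i5⟩ := i4
      obtain ⟨e, E, rfl, j1, rfl, j2⟩ := infos_eq_cons i3
      obtain ⟨C, rfl⟩ := exists_concept j1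
      have i6 : x.drop k = (Node.c (.neg C)).encode ++ E.flatMap Node.encode := by
        rw [h1, i5]; simp [Node.encode, Concept.encode]
      have e2 : k + (Node.c (.neg C)).encode.length = k + 1 + (Node.c C).encode.length := by
        simp only [Node.encode, Concept.encode, List.length_cons]; omega
      exact ⟨by simp, .c (.neg C) :: E, k, ⟨⟨h, hd, i2.1⟩, by rw [e2]; exact i2.2⟩,
        by simp only [infos, e2]; rw [← j2]; rfl, rfl, by rw [i6, flat]⟩
    | box i u g s h hd =>
      obtain ⟨rfl, i5⟩ := i4
      obtain ⟨e, E, rfl, j1, rfl, j2⟩ := infos_eq_cons i3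
      obtain ⟨C, rfl⟩ := exists_concept j1
      have i6 : x.drop k = (Node.c (.box i C)).encode ++ E.flatMap Node.encode := by
        rw [h1, i5]; simp [Node.encode, Concept.encode]
      have e2 : k + (Node.c (.box i C)).encode.length = k + 1 + (Node.c C).encode.length := by
        simp only [Node.encode, Concept.encode, List.length_cons]; omega
      exact ⟨by simp, .c (.box i C) :: E, k, ⟨⟨h, hd, i2.1⟩, by rw [e2]; exact i2.2⟩,
        by simp only [infos, e2]; rw [← j2]; rfl, rfl, by rw [i6, flat]⟩
    | fneg u g s h hd =>
      obtain ⟨rfl, i5⟩ := i4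
      obtain ⟨e, E, rfl, j1, rfl, j2⟩ := infos_eq_cons i3
      obtain ⟨ψ, rfl⟩ := exists_formula j1
      have i6 : x.drop k = (Node.f (.neg ψ)).encode ++ E.flatMap Node.encode := by
        rw [h1, i5]; simp [Node.encode, Formula.encode]
      have e2 : k + (Node.f (.neg ψ)).encode.length = k + 1 + (Node.f ψ).encode.length := by
        simp only [Node.encode, Formula.encode, List.length_cons]; omega
      exact ⟨by simp, .f (.neg ψ) :: E, k, ⟨⟨h, hd, i2.1⟩, by rw [e2]; exact i2.2⟩,
        by simp only [infos, e2]; rw [← j2]; rfl, rfl, by rw [i6, flat]⟩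
    | fbox i u g s h hd =>
      obtain ⟨rfl, i5⟩ := i4
      obtain ⟨e, E, rfl, j1, rfl, j2⟩ := infos_eq_cons i3
      obtain ⟨ψ, rfl⟩ := exists_formula j1
      have i6 : x.drop k = (Node.f (.box i ψ)).encode ++ E.flatMap Node.encode := by
        rw [h1, i5]; simp [Node.encode, Formula.encode]
      have e2 : k + (Node.f (.box i ψ)).encode.length = k + 1 + (Node.f ψ).encode.length := by
        simp only [Node.encode, Formula.encode, List.length_cons]; omega
      exact ⟨by simp, .f (.box i ψ) :: E, k, ⟨⟨h, hd, i2.1⟩, by rw [e2]; exact i2.2⟩,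
        by simp only [infos, e2]; rw [← j2]; rfl, rfl, by rw [i6, flat]⟩
    | inter u v g h hd hd' =>
      obtain ⟨rfl, i5⟩ := i4
      obtain ⟨st, rfl⟩ := List.head?_eq_some_iff.1 ht.symm
      obtain ⟨e, E, rfl, j1, rfl, j2⟩ := infos_eq_cons i3
      obtain ⟨C, rfl⟩ := exists_concept j1
      obtain ⟨e, E, rfl, j3, rfl, j4⟩ := infos_eq_cons j2
      obtain ⟨D, rfl⟩ := exists_concept j3
      have i6 : x.drop k = (Node.c (.inter C D)).encode ++ E.flatMap Node.encode := by
        rw [h1, i5]; simp [Node.encode, Concept.encode]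
      have e2 : k + (Node.c (.inter C D)).encode.length =
          k + 1 + (Node.c C).encode.length + (Node.c D).encode.length := by
        simp only [Node.encode, Concept.encode, List.length_cons, List.length_append]; omega
      exact ⟨by simp, .c (.inter C D) :: E, k, ⟨⟨h, hd, hd', i2.1, i2.2.1⟩,
          by rw [e2]; exact i2.2.2⟩,
        by simp only [infos, e2]; rw [← j4]; rfl, rfl, by rw [i6, flat]⟩
    | incl u v g h h' hd hd' =>
      obtain ⟨rfl, i5⟩ := i4
      obtain ⟨st, rfl⟩ := List.head?_eq_some_iff.1 ht.symm
      obtain ⟨e, E, rfl, j1, rfl, j2⟩ := infos_eq_cons i3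
      obtain ⟨C, rfl⟩ := exists_concept j1
      obtain ⟨e, E, rfl, j3, rfl, j4⟩ := infos_eq_cons j2
      obtain ⟨D, rfl⟩ := exists_concept j3
      have i6 : x.drop k = (Node.f (.incl C D)).encode ++ E.flatMap Node.encode := by
        rw [h1, i5]; simp [Node.encode, Formula.encode]
      have e2 : k + (Node.f (.incl C D)).encode.length =
          k + 1 + (Node.c C).encode.length + (Node.c D).encode.length := by
        simp only [Node.encode, Formula.encode, List.length_cons, List.length_append]; omega
      exact ⟨by simp, .f (.incl C D) :: E, k, ⟨⟨h, h', hd, hd', i2.1, i2.2.1⟩,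
          by rw [e2]; exact i2.2.2⟩,
        by simp only [infos, e2]; rw [← j4]; rfl, rfl, by rw [i6, flat]⟩
    | fand u v g h hd hd' =>
      obtain ⟨rfl, i5⟩ := i4
      obtain ⟨st, rfl⟩ := List.head?_eq_some_iff.1 ht.symm
      obtain ⟨e, E, rfl, j1, rfl, j2⟩ := infos_eq_cons i3
      obtain ⟨ψ, rfl⟩ := exists_formula j1
      obtain ⟨e, E, rfl, j3, rfl, j4⟩ := infos_eq_cons j2
      obtain ⟨χ, rfl⟩ := exists_formula j3
      have i6 : x.drop k = (Node.f (.and ψ χ)).encode ++ E.flatMap Node.encode := by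
        rw [h1, i5]; simp [Node.encode, Formula.encode]
      have e2 : k + (Node.f (.and ψ χ)).encode.length =
          k + 1 + (Node.f ψ).encode.length + (Node.f χ).encode.length := by
        simp only [Node.encode, Formula.encode, List.length_cons, List.length_append]; omega
      exact ⟨by simp, .f (.and ψ χ) :: E, k, ⟨⟨h, hd, hd', i2.1, i2.2.1⟩,
          by rw [e2]; exact i2.2.2⟩,
        by simp only [infos, e2]; rw [← j4]; rfl, rfl, by rw [i6, flat]⟩

theorem run_step {p : ℕ} {a : Letter n} {q q' : Bool × Option (Bool × Cell n)}
    {st : List (Bool × Cell n)} {op : StackOp (Bool × Cell n)} (hp : x[p]? = some a)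
    (hs : LocStep q a (V main p) st.head? q' op)
    (h : (locPDA (n := n) main).Run ((sweepCols x V).drop (p + 1)) q st) :
    (locPDA (n := n) main).Run ((sweepCols x V).drop p) q' (op.app st) := by
  obtain ⟨hlt, rfl⟩ := List.getElem?_eq_some_iff.1 hp
  rw [List.drop_eq_getElem_cons (by simpa [sweepCols] using hlt)]
  refine .cons h ?_
  simp only [sweepCols, List.getElem_mapIdx]
  exact hs

theorem run_encodeName {a : List Bool} {t : Option (Bool × Cell n)} {st : List (Bool × Cell n)} :
    ∀ {p : ℕ}, encodeName n a <+: x.drop p →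
    (locPDA (n := n) main).Run ((sweepCols x V).drop (p + a.length + 1)) (false, t) st →
    (locPDA (n := n) main).Run ((sweepCols x V).drop p) (true, t) st := by
  induction a with
  | nil =>
    intro p h h1
    exact run_step (prefix_drop_cons h).1 (.endName _ _ _) h1
  | cons b a ih =>
    intro p h h1
    obtain ⟨h2, h3⟩ := prefix_drop_cons h
    refine run_step h2 (.bit _ _ _ _) (ih h3 ?_)
    rwa [List.length_cons, ← add_assoc, add_right_comm p] at h1

/-- The automaton can read the code of a concept, which leaves the cell of the concept on top of its
memory. -/
theorem run_concept (C : Concept n) : ∀ {p : ℕ} {t : Option (Bool × Cell n)}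
    {st : List (Bool × Cell n)}, C.encode <+: x.drop p → LocC C (V main) p → (t = none → st = []) →
    (locPDA (n := n) main).Run ((sweepCols x V).drop (p + C.encode.length)) (false, t) st →
    (locPDA (n := n) main).Run ((sweepCols x V).drop p) (false, some (false, V main p))
      (t.toList ++ st) := by
  induction C with
  | name A =>
    intro p t st h hl ht hr
    obtain ⟨h1, h2⟩ := prefix_drop_cons h
    have h3 := run_encodeName (V := V) (main := main) (t := t) (st := st) h2 (by
      rwa [Concept.encode, List.length_cons, encodeName_length,
        show p + (A.length + 1 + 1) = p + 1 + A.length + 1 by omega] at hr)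
    cases t with
    | none =>
      obtain rfl := ht rfl
      exact run_step h1 (.name _ _) h3
    | some u => exact run_step h1 (.name_push _ _ _) h3
  | neg C ih =>
    intro p t st h hl ht hr
    obtain ⟨h1, h2⟩ := prefix_drop_cons h
    rw [Concept.encode, List.length_cons, add_comm _ 1, ← add_assoc] at hr
    exact run_step h1 (.neg _ _ _ hl.1 hl.2.1) (ih h2 hl.2.2 ht hr)
  | inter C D ih ih' =>
    intro p t st h hl ht hr
    obtain ⟨h1, h2⟩ := prefix_drop_cons h
    obtain ⟨h2, h3⟩ := prefix_drop_append h2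
    rw [Concept.encode, List.length_cons, List.length_append, add_comm _ 1, ← add_assoc,
      ← add_assoc] at hr
    exact run_step h1 (.inter _ _ _ hl.1 hl.2.1 hl.2.2.1) (ih h2 hl.2.2.2.1 (by simp)
      (ih' h3 hl.2.2.2.2 ht hr))
  | ex r C ih =>
    intro p t st h hl ht hr
    obtain ⟨h1, h2⟩ := prefix_drop_cons h
    obtain ⟨h2, h3⟩ := prefix_drop_append h2
    rw [encodeName_length, show p + 1 + (r.length + 1) = p + 2 + r.length by omega] at h3
    rw [Concept.encode, List.length_cons, List.length_append, encodeName_length,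
      show p + (r.length + 1 + C.encode.length + 1) = p + 2 + r.length + C.encode.length by omega]
      at hr
    have h4 := ih h3 hl.2.2 ht hr
    rw [show p + 2 + r.length = p + 1 + r.length + 1 by omega] at h4
    refine run_step h1 (.ex _ _ _ ?_ ?_) (run_encodeName h2 h4)
    · rw [show p + 1 + r.length + 1 = p + 2 + r.length by omega]; exact hl.1
    · rw [show p + 1 + r.length + 1 = p + 2 + r.length by omega]; exact hl.2.1
  | box i C ih =>
    intro p t st h hl ht hr
    obtain ⟨h1, h2⟩ := prefix_drop_cons h
    rw [Concept.encode, List.length_cons, add_comm _ 1, ← add_assoc] at hr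
    exact run_step h1 (.box _ _ _ _ hl.1 hl.2.1) (ih h2 hl.2.2 ht hr)

theorem run_formula (ψ : Formula n) : ∀ {p : ℕ} {t : Option (Bool × Cell n)}
    {st : List (Bool × Cell n)}, ψ.encode <+: x.drop p → LocF ψ (V main) p → (t = none → st = []) →
    (locPDA (n := n) main).Run ((sweepCols x V).drop (p + ψ.encode.length)) (false, t) st →
    (locPDA (n := n) main).Run ((sweepCols x V).drop p) (false, some (true, V main p))
      (t.toList ++ st) := by
  induction ψ with
  | incl C D =>
    intro p t st h hl ht hr
    obtain ⟨h1, h2⟩ := prefix_drop_cons h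
    obtain ⟨h2, h3⟩ := prefix_drop_append h2
    rw [Formula.encode, List.length_cons, List.length_append, add_comm _ 1, ← add_assoc,
      ← add_assoc] at hr
    exact run_step h1 (.incl _ _ _ hl.1 hl.2.1 hl.2.2.1 hl.2.2.2.1)
      (run_concept C h2 hl.2.2.2.2.1 (by simp) (run_concept D h3 hl.2.2.2.2.2 ht hr))
  | neg ψ ih =>
    intro p t st h hl ht hr
    obtain ⟨h1, h2⟩ := prefix_drop_cons h
    rw [Formula.encode, List.length_cons, add_comm _ 1, ← add_assoc] at hr
    exact run_step h1 (.fneg _ _ _ hl.1 hl.2.1) (ih h2 hl.2.2 ht hr)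
  | and ψ χ ih ih' =>
    intro p t st h hl ht hr
    obtain ⟨h1, h2⟩ := prefix_drop_cons h
    obtain ⟨h2, h3⟩ := prefix_drop_append h2
    rw [Formula.encode, List.length_cons, List.length_append, add_comm _ 1, ← add_assoc,
      ← add_assoc] at hr
    exact run_step h1 (.fand _ _ _ hl.1 hl.2.1 hl.2.2.1) (ih h2 hl.2.2.2.1 (by simp)
      (ih' h3 hl.2.2.2.2 ht hr))
  | box i ψ ih =>
    intro p t st h hl ht hr
    obtain ⟨h1, h2⟩ := prefix_drop_cons h
    rw [Formula.encode, List.length_cons, add_comm _ 1, ← add_assoc] at hr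
    exact run_step h1 (.fbox _ _ _ _ hl.1 hl.2.1) (ih h2 hl.2.2 ht hr)

/-- The automaton for the local conditions is correct. -/
theorem accepts_locPDA_iff : (locPDA (n := n) main).Accepts (sweepCols x V) ↔
    ∃ φ : Formula n, φ.encode = x ∧ LocF φ (V main) 0 := by
  constructor
  · rintro ⟨q, ⟨g, rfl⟩, h⟩
    obtain ⟨-, E, k', i2, i3, i4⟩ := locInv_of_run (k := 0) (x := x) (V := V) h rfl
    obtain ⟨rfl, i5⟩ := i4
    obtain ⟨e, E, rfl, j1, rfl, j2⟩ := infos_eq_cons i3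
    obtain ⟨ψ, rfl⟩ := exists_formula j1
    cases E with
    | cons _ _ => cases j2
    | nil => exact ⟨ψ, by simpa [Node.encode] using i5.symm, i2.1⟩
  · rintro ⟨φ, rfl, hl⟩
    refine ⟨_, ⟨_, rfl⟩,
      run_formula φ (p := 0) (t := none) (st := []) (by simp) hl (fun _ => rfl) ?_⟩
    rw [List.drop_eq_nil_of_le (by simp [sweepCols])]
    exact .nil rfl

end loc
end MLALC

/-! ### The test of blocks -/

namespace MLALC

variable {n : ℕ}

/-- The modality and the sort of a box. -/
def Letter.box : Letter n → Option (Fin n × Bool)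
  | .cBox i => some (i, false)
  | .fBox i => some (i, true)
  | _ => none

/-- The letters at which formulas start. -/
def Letter.IsF : Letter n → Prop
  | .fIncl => True
  | .fNeg => True
  | .fAnd => True
  | .fBox _ => True
  | _ => False

/-- The conditions of a quasimodel that require another type. -/
inductive Wit (n : ℕ) : Type
  | ex
  | incl
  | nonempty (i : Fin n) (s : Bool)
  | joint (i : Fin n)
  | unit (i : Fin n) (s : Bool)
  | imp (i : Fin n) (s s' : Bool)
  | sep (i : Fin n) (s s' : Bool)

instance : Finite (Wit n) :=
  Finite.of_injective
    (fun j : Wit n => match j with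
      | .ex => (Sum.inl 0 : Fin 2 ⊕ (Fin n × Bool) ⊕ Fin n ⊕ (Fin n × Bool) ⊕
          (Fin n × Bool × Bool) ⊕ (Fin n × Bool × Bool))
      | .incl => .inl 1
      | .nonempty i s => .inr (.inl (i, s))
      | .joint i => .inr (.inr (.inl i))
      | .unit i s => .inr (.inr (.inr (.inl (i, s))))
      | .imp i s s' => .inr (.inr (.inr (.inr (.inl (i, s, s')))))
      | .sep i s s' => .inr (.inr (.inr (.inr (.inr (i, s, s'))))))
    (by rintro (_ | _ | _ | _ | _ | _ | _) (_ | _ | _ | _ | _ | _ | _) <;> simp)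

/-- The blocks that are compared. The blocks `main` and `uni` are arbitrary; `main` is considered
as a type, and `uni` supplies the positions, the row of `imp`, and the name with respect to which
the conditions on `main` are tested. The blocks `last`, `left1`, `left2` and `bit b` make sure that
all positions and all names are supplied by some block. -/
inductive Head (n : ℕ) : Type
  | main
  | uni
  | root
  | last
  | left1
  | left2
  | bit (b : Bool)
  | wit (j : Wit n)

instance : Finite (Head n) :=
  Finite.of_injective
    (fun h : Head n => match h with
      | .main => (Sum.inl 0 : Fin 6 ⊕ Bool ⊕ Wit n)
      | .uni => .inl 1
      | .root => .inl 2
      | .last => .inl 3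
      | .left1 => .inl 4
      | .left2 => .inl 5
      | .bit b => .inr (.inl b)
      | .wit j => .inr (.inr j))
    (by rintro (_ | _ | _ | _ | _ | _ | _ | _) (_ | _ | _ | _ | _ | _ | _ | _) <;> simp)

/-- What has to be known about a marked position: the letter of the input, the cell of the type,
the row of `imp`, and whether the name is read from the next position on. -/
abbrev Profile (n : ℕ) : Type := Letter n × Cell n × Prop × Prop

/-- There is a box `□_i` of sort `s` of the modal depth of the type. -/
def Profile.Box (π : Profile n) (i : Fin n) (s : Bool) : Prop :=
  π.1.box = some (i, s) ∧ π.2.1.act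

/-- The other type is required. -/
def Trig (L : Log) (π π' : Profile n) : Wit n → Prop
  | .ex => π.1 = .cEx ∧ π.2.2.2 ∧ π.2.1.act ∧ π.2.1.mark
  | .incl => π.1 = .fIncl ∧ π.2.1.act ∧ ¬ π.2.1.mark
  | .nonempty i s => π.Box i s ∧
      match L with
      | .E | .N => ¬ (π.2.1.mark ↔ π.2.1.eps i)
      | .M => π.2.1.mark ∧ ¬ π.2.1.eps i
      | .C => ¬ π.2.1.mark ∧ π.2.1.eps i
  | .joint i => L = .C ∧ (∃ s, π.Box i s) ∧ ¬ π.2.1.eps i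
  | .unit i s => L = .N ∧ π.Box i s ∧ ¬ π.2.1.mark
  | .imp i s s' => L ≠ .M ∧ π.Box i s ∧ π'.Box i s' ∧ (s = true → s' = true) ∧
      (L ≠ .C → s = s') ∧ ¬ π'.2.2.1
  | .sep i s s' => π.Box i s ∧ π'.Box i s' ∧ ¬ π.2.1.mark ∧ π'.2.1.mark ∧
      (L = .M → s' = true → s = true) ∧ (L ≠ .M → s = s' ∧ π'.2.2.1)

/-- The conditions on a column of the other type `w`, given the profile `π` of the column and the
information whether the column is marked as the first or the second position. -/
def WitOK (L : Log) (π : Profile n) (P1 P2 : Prop) (w : Cell n) : Wit n → Prop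
  | .ex => w.id = π.2.1.id ∧ (π.2.1.act → w.act) ∧ (P1 → w.ch) ∧
      (π.1 = .cEx → π.2.2.2 → π.2.1.act → w.ch → π.2.1.mark)
  | .incl => w.id = π.2.1.id ∧ (π.2.1.act → w.act) ∧ (P1 → w.ch)
  | .nonempty _ _ => (π.2.1.nxt → w.act) ∧ (P1 → w.ch)
  | .joint i => (π.2.1.nxt → w.act) ∧ w.id = π.2.1.tgt i ∧
      ((∃ s, π.Box i s) → π.2.1.mark → w.ch)
  | .unit _ s => (π.2.1.nxt → w.act) ∧ (P1 → s = true → ¬ w.ch)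
  | .imp _ _ _ => (π.2.1.nxt → w.act) ∧ (P1 → w.ch) ∧ (P2 → ¬ w.ch)
  | .sep i s _ => (π.2.1.nxt → w.act) ∧ (P1 → ¬ w.ch) ∧ (P2 → w.ch) ∧
      (L = .C → ∀ s', π.Box i s' → π.2.1.mark → π.2.2.1 → (s = true → s' = true) → w.ch)

/-- The global information that is guessed: the profiles of the two marked positions, the sets
`eps`, the truth value of the concept name that is read, and whether the identities of `main` and
`uni` are different. -/
structure Guess (n : ℕ) : Type where
  fst : Profile n
  snd : Profile n
  eps : Fin n → Prop
  name : Prop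
  differ : Prop

instance : Finite (Guess n) :=
  Finite.of_injective (fun θ : Guess n => (θ.fst, θ.snd, θ.eps, θ.name, θ.differ))
    (by rintro ⟨⟩ ⟨⟩ h; simpa using h)

/-- The columns of the input and the blocks. -/
abbrev Column (n : ℕ) : Type := Letter n × (Head n → Cell n)

/-- The profile of a column, given the column to the right of it. -/
def profile (c : Column n) (c' : Option (Column n)) : Profile n :=
  (c.1, c.2 .main, (c.2 .uni).gt, ∃ y ∈ c', (y.2 .uni).nm)

/-- The conditions on a column `c` and the column `c'` to the right of it. -/
structure ColOK (L : Log) (θ : Guess n) (c : Column n) (c' : Option (Column n)) : Prop where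
  fst : (c.2 .uni).P1 → θ.fst = profile c c'
  snd : (c.2 .uni).P2 → θ.snd = profile c c'
  eps : (c.2 .main).eps = θ.eps
  name : c.1 = .cName → (profile c c').2.2.2 → (c.2 .main).act → ((c.2 .main).mark ↔ θ.name)
  boxM : L = .M → ∀ i s, (profile c c').Box i s → ¬ (c.2 .main).mark → ¬ (c.2 .main).eps i
  key : ¬ θ.differ → (c.2 .main).eps = (c.2 .uni).eps ∧ (c.2 .main).tgt = (c.2 .uni).tgt ∧
    (c.1.IsF → (c.2 .main).act → (c.2 .uni).act → ((c.2 .main).mark ↔ (c.2 .uni).mark))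
  last : ((c.2 .last).P1 ↔ c' = none) ∧ ((c.2 .last).P2 ↔ c' = none) ∧
    ((c.2 .last).nm ↔ c.1 = .endName)
  left1 : ((c.2 .left1).P1 ↔ ∃ y ∈ c', (y.2 .uni).P1) ∧ ((c.2 .left1).P2 ↔ (c.2 .uni).P2) ∧
    ((c.2 .left1).nm ↔ (c.2 .uni).nm)
  left2 : ((c.2 .left2).P1 ↔ (c.2 .uni).P1) ∧ ((c.2 .left2).P2 ↔ ∃ y ∈ c', (y.2 .uni).P2) ∧
    ((c.2 .left2).nm ↔ (c.2 .uni).nm) ∧ ((c.2 .left2).gt ↔ (c.2 .uni).gt)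
  bit : ∀ b, ((c.2 (.bit b)).P1 ↔ (c.2 .uni).P1) ∧ ((c.2 (.bit b)).P2 ↔ (c.2 .uni).P2) ∧
    ((c.2 (.bit b)).nm ↔ c.1 = .bit b ∧ (profile c c').2.2.2) ∧
    ((c.2 (.bit b)).gt ↔ (c.2 .uni).gt)
  wit : ∀ j, Trig L θ.fst θ.snd j →
    WitOK L (profile c c') (c.2 .uni).P1 (c.2 .uni).P2 (c.2 (.wit j)) j

/-- The automaton that tests the blocks. -/
def testPDA (L : Log) (n : ℕ) : PDA (Column n) :=
  (locPDA Head.main).guess (ColOK L) (fun c => (c.2 .main).id ≠ (c.2 .uni).id)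
    fun θ seen c => (θ.differ → seen) ∧ ∀ y ∈ c, (y.2 .root).act ∧ (y.2 .root).mark

/-- The letter at position `k` of the code of `φ`. -/
def Formula.letter (φ : Formula n) (k : ℕ) : Letter n := φ.encode[k]?.getD .endName

/-- The profile of position `k`, for a type `B`, a row `G` of `imp`, and the positions `N` at which
the name is read. -/
def Formula.profile (φ : Formula n) (B : ℕ → Cell n) (G N : ℕ → Prop) (k : ℕ) : Profile n :=
  (φ.letter k, B k, G k, k + 1 < φ.encode.length ∧ N (k + 1))

/-- The name `a` is read from position `k` on. -/
def Formula.NameAt (φ : Formula n) (a : List Bool) (k : ℕ) : Prop :=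
  encodeName n a <+: φ.encode.drop k

/-- The conditions on the blocks `V` for the guess `θ`. -/
structure Tested (L : Log) (φ : Formula n) (V : Head n → ℕ → Cell n) (θ : Guess n) : Prop where
  loc : LocF φ (V .main) 0
  root : (V .root 0).act ∧ (V .root 0).mark
  differ : θ.differ → ∃ k < φ.encode.length, (V .main k).id ≠ (V .uni k).id
  fst : ∀ k < φ.encode.length, (V .uni k).P1 →
    θ.fst = φ.profile (V .main) (fun k => (V .uni k).gt) (fun k => (V .uni k).nm) k
  snd : ∀ k < φ.encode.length, (V .uni k).P2 →
    θ.snd = φ.profile (V .main) (fun k => (V .uni k).gt) (fun k => (V .uni k).nm) k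
  eps : ∀ k < φ.encode.length, (V .main k).eps = θ.eps
  name : ∀ k < φ.encode.length, φ.letter k = .cName →
    k + 1 < φ.encode.length ∧ (V .uni (k + 1)).nm → (V .main k).act → ((V .main k).mark ↔ θ.name)
  boxM : L = .M → ∀ k < φ.encode.length, ∀ i s, (φ.letter k).box = some (i, s) →
    (V .main k).act → ¬ (V .main k).mark → ¬ (V .main k).eps i
  key : ¬ θ.differ → ∀ k < φ.encode.length, (V .main k).eps = (V .uni k).eps ∧
    (V .main k).tgt = (V .uni k).tgt ∧ ((φ.letter k).IsF → (V .main k).act → (V .uni k).act →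
      ((V .main k).mark ↔ (V .uni k).mark))
  last : ∀ k < φ.encode.length, ((V .last k).P1 ↔ k + 1 = φ.encode.length) ∧
    ((V .last k).P2 ↔ k + 1 = φ.encode.length) ∧ ((V .last k).nm ↔ φ.letter k = .endName)
  left1 : ∀ k < φ.encode.length,
    ((V .left1 k).P1 ↔ k + 1 < φ.encode.length ∧ (V .uni (k + 1)).P1) ∧
    ((V .left1 k).P2 ↔ (V .uni k).P2) ∧ ((V .left1 k).nm ↔ (V .uni k).nm)
  left2 : ∀ k < φ.encode.length, ((V .left2 k).P1 ↔ (V .uni k).P1) ∧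
    ((V .left2 k).P2 ↔ k + 1 < φ.encode.length ∧ (V .uni (k + 1)).P2) ∧
    ((V .left2 k).nm ↔ (V .uni k).nm) ∧ ((V .left2 k).gt ↔ (V .uni k).gt)
  bit : ∀ k < φ.encode.length, ∀ b, ((V (.bit b) k).P1 ↔ (V .uni k).P1) ∧
    ((V (.bit b) k).P2 ↔ (V .uni k).P2) ∧ ((V (.bit b) k).nm ↔
      φ.letter k = .bit b ∧ k + 1 < φ.encode.length ∧ (V .uni (k + 1)).nm) ∧
    ((V (.bit b) k).gt ↔ (V .uni k).gt)
  wit : ∀ k < φ.encode.length, ∀ j, Trig L θ.fst θ.snd j →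
    WitOK L (φ.profile (V .main) (fun k => (V .uni k).gt) (fun k => (V .uni k).nm) k)
      (V .uni k).P1 (V .uni k).P2 (V (.wit j) k) j

theorem Formula.length_pos (φ : Formula n) : 0 < φ.encode.length :=
  List.length_pos_iff.2 (Node.encode_ne_nil (.f φ))

/-- The automaton performs the test. -/
theorem accepts_testPDA_iff {L : Log} {φ : Formula n} {V : Head n → ℕ → Cell n} :
    (testPDA L n).Accepts (sweepCols φ.encode V) ↔ ∃ θ, Tested L φ V θ := by
  have hlen : (sweepCols φ.encode V).length = φ.encode.length := by simp [sweepCols]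
  have hget : ∀ k (hk : k < (sweepCols φ.encode V).length),
      (sweepCols φ.encode V)[k] = (φ.letter k, fun h => V h k) := by
    intro k hk
    rw [hlen] at hk
    simp [sweepCols, Formula.letter, hk]
  have hmem : ∀ k, ∀ R : Column n → Prop, (∃ y ∈ (sweepCols φ.encode V)[k]?, R y) ↔
      k < φ.encode.length ∧ R (φ.letter k, fun h => V h k) := by
    intro k R
    by_cases hk : k < (sweepCols φ.encode V).length
    · rw [List.getElem?_eq_getElem hk, hget, ← hlen]
      simp [hk]
    · rw [List.getElem?_eq_none (by omega)]
      rw [hlen] at hk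
      simp [hk]
  have hnone : ∀ k < φ.encode.length,
      ((sweepCols φ.encode V)[k + 1]? = none ↔ k + 1 = φ.encode.length) := by
    intro k hk
    rw [List.getElem?_eq_none_iff, hlen]; omega
  have hprof : ∀ k (hk : k < (sweepCols φ.encode V).length),
      profile (sweepCols φ.encode V)[k] (sweepCols φ.encode V)[k + 1]? =
        φ.profile (V .main) (fun k => (V .uni k).gt) (fun k => (V .uni k).nm) k := by
    intro k hk
    rw [profile, hmem, hget, Formula.profile]
  have hex : (∃ a ∈ sweepCols φ.encode V, (a.2 .main).id ≠ (a.2 .uni).id) ↔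
      ∃ k < φ.encode.length, (V .main k).id ≠ (V .uni k).id := by
    constructor
    · rintro ⟨a, ha, h⟩
      obtain ⟨k, hk, rfl⟩ := List.getElem_of_mem ha
      rw [hget] at h
      exact ⟨k, by rwa [← hlen], h⟩
    · rintro ⟨k, hk, h⟩
      rw [← hlen] at hk
      exact ⟨_, List.getElem_mem hk, by rw [hget]; exact h⟩
  have hhead : (∀ y ∈ (sweepCols φ.encode V).head?, (y.2 .root).act ∧ (y.2 .root).mark) ↔
      (V .root 0).act ∧ (V .root 0).mark := by
    have h0 : 0 < (sweepCols φ.encode V).length := by rw [hlen]; exact φ.length_pos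
    rw [List.head?_eq_getElem?, List.getElem?_eq_getElem h0, hget]
    simp
  rw [testPDA, PDA.accepts_guess_iff, accepts_locPDA_iff]
  simp only [hex, hhead]
  constructor
  · rintro ⟨⟨ψ, h1, h2⟩, θ, h3, h4, h5⟩
    obtain rfl : ψ = φ := (Formula.encode_inj (s := []) (s' := []) (by simpa using h1)).1
    have h6 := fun k (hk : k < ψ.encode.length) => h3 k (by rwa [hlen])
    refine ⟨θ, h2, h5, h4, fun k hk => ?_, fun k hk => ?_, fun k hk => ?_, fun k hk => ?_,
      fun hL k hk => ?_, fun hd k hk => ?_, fun k hk => ?_, fun k hk => ?_, fun k hk => ?_,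
      fun k hk => ?_, fun k hk => ?_⟩ <;> have h7 := h6 k hk
    · have := h7.fst; rwa [hprof, hget] at this
    · have := h7.snd; rwa [hprof, hget] at this
    · have := h7.eps; rwa [hget] at this
    · have := h7.name; rwa [hprof, hget] at this
    · have := h7.boxM hL; rw [hprof, hget] at this
      exact fun i s h1 h2 => this i s ⟨h1, h2⟩
    · have := h7.key hd; rwa [hget] at this
    · have := h7.last; rwa [hget, hnone k hk] at this
    · have := h7.left1; rwa [hmem, hget] at this
    · have := h7.left2; rwa [hmem, hget] at this
    · have := h7.bit; rwa [hprof, hget] at this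
    · have := h7.wit; rwa [hprof, hget] at this
  · rintro ⟨θ, h⟩
    refine ⟨⟨φ, rfl, h.loc⟩, θ, fun k hk => ?_, h.differ, h.root⟩
    have hk' := hk
    rw [hlen] at hk'
    refine ⟨?_, ?_, ?_, ?_, fun hL => ?_, fun hd => ?_, ?_, ?_, ?_, ?_, ?_⟩
    · rw [hprof, hget]; exact h.fst k hk'
    · rw [hprof, hget]; exact h.snd k hk'
    · rw [hget]; exact h.eps k hk'
    · rw [hprof, hget]; exact h.name k hk'
    · rw [hprof, hget]; exact fun i s h1 => h.boxM hL k hk' i s h1.1 h1.2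
    · rw [hget]; exact h.key hd k hk'
    · rw [hget, hnone k hk']; exact h.last k hk'
    · rw [hmem, hget]; exact h.left1 k hk'
    · rw [hmem, hget]; exact h.left2 k hk'
    · rw [hprof, hget]; exact h.bit k hk'
    · rw [hprof, hget]; exact h.wit k hk'

end MLALC

/-! ### From blocks to a quasimodel -/

namespace MLALC

variable {n : ℕ}

theorem Formula.letter_eq {φ : Formula n} {k : ℕ} {a : Letter n} (h : φ.encode[k]? = some a) :
    φ.letter k = a := by
  rw [Formula.letter, h]; rfl

theorem Formula.drop_eq {φ : Formula n} {k : ℕ} (hk : k < φ.encode.length) :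
    φ.encode.drop k = φ.letter k :: φ.encode.drop (k + 1) := by
  rw [List.drop_eq_getElem_cons hk]
  simp [Formula.letter, hk]

theorem Formula.nameAt_nil {φ : Formula n} {k : ℕ} (hk : k < φ.encode.length) :
    φ.NameAt [] k ↔ φ.letter k = .endName := by
  rw [Formula.NameAt, Formula.drop_eq hk]
  simp [encodeName, eq_comm]

theorem Formula.NameAt.lt {φ : Formula n} {a : List Bool} {k : ℕ} (h : φ.NameAt a k) :
    k < φ.encode.length := by
  by_contra hk
  rw [Formula.NameAt, List.drop_eq_nil_of_le (by omega)] at h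
  simp [encodeName] at h

theorem Formula.nameAt_cons {φ : Formula n} {b : Bool} {a : List Bool} {k : ℕ}
    (hk : k < φ.encode.length) : φ.NameAt (b :: a) k ↔
      φ.letter k = .bit b ∧ k + 1 < φ.encode.length ∧ φ.NameAt a (k + 1) := by
  have h1 : φ.NameAt (b :: a) k ↔ φ.letter k = .bit b ∧ φ.NameAt a (k + 1) := by
    rw [Formula.NameAt, Formula.drop_eq hk]
    simp only [encodeName, List.map_cons, List.cons_append, List.cons_prefix_cons, Formula.NameAt,
      eq_comm]
  rw [h1]
  exact ⟨fun h => ⟨h.1, h.2.lt, h.2⟩, fun h => ⟨h.1, h.2.2⟩⟩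

theorem OccBox.letter {φ : Formula n} {i : Fin n} {s : Bool} {p d : ℕ} (h : OccBox φ i s p d) :
    (φ.letter p).box = some (i, s) := by
  cases s <;> obtain ⟨_, h⟩ := h <;>
    rw [Formula.letter_eq (prefix_drop_cons h.prefix).1] <;> rfl

theorem OccBox.pos_lt {φ : Formula n} {i : Fin n} {s : Bool} {p d : ℕ} (h : OccBox φ i s p d) :
    p < φ.encode.length := by
  cases s <;> obtain ⟨_, h⟩ := h <;> exact h.lt_length

theorem OccBox.ch_iff {φ : Formula n} {f : ℕ → Cell n} (hφ : LocF φ f 0) {i : Fin n} {s : Bool}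
    {p d : ℕ} (h : OccBox φ i s p d) : (f p).ch ↔ (f (p + 1)).mark := by
  cases s <;> obtain ⟨_, h⟩ := h <;> exact (h.locN hφ).1

theorem Occ.letter_isF {φ ψ : Formula n} {p d : ℕ} (h : Occ φ (.f ψ) p d) :
    (φ.letter p).IsF := by
  cases ψ <;> rw [Formula.letter_eq (prefix_drop_cons h.prefix).1] <;> trivial

theorem Occ.letter_name {φ : Formula n} {A : ConceptName} {p d : ℕ}
    (h : Occ φ (.c (.name A)) p d) : φ.letter p = .cName ∧ φ.NameAt A (p + 1) := by
  obtain ⟨h1, h2⟩ := prefix_drop_cons h.prefix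
  exact ⟨Formula.letter_eq h1, h2⟩

theorem Occ.letter_ex {φ : Formula n} {r : RoleName} {C : Concept n} {p d : ℕ}
    (h : Occ φ (.c (.ex r C)) p d) : φ.letter p = .cEx ∧ φ.NameAt r (p + 1) := by
  obtain ⟨h1, h2⟩ := prefix_drop_cons h.prefix
  exact ⟨Formula.letter_eq h1, (prefix_drop_append h2).1⟩

theorem Occ.letter_incl {φ : Formula n} {C D : Concept n} {p d : ℕ}
    (h : Occ φ (.f (.incl C D)) p d) : φ.letter p = .fIncl :=
  Formula.letter_eq (prefix_drop_cons h.prefix).1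

/-- Every pair of blocks in `D` passes the test together with further blocks in `D`. -/
def Closed (L : Log) (φ : Formula n) (D : Set (ℕ → Cell n)) : Prop :=
  ∀ B ∈ D, ∀ C ∈ D, ∃ V : Head n → ℕ → Cell n, V .main = B ∧ V .uni = C ∧ (∀ h, V h ∈ D) ∧
    ∃ θ, Tested L φ V θ

/-- The block `C` supplies the positions `p` and `p'`, the name `a` and the row `G`. -/
def IsRow (φ : Formula n) (p p' : ℕ) (a : List Bool) (G : ℕ → Prop) (C : ℕ → Cell n) : Prop :=
  ∀ k < φ.encode.length, ((C k).P1 ↔ k = p) ∧ ((C k).P2 ↔ k = p') ∧ ((C k).nm ↔ φ.NameAt a k) ∧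
    ((C k).gt ↔ G k)

/-- All positions and all names are supplied by blocks in a closed set: the block `last` supplies
the last position and the empty name, and from there `left1`, `left2` and `bit b` lead to the
others. The row of `imp` depends on the first position only. -/
theorem Closed.exists_isRow {L : Log} {φ : Formula n} {D : Set (ℕ → Cell n)}
    (hD : Closed L φ D) (hne : D.Nonempty) :
    ∃ G : ℕ → ℕ → Prop, ∀ p < φ.encode.length, ∀ p' < φ.encode.length, ∀ a,
      ∃ C ∈ D, IsRow φ p p' a (G p) C := by
  have hm := φ.length_pos
  set m := φ.encode.length with hm'
  have h1 : ∀ j < m, ∃ C ∈ D, ∃ G, IsRow φ (m - 1 - j) (m - 1) [] G C := by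
    intro j
    induction j with
    | zero =>
      intro _
      obtain ⟨B, hB⟩ := hne
      obtain ⟨V, -, -, hV, θ, hθ⟩ := hD B hB B hB
      refine ⟨_, hV .last, fun k => (V .last k).gt, fun k hk => ?_⟩
      obtain ⟨h1, h2, h3⟩ := hθ.last k hk
      exact ⟨by rw [h1]; omega, by rw [h2]; omega, by rw [h3, Formula.nameAt_nil hk], Iff.rfl⟩
    | succ j ih =>
      intro hj
      obtain ⟨C, hC, G, hG⟩ := ih (by omega)
      obtain ⟨V, -, rfl, hV, θ, hθ⟩ := hD C hC C hC
      refine ⟨_, hV .left1, fun k => (V .left1 k).gt, fun k hk => ?_⟩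
      obtain ⟨h1, h2, h3⟩ := hθ.left1 k hk
      refine ⟨?_, by rw [h2, (hG k hk).2.1], by rw [h3, (hG k hk).2.2.1], Iff.rfl⟩
      rw [h1]
      constructor
      · rintro ⟨h4, h5⟩
        have := (hG _ h4).1.1 h5
        omega
      · intro h4
        have h5 : k + 1 < m := by omega
        exact ⟨h5, (hG _ h5).1.2 (by omega)⟩
  have h2 : ∀ p < m, ∃ G, ∃ C ∈ D, IsRow φ p (m - 1) [] G C := by
    intro p hp
    obtain ⟨C, hC, G, hG⟩ := h1 (m - 1 - p) (by omega)
    rw [show m - 1 - (m - 1 - p) = p by omega] at hG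
    exact ⟨G, C, hC, hG⟩
  choose! G hG using h2
  refine ⟨G, fun p hp => ?_⟩
  have h3 : ∀ j < m, ∃ C ∈ D, IsRow φ p (m - 1 - j) [] (G p) C := by
    intro j
    induction j with
    | zero => intro _; exact hG p hp
    | succ j ih =>
      intro hj
      obtain ⟨C, hC, hR⟩ := ih (by omega)
      obtain ⟨V, -, rfl, hV, θ, hθ⟩ := hD C hC C hC
      refine ⟨_, hV .left2, fun k hk => ?_⟩
      obtain ⟨h1, h2, h3, h4⟩ := hθ.left2 k hk
      refine ⟨by rw [h1, (hR k hk).1], ?_, by rw [h3, (hR k hk).2.2.1],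
        by rw [h4, (hR k hk).2.2.2]⟩
      rw [h2]
      constructor
      · rintro ⟨h4, h5⟩
        have := (hR _ h4).2.1.1 h5
        omega
      · intro h4
        have h5 : k + 1 < m := by omega
        exact ⟨h5, (hR _ h5).2.1.2 (by omega)⟩
  intro p' hp' a
  induction a with
  | nil =>
    obtain ⟨C, hC, hR⟩ := h3 (m - 1 - p') (by omega)
    rw [show m - 1 - (m - 1 - p') = p' by omega] at hR
    exact ⟨C, hC, hR⟩
  | cons b a ih =>
    obtain ⟨C, hC, hR⟩ := ih
    obtain ⟨V, -, rfl, hV, θ, hθ⟩ := hD C hC C hC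
    refine ⟨_, hV (.bit b), fun k hk => ?_⟩
    obtain ⟨h1, h2, h3, h4⟩ := hθ.bit k hk b
    refine ⟨by rw [h1, (hR k hk).1], by rw [h2, (hR k hk).2.1], ?_, by rw [h4, (hR k hk).2.2.2]⟩
    rw [h3, Formula.nameAt_cons hk]
    refine and_congr_right fun _ => and_congr_right fun h5 => (hR _ h5).2.2.1

/-- The conditions on a set of blocks that result from the test. -/
structure Sound (L : Log) (φ : Formula n) (D : Set (ℕ → Cell n)) (G : ℕ → ℕ → Prop) : Prop where
  loc : ∀ B ∈ D, LocF φ B 0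
  root : ∃ B ∈ D, (B 0).act ∧ (B 0).mark
  eps : ∀ B ∈ D, ∀ k < φ.encode.length, (B k).eps = (B 0).eps
  name : ∀ B ∈ D, ∀ a, ∃ v : Prop, ∀ k < φ.encode.length, φ.letter k = .cName →
    φ.NameAt a (k + 1) → (B k).act → ((B k).mark ↔ v)
  boxM : L = .M → ∀ B ∈ D, ∀ k < φ.encode.length, ∀ i s, (φ.letter k).box = some (i, s) →
    (B k).act → ¬ (B k).mark → ¬ (B k).eps i
  key : ∀ B ∈ D, ∀ C ∈ D, (∀ k < φ.encode.length, (B k).id = (C k).id) →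
    ∀ k < φ.encode.length, (B k).eps = (C k).eps ∧ (B k).tgt = (C k).tgt ∧
      ((φ.letter k).IsF → (B k).act → (C k).act → ((B k).mark ↔ (C k).mark))
  wit : ∀ B ∈ D, ∀ p < φ.encode.length, ∀ p' < φ.encode.length, ∀ a j,
    Trig L (φ.profile B (G p) (φ.NameAt a) p) (φ.profile B (G p) (φ.NameAt a) p') j →
      ∃ W ∈ D, ∀ k < φ.encode.length,
        WitOK L (φ.profile B (G p) (φ.NameAt a) k) (k = p) (k = p') (W k) j

/-- For fixed `main`, all blocks of `IsRow` are used as `uni`. -/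
theorem Closed.exists_sound {L : Log} {φ : Formula n} {D : Set (ℕ → Cell n)}
    (hD : Closed L φ D) (hne : D.Nonempty) : ∃ G, Sound L φ D G := by
  obtain ⟨G, hG⟩ := hD.exists_isRow hne
  have hm := φ.length_pos
  have hdiag : ∀ B ∈ D, ∃ V : Head n → ℕ → Cell n, V .main = B ∧ (∀ h, V h ∈ D) ∧
      ∃ θ, Tested L φ V θ := by
    intro B hB
    obtain ⟨V, h1, -, h2, h3⟩ := hD B hB B hB
    exact ⟨V, h1, h2, h3⟩
  refine ⟨G, fun B hB => ?_, ?_, fun B hB k hk => ?_, fun B hB a => ?_, fun hL B hB => ?_,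
    fun B hB C hC hid => ?_, fun B hB p hp p' hp' a j hj => ?_⟩
  · obtain ⟨V, rfl, -, θ, hθ⟩ := hdiag B hB
    exact hθ.loc
  · obtain ⟨B, hB⟩ := hne
    obtain ⟨V, -, hV, θ, hθ⟩ := hdiag B hB
    exact ⟨_, hV .root, hθ.root⟩
  · obtain ⟨V, rfl, -, θ, hθ⟩ := hdiag B hB
    rw [hθ.eps k hk, hθ.eps 0 hm]
  · obtain ⟨C, hC, hR⟩ := hG 0 hm 0 hm a
    obtain ⟨V, rfl, rfl, -, θ, hθ⟩ := hD B hB C hC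
    exact ⟨θ.name, fun k hk h1 h2 h3 => hθ.name k hk h1 ⟨h2.lt, (hR _ h2.lt).2.2.1.2 h2⟩ h3⟩
  · obtain ⟨V, rfl, -, θ, hθ⟩ := hdiag B hB
    exact hθ.boxM hL
  · obtain ⟨V, rfl, rfl, -, θ, hθ⟩ := hD B hB C hC
    refine hθ.key fun hd => ?_
    obtain ⟨k, hk, h⟩ := hθ.differ hd
    exact h (hid k hk)
  · obtain ⟨C, hC, hR⟩ := hG p hp p' hp' a
    obtain ⟨V, rfl, rfl, hV, θ, hθ⟩ := hD B hB C hC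
    have hprof : ∀ k < φ.encode.length,
        φ.profile (V .main) (fun k => (V .uni k).gt) (fun k => (V .uni k).nm) k =
          φ.profile (V .main) (G p) (φ.NameAt a) k := by
      intro k hk
      have h1 : (V .uni k).gt = G p k := propext (hR k hk).2.2.2
      have h2 : (k + 1 < φ.encode.length ∧ (V .uni (k + 1)).nm) =
          (k + 1 < φ.encode.length ∧ φ.NameAt a (k + 1)) :=
        propext (and_congr_right fun h => (hR _ h).2.2.1)
      simp only [Formula.profile, h1, h2]
    have h1 := hθ.fst p hp ((hR p hp).1.2 rfl)
    have h2 := hθ.snd p' hp' ((hR p' hp').2.1.2 rfl)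
    rw [hprof p hp] at h1
    rw [hprof p' hp'] at h2
    refine ⟨_, hV (.wit j), fun k hk => ?_⟩
    have h3 := hθ.wit k hk j (by rwa [h1, h2])
    rwa [hprof k hk, propext (hR k hk).1, propext (hR k hk).2.1] at h3

/-- The blocks in `D` that can describe an object at a world of modal depth `l`. -/
def Level (φ : Formula n) (D : Set (ℕ → Cell n)) : ℕ → Set (ℕ → Cell n)
  | 0 => {B | B ∈ D ∧ (B 0).act}
  | l + 1 => {B | B ∈ D ∧ ∃ B' ∈ Level φ D l, ∀ k < φ.encode.length, (B' k).nxt → (B k).act}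

section level

variable {L : Log} {φ : Formula n} {D : Set (ℕ → Cell n)} {G : ℕ → ℕ → Prop} {B W : ℕ → Cell n}
  {l : ℕ}

theorem Level.mem (h : B ∈ Level φ D l) : B ∈ D := by
  cases l <;> exact h.1

theorem Level.next (h : B ∈ Level φ D l) (hW : W ∈ D)
    (hBW : ∀ k < φ.encode.length, (B k).nxt → (W k).act) : W ∈ Level φ D (l + 1) :=
  ⟨hW, B, h, hBW⟩

theorem Level.same (h : B ∈ Level φ D l) (hW : W ∈ D)
    (hBW : ∀ k < φ.encode.length, (B k).act → (W k).act) : W ∈ Level φ D l := by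
  cases l with
  | zero => exact ⟨hW, hBW 0 φ.length_pos h.2⟩
  | succ l =>
    obtain ⟨-, B', h1, h2⟩ := h
    exact ⟨hW, B', h1, fun k hk h => hBW k hk (h2 k hk h)⟩

/-- The blocks at level `l` are active at the positions of modal depth `l`. -/
theorem Sound.act (hS : Sound L φ D G) (h : B ∈ Level φ D l) {e : Node n} {p : ℕ}
    (hp : Occ φ e p l) : (B p).act := by
  induction l generalizing B e p with
  | zero => exact hp.act_of_root (hS.loc B h.1) h.2
  | succ l ih =>
    obtain ⟨-, B', h1, h2⟩ := h
    exact h2 p hp.lt_length (hp.nxt_of_act (hS.loc B' (Level.mem h1)) fun e p hp => ih h1 hp)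

theorem Sound.act_box (hS : Sound L φ D G) (h : B ∈ Level φ D l) {i : Fin n} {s : Bool} {p : ℕ}
    (hp : OccBox φ i s p l) : (B p).act := by
  obtain ⟨e, he⟩ := hp.exists_occ
  exact hS.act h he

theorem Sound.box (hS : Sound L φ D G) (h : B ∈ Level φ D l) {i : Fin n} {s : Bool} {p : ℕ}
    (hp : OccBox φ i s p l) (G N : ℕ → Prop) : (φ.profile B G N p).Box i s :=
  ⟨hp.letter, hS.act_box h hp⟩

/-- A set of blocks as in `Sound` gives a quasimodel. -/
def Sound.quasi (hS : Sound L φ D G) :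
    Quasi L φ (Fin φ.encode.length → Prop × Option (Fin n)) where
  T := {t : ℕ × (ℕ → Cell n) // t.2 ∈ Level φ D t.1}
  mark B p := (B.1.2 p).mark
  lev B := B.1.1
  id B k := (B.1.2 k).id
  tgt B i k := (B.1.2 k).tgt i
  eps B i := (B.1.2 0).eps i
  imp := G
  root := by
    obtain ⟨B, h1, h2, h3⟩ := hS.root
    exact ⟨⟨(0, B), h1, h2⟩, rfl, h3⟩
  name := by
    rintro ⟨⟨l, B⟩, hB⟩ A p p' h h'
    obtain ⟨v, hv⟩ := hS.name B (Level.mem hB) A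
    exact (hv p h.lt_length h.letter_name.1 h.letter_name.2 (hS.act hB h)).trans
      (hv p' h'.lt_length h'.letter_name.1 h'.letter_name.2 (hS.act hB h')).symm
  neg B C p d h := (h.locN (hS.loc _ (Level.mem B.2))).1
  inter B C D p d h := (h.locN (hS.loc _ (Level.mem B.2))).1
  fneg B ψ p d h := (h.locN (hS.loc _ (Level.mem B.2))).1
  fand B ψ χ p d h := (h.locN (hS.loc _ (Level.mem B.2))).1
  incl B C D p d h h1 h2 := by
    have h3 := h.locN (hS.loc _ (Level.mem B.2))
    by_contra h4
    exact h3.2.1 h1 (h3.1.2 ⟨h2, h4⟩)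
  not_incl := by
    rintro ⟨⟨l, B⟩, hB⟩ C D' p h hm
    obtain ⟨W, hW, hok⟩ := hS.wit B (Level.mem hB) p h.lt_length p h.lt_length [] .incl
      ⟨h.letter_incl, hS.act hB h, hm⟩
    have h1 := (h.locN (hS.loc _ hW)).1.1 ((hok p h.lt_length).2.2 rfl)
    exact ⟨⟨(l, W), Level.same hB hW fun k hk => (hok k hk).2.1⟩,
      funext fun k => (hok k k.2).1, rfl, h1⟩
  ex := by
    rintro ⟨⟨l, B⟩, hB⟩ r C p h hm
    obtain ⟨W, hW, hok⟩ := hS.wit B (Level.mem hB) p h.lt_length p h.lt_length r .ex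
      ⟨h.letter_ex.1, ⟨h.letter_ex.2.lt, h.letter_ex.2⟩, hS.act hB h, hm⟩
    refine ⟨⟨(l, W), Level.same hB hW fun k hk => (hok k hk).2.1⟩,
      funext fun k => (hok k k.2).1, rfl,
      (h.locN (hS.loc _ hW)).1.1 ((hok p h.lt_length).2.2.1 rfl), ?_⟩
    intro C' p' h' hm'
    exact (hok p' h'.lt_length).2.2.2 h'.letter_ex.1 ⟨h'.letter_ex.2.lt, h'.letter_ex.2⟩
      (hS.act hB h') ((h'.locN (hS.loc _ hW)).1.2 hm')
  key_mark := by
    rintro ⟨⟨l, B⟩, hB⟩ ⟨⟨l', B'⟩, hB'⟩ h ψ p hp hp'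
    exact (hS.key B (Level.mem hB) B' (Level.mem hB') (fun k hk => congrFun h ⟨k, hk⟩) p
      hp.lt_length).2.2 hp.letter_isF (hS.act hB hp) (hS.act hB' hp')
  key_eps := by
    rintro ⟨⟨l, B⟩, hB⟩ ⟨⟨l', B'⟩, hB'⟩ h i
    exact iff_of_eq (congrFun (hS.key B (Level.mem hB) B' (Level.mem hB')
      (fun k hk => congrFun h ⟨k, hk⟩) 0 φ.length_pos).1 i)
  key_tgt := by
    rintro ⟨⟨l, B⟩, hB⟩ ⟨⟨l', B'⟩, hB'⟩ h i
    exact funext fun k => congrFun (hS.key B (Level.mem hB) B' (Level.mem hB')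
      (fun k hk => congrFun h ⟨k, hk⟩) k k.2).2.1 i
  box_EN hL := by
    rintro ⟨⟨l, B⟩, hB⟩ i s p hp
    by_contra hcon
    obtain ⟨h1, h2⟩ := not_or.1 hcon
    obtain ⟨W, hW, hok⟩ := hS.wit B (Level.mem hB) p hp.pos_lt p hp.pos_lt [] (.nonempty i s)
      ⟨hS.box hB hp _ _, by
        have : ¬ ((B p).mark ↔ (B p).eps i) := by
          rw [hS.eps B (Level.mem hB) p hp.pos_lt]; exact h1
        rcases hL with rfl | rfl <;> exact this⟩
    exact h2 ⟨⟨(l + 1, W), Level.next hB hW fun k hk => (hok k hk).1⟩, rfl,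
      (hp.ch_iff (hS.loc W hW)).1 ((hok p hp.pos_lt).2 rfl)⟩
  box_M hL := by
    rintro ⟨⟨l, B⟩, hB⟩ i s p hp hm
    by_contra! hcon
    obtain ⟨h1, h2⟩ := hcon
    obtain ⟨W, hW, hok⟩ := hS.wit B (Level.mem hB) p hp.pos_lt p hp.pos_lt [] (.nonempty i s)
      ⟨hS.box hB hp _ _, by
        have : (B p).mark ∧ ¬ (B p).eps i := by
          rw [hS.eps B (Level.mem hB) p hp.pos_lt]; exact ⟨hm, h1⟩
        subst hL; exact this⟩
    exact h2 ⟨(l + 1, W), Level.next hB hW fun k hk => (hok k hk).1⟩ rfl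
      ((hp.ch_iff (hS.loc W hW)).1 ((hok p hp.pos_lt).2 rfl))
  not_box_M hL := by
    rintro ⟨⟨l, B⟩, hB⟩ i s p hp hm
    have := hS.boxM hL B (Level.mem hB) p hp.pos_lt i s hp.letter (hS.act_box hB hp) hm
    rwa [hS.eps B (Level.mem hB) p hp.pos_lt] at this
  not_box_C hL := by
    rintro ⟨⟨l, B⟩, hB⟩ i s p hp hm he
    obtain ⟨W, hW, hok⟩ := hS.wit B (Level.mem hB) p hp.pos_lt p hp.pos_lt [] (.nonempty i s)
      ⟨hS.box hB hp _ _, by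
        have : ¬ (B p).mark ∧ (B p).eps i := by
          rw [hS.eps B (Level.mem hB) p hp.pos_lt]; exact ⟨hm, he⟩
        subst hL; exact this⟩
    exact ⟨⟨(l + 1, W), Level.next hB hW fun k hk => (hok k hk).1⟩, rfl,
      (hp.ch_iff (hS.loc W hW)).1 ((hok p hp.pos_lt).2 rfl)⟩
  joint hL := by
    rintro ⟨⟨l, B⟩, hB⟩ i s p hp he
    obtain ⟨W, hW, hok⟩ := hS.wit B (Level.mem hB) p hp.pos_lt p hp.pos_lt [] (.joint i)
      ⟨hL, ⟨s, hS.box hB hp _ _⟩, by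
        have := hS.eps B (Level.mem hB) p hp.pos_lt
        change ¬ (B p).eps i
        rw [this]; exact he⟩
    refine ⟨⟨(l + 1, W), Level.next hB hW fun k hk => (hok k hk).1⟩, rfl,
      funext fun k => (hok k k.2).2.1, fun s' p' hp' hm => ?_⟩
    exact (hp'.ch_iff (hS.loc W hW)).1 ((hok p' hp'.pos_lt).2.2 ⟨s', hS.box hB hp' _ _⟩ hm)
  unit hL := by
    rintro ⟨⟨l, B⟩, hB⟩ i s p hp hm
    obtain ⟨W, hW, hok⟩ := hS.wit B (Level.mem hB) p hp.pos_lt p hp.pos_lt [] (.unit i s)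
      ⟨hL, hS.box hB hp _ _, hm⟩
    exact ⟨⟨(l + 1, W), Level.next hB hW fun k hk => (hok k hk).1⟩, rfl,
      fun hs h => (hok p hp.pos_lt).2 rfl hs ((hp.ch_iff (hS.loc W hW)).2 h)⟩
  imp_or hL := by
    rintro ⟨⟨l, B⟩, hB⟩ i s p s' p' hp hp' hs hs' hi
    obtain ⟨W, hW, hok⟩ := hS.wit B (Level.mem hB) p hp.pos_lt p' hp'.pos_lt [] (.imp i s s')
      ⟨hL, hS.box hB hp _ _, hS.box hB hp' _ _, hs, hs', hi⟩
    exact ⟨⟨(l + 1, W), Level.next hB hW fun k hk => (hok k hk).1⟩, rfl,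
      (hp.ch_iff (hS.loc W hW)).1 ((hok p hp.pos_lt).2.1 rfl),
      fun h => (hok p' hp'.pos_lt).2.2 rfl ((hp'.ch_iff (hS.loc W hW)).2 h)⟩
  sep_EN hL := by
    rintro ⟨⟨l, B⟩, hB⟩ i s p p' hp hp' hm hm' hi
    obtain ⟨W, hW, hok⟩ := hS.wit B (Level.mem hB) p hp.pos_lt p' hp'.pos_lt [] (.sep i s s)
      ⟨hS.box hB hp _ _, hS.box hB hp' _ _, hm, hm', fun _ h => h, fun _ => ⟨rfl, hi⟩⟩
    exact ⟨⟨(l + 1, W), Level.next hB hW fun k hk => (hok k hk).1⟩, rfl,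
      (hp'.ch_iff (hS.loc W hW)).1 ((hok p' hp'.pos_lt).2.2.1 rfl),
      fun h => (hok p hp.pos_lt).2.1 rfl ((hp.ch_iff (hS.loc W hW)).2 h)⟩
  sep_M hL := by
    rintro ⟨⟨l, B⟩, hB⟩ i s p s' p' hp hp' hm hm' hs
    obtain ⟨W, hW, hok⟩ := hS.wit B (Level.mem hB) p hp.pos_lt p' hp'.pos_lt [] (.sep i s s')
      ⟨hS.box hB hp _ _, hS.box hB hp' _ _, hm, hm', fun _ => hs, fun h => (h hL).elim⟩
    exact ⟨⟨(l + 1, W), Level.next hB hW fun k hk => (hok k hk).1⟩, rfl,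
      (hp'.ch_iff (hS.loc W hW)).1 ((hok p' hp'.pos_lt).2.2.1 rfl),
      fun h => (hok p hp.pos_lt).2.1 rfl ((hp.ch_iff (hS.loc W hW)).2 h)⟩
  sep_C hL := by
    rintro ⟨⟨l, B⟩, hB⟩ i s p p' hp hp' hm hm' hi
    obtain ⟨W, hW, hok⟩ := hS.wit B (Level.mem hB) p hp.pos_lt p' hp'.pos_lt [] (.sep i s s)
      ⟨hS.box hB hp _ _, hS.box hB hp' _ _, hm, hm', fun _ h => h, fun _ => ⟨rfl, hi⟩⟩
    refine ⟨⟨(l + 1, W), Level.next hB hW fun k hk => (hok k hk).1⟩, rfl,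
      fun h => (hok p hp.pos_lt).2.1 rfl ((hp.ch_iff (hS.loc W hW)).2 h), ?_⟩
    intro s' k hk hmk hik hs
    exact (hk.ch_iff (hS.loc W hW)).1 ((hok k hk.pos_lt).2.2.2 hL s' (hS.box hB hk _ _) hmk hik hs)

end level

end MLALC

/-! ### From a quasimodel to blocks -/

namespace MLALC

variable {n : ℕ}

theorem OccBox.of_letter {φ : Formula n} {e : Node n} {i : Fin n} {s : Bool} {p d : ℕ}
    (h : Occ φ e p d) (hp : (φ.letter p).box = some (i, s)) : OccBox φ i s p d := by
  rcases e with (_ | _ | _ | _ | _) | (_ | _ | _ | _) <;>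
    rw [Formula.letter_eq (prefix_drop_cons h.prefix).1] at hp <;> cases hp <;> exact ⟨_, h⟩

theorem Occ.formula_of_letter {φ : Formula n} {e : Node n} {p d : ℕ}
    (h : Occ φ e p d) (hp : (φ.letter p).IsF) : ∃ ψ, e = .f ψ := by
  rcases e with (_ | _ | _ | _ | _) | (_ | _ | _ | _) <;>
    rw [Formula.letter_eq (prefix_drop_cons h.prefix).1] at hp
  all_goals first | exact hp.elim | exact ⟨_, rfl⟩

theorem Occ.incl_of_letter {φ : Formula n} {e : Node n} {p d : ℕ}
    (h : Occ φ e p d) (hp : φ.letter p = .fIncl) : ∃ C D, e = .f (.incl C D) := by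
  rcases e with (_ | _ | _ | _ | _) | (_ | _ | _ | _) <;>
    rw [Formula.letter_eq (prefix_drop_cons h.prefix).1] at hp <;> cases hp
  exact ⟨_, _, rfl⟩

theorem Formula.NameAt.unique {φ : Formula n} {a a' : List Bool} {k : ℕ} (h : φ.NameAt a k)
    (h' : φ.NameAt a' k) : a = a' := by
  obtain ⟨s, hs⟩ := h
  obtain ⟨s', hs'⟩ := h'
  exact (encodeName_inj (hs.trans hs'.symm)).1

theorem Occ.name_of_letter {φ : Formula n} {e : Node n} {a : List Bool} {p d : ℕ}
    (h : Occ φ e p d) (hp : φ.letter p = .cName) (ha : φ.NameAt a (p + 1)) :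
    e = .c (.name a) := by
  have h0 := hp
  rcases e with (_ | _ | _ | _ | _) | (_ | _ | _ | _) <;>
    rw [Formula.letter_eq (prefix_drop_cons h.prefix).1] at h0 <;> cases h0
  rw [h.letter_name.2.unique ha]

theorem Occ.ex_of_letter {φ : Formula n} {e : Node n} {a : List Bool} {p d : ℕ}
    (h : Occ φ e p d) (hp : φ.letter p = .cEx) (ha : φ.NameAt a (p + 1)) :
    ∃ C, e = .c (.ex a C) := by
  have h0 := hp
  rcases e with (_ | _ | _ | _ | _) | (_ | _ | _ | _) <;>
    rw [Formula.letter_eq (prefix_drop_cons h.prefix).1] at h0 <;> cases h0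
  rw [h.letter_ex.2.unique ha]
  exact ⟨_, rfl⟩

/-- The value of the track `ch` for the marks `m`. -/
def ChildMark (φ : Formula n) (m : ℕ → Prop) (k : ℕ) : Prop :=
  (∃ i s d, OccBox φ i s k d ∧ m (k + 1)) ∨
    (∃ r C d, Occ φ (.c (.ex r C)) k d ∧ m (k + 2 + r.length)) ∨
    ∃ C D d, Occ φ (.f (.incl C D)) k d ∧ m (k + 1) ∧ ¬ m (k + 1 + C.encode.length)

theorem OccBox.childMark_iff {φ : Formula n} {m : ℕ → Prop} {i : Fin n} {s : Bool} {p d : ℕ}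
    (h : OccBox φ i s p d) : ChildMark φ m p ↔ m (p + 1) := by
  refine ⟨?_, fun hm => .inl ⟨i, s, d, h, hm⟩⟩
  rintro (⟨_, _, _, _, h'⟩ | ⟨_, _, _, h', _⟩ | ⟨_, _, _, h', _⟩)
  · exact h'
  all_goals
    cases s <;> obtain ⟨_, h⟩ := h <;> cases h.unique h'

theorem Occ.childMark_ex_iff {φ : Formula n} {m : ℕ → Prop} {r : RoleName} {C : Concept n} {p d : ℕ}
    (h : Occ φ (.c (.ex r C)) p d) : ChildMark φ m p ↔ m (p + 2 + r.length) := by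
  refine ⟨?_, fun hm => .inr (.inl ⟨r, C, d, h, hm⟩)⟩
  rintro (⟨_, s, _, h', _⟩ | ⟨_, _, _, h', hm⟩ | ⟨_, _, _, h', _⟩)
  · cases s <;> obtain ⟨_, h'⟩ := h' <;> cases h.unique h'
  · cases h.unique h'
    exact hm
  · cases h.unique h'

theorem Occ.childMark_incl_iff {φ : Formula n} {m : ℕ → Prop} {C D : Concept n} {p d : ℕ}
    (h : Occ φ (.f (.incl C D)) p d) :
    ChildMark φ m p ↔ m (p + 1) ∧ ¬ m (p + 1 + C.encode.length) := by
  refine ⟨?_, fun hm => .inr (.inr ⟨C, D, d, h, hm⟩)⟩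
  rintro (⟨_, s, _, h', _⟩ | ⟨_, _, _, h', _⟩ | ⟨_, _, _, h', hm⟩)
  · cases s <;> obtain ⟨_, h'⟩ := h' <;> cases h.unique h'
  · cases h.unique h'
  · cases h.unique h'
    exact hm

namespace Quasi

variable {L : Log} {φ : Formula n} (Q : Quasi L φ (ℕ → Prop × Option (Fin n)))

/-- The block of the type `t` which supplies the positions `p` and `p'` and the name `a`. -/
def block (t : Q.T) (p p' : ℕ) (a : List Bool) (k : ℕ) : Cell n where
  mark := Q.mark t k
  ch := ChildMark φ (Q.mark t) k
  act := ∃ e, Occ φ e k (Q.lev t)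
  nxt := ∃ e, Occ φ e k (Q.lev t + 1)
  eps := Q.eps t
  id := Q.id t k
  tgt i := Q.tgt t i k
  P1 := k = p
  P2 := k = p'
  gt := Q.imp p k
  nm := φ.NameAt a k

variable {Q} {t : Q.T} {p p' : ℕ} {a : List Bool}

theorem down_block {e : Node n} {k k' d : ℕ} (h : Occ φ e k d)
    (hk : ∀ d, Occ φ e k d → ∃ e', Occ φ e' k' d) :
    Down (Q.block t p p' a k) (Q.block t p p' a k') := by
  constructor <;> rintro ⟨e', he'⟩ <;> rw [← h.unique he'] at he' <;> exact hk _ he'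

theorem locC_block {C : Concept n} {k d : ℕ} (h : Occ φ (.c C) k d) :
    LocC C (Q.block t p p' a) k := by
  induction C generalizing k d with
  | name A => trivial
  | neg C ih => exact ⟨Q.neg t C k d h, down_block h fun _ h => ⟨_, h.neg⟩, ih h.neg⟩
  | inter C D ih ih' =>
    exact ⟨Q.inter t C D k d h, down_block h fun _ h => ⟨_, h.inter_left⟩,
      down_block h fun _ h => ⟨_, h.inter_right⟩, ih h.inter_left, ih' h.inter_right⟩
  | ex r C ih => exact ⟨h.childMark_ex_iff, down_block h fun _ h => ⟨_, h.ex⟩, ih h.ex⟩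
  | box i C ih =>
    refine ⟨OccBox.childMark_iff (s := false) ⟨C, h⟩, ?_, ih h.box⟩
    rintro ⟨e, he⟩
    rw [← h.unique he] at he
    exact ⟨_, he.box⟩

theorem locF_block {ψ : Formula n} {k d : ℕ} (h : Occ φ (.f ψ) k d) :
    LocF ψ (Q.block t p p' a) k := by
  induction ψ generalizing k d with
  | incl C D =>
    refine ⟨h.childMark_incl_iff, fun hm hc => ?_, down_block h fun _ h => ⟨_, h.incl_left⟩,
      down_block h fun _ h => ⟨_, h.incl_right⟩, locC_block h.incl_left, locC_block h.incl_right⟩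
    have hc := h.childMark_incl_iff.1 hc
    exact hc.2 (Q.incl t C D k d h hm hc.1)
  | neg ψ ih => exact ⟨Q.fneg t ψ k d h, down_block h fun _ h => ⟨_, h.fneg⟩, ih h.fneg⟩
  | and ψ χ ih ih' =>
    exact ⟨Q.fand t ψ χ k d h, down_block h fun _ h => ⟨_, h.and_left⟩,
      down_block h fun _ h => ⟨_, h.and_right⟩, ih h.and_left, ih' h.and_right⟩
  | box i ψ ih =>
    refine ⟨OccBox.childMark_iff (s := true) ⟨ψ, h⟩, ?_, ih h.fbox⟩
    rintro ⟨e, he⟩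
    rw [← h.unique he] at he
    exact ⟨_, he.fbox⟩

theorem occBox_of_box {G N : ℕ → Prop} {k : ℕ} {i : Fin n} {s : Bool} {q q' : ℕ}
    (h : (φ.profile (Q.block t q q' a) G N k).Box i s) : OccBox φ i s k (Q.lev t) := by
  obtain ⟨h1, e, h2⟩ := h
  exact .of_letter h2 h1

/-- The types that are required exist. -/
theorem exists_witOK (t : Q.T) (p p' q q' : ℕ) (a c : List Bool) (j : Wit n)
    (hj : Trig L (φ.profile (Q.block t q q' c) (Q.imp p) (φ.NameAt a) p)
      (φ.profile (Q.block t q q' c) (Q.imp p) (φ.NameAt a) p') j) :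
    ∃ W : Q.T, ∀ k, WitOK L (φ.profile (Q.block t q q' c) (Q.imp p) (φ.NameAt a) k)
      (k = p) (k = p') (Q.block W 0 0 [] k) j := by
  have nxt : ∀ {W : Q.T}, Q.lev W = Q.lev t + 1 → ∀ k, (Q.block t q q' c k).nxt →
      (Q.block W 0 0 [] k).act := by
    intro W hW k h
    change ∃ e, Occ φ e k (Q.lev W)
    rw [hW]; exact h
  have act : ∀ {W : Q.T}, Q.lev W = Q.lev t → ∀ k, (Q.block t q q' c k).act →
      (Q.block W 0 0 [] k).act := by
    intro W hW k h
    change ∃ e, Occ φ e k (Q.lev W)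
    rw [hW]; exact h
  have ch : ∀ {i s k} {W : Q.T}, OccBox φ i s k (Q.lev t) →
      ((Q.block W 0 0 [] k).ch ↔ Q.mark W (k + 1)) := fun h => h.childMark_iff
  cases j with
  | ex =>
    obtain ⟨h1, ⟨-, h2⟩, ⟨e, he⟩, hm⟩ := hj
    obtain ⟨C, rfl⟩ := he.ex_of_letter h1 h2
    obtain ⟨W, h3, h4, h5, h6⟩ := Q.ex t a C p he hm
    refine ⟨W, fun k => ⟨congrFun h3 k, act h4 k, ?_, ?_⟩⟩
    · rintro rfl
      exact he.childMark_ex_iff.2 h5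
    · rintro i1 ⟨-, i2⟩ ⟨e, he⟩ hc
      obtain ⟨C', rfl⟩ := he.ex_of_letter i1 i2
      exact h6 C' k he (he.childMark_ex_iff.1 hc)
  | incl =>
    obtain ⟨h1, ⟨e, he⟩, hm⟩ := hj
    obtain ⟨C, D, rfl⟩ := he.incl_of_letter h1
    obtain ⟨W, h3, h4, h5⟩ := Q.not_incl t C D p he hm
    refine ⟨W, fun k => ⟨congrFun h3 k, act h4 k, ?_⟩⟩
    rintro rfl
    exact he.childMark_incl_iff.2 h5
  | nonempty i s =>
    obtain ⟨h1, h2⟩ := hj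
    have hp := occBox_of_box h1
    obtain ⟨W, h3, h4⟩ : ∃ W, Q.lev W = Q.lev t + 1 ∧ Q.mark W (p + 1) := by
      cases L with
      | E => exact (Q.box_EN (.inl rfl) t i s p hp).resolve_left h2
      | N => exact (Q.box_EN (.inr rfl) t i s p hp).resolve_left h2
      | M => exact (Q.box_M rfl t i s p hp h2.1).resolve_left h2.2
      | C => exact Q.not_box_C rfl t i s p hp h2.1 h2.2
    refine ⟨W, fun k => ⟨nxt h3 k, ?_⟩⟩
    rintro rfl
    exact (ch hp).2 h4
  | joint i =>
    obtain ⟨hL, ⟨s, h1⟩, h2⟩ := hj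
    obtain ⟨W, h3, h4, h5⟩ := Q.joint hL t i s p (occBox_of_box h1) h2
    refine ⟨W, fun k => ⟨nxt h3 k, congrFun h4 k, ?_⟩⟩
    rintro ⟨s', h6⟩ hm
    exact (ch (occBox_of_box h6)).2 (h5 s' k (occBox_of_box h6) hm)
  | unit i s =>
    obtain ⟨hL, h1, h2⟩ := hj
    have hp := occBox_of_box h1
    obtain ⟨W, h3, h4⟩ := Q.unit hL t i s p hp h2
    refine ⟨W, fun k => ⟨nxt h3 k, ?_⟩⟩
    rintro rfl hs hc
    exact h4 hs ((ch hp).1 hc)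
  | imp i s s' =>
    obtain ⟨hL, h1, h2, h3, h4, h5⟩ := hj
    have hp := occBox_of_box h1
    have hp' := occBox_of_box h2
    obtain ⟨W, h6, h7, h8⟩ := Q.imp_or hL t i s p s' p' hp hp' h3 h4 h5
    refine ⟨W, fun k => ⟨nxt h6 k, ?_, ?_⟩⟩
    · rintro rfl
      exact (ch hp).2 h7
    · rintro rfl hc
      exact h8 ((ch hp').1 hc)
  | sep i s s' =>
    obtain ⟨h1, h2, hm, hm', h3, h4⟩ := hj
    have hp := occBox_of_box h1
    have hp' := occBox_of_box h2
    obtain ⟨W, h5, h6, h7, h8⟩ : ∃ W, Q.lev W = Q.lev t + 1 ∧ ¬ Q.mark W (p + 1) ∧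
        Q.mark W (p' + 1) ∧ (L = .C → ∀ s' k, OccBox φ i s' k (Q.lev t) → Q.mark t k →
          Q.imp p k → (s = true → s' = true) → Q.mark W (k + 1)) := by
      by_cases hM : L = .M
      · obtain ⟨W, h5, h6, h7⟩ := Q.sep_M hM t i s p s' p' hp hp' hm hm' (h3 hM)
        exact ⟨W, h5, h7, h6, fun hC => by rw [hM] at hC; cases hC⟩
      · obtain ⟨rfl, hi⟩ := h4 hM
        by_cases hC : L = .C
        · obtain ⟨W, h5, h6, h7⟩ := Q.sep_C hC t i s p p' hp hp' hm hm' hi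
          exact ⟨W, h5, h6, h7 s p' hp' hm' hi fun h => h, fun _ => h7⟩
        · obtain ⟨W, h5, h6, h7⟩ := Q.sep_EN (by cases L <;> simp_all) t i s p p' hp hp' hm hm' hi
          exact ⟨W, h5, h7, h6, fun h => (hC h).elim⟩
    refine ⟨W, fun k => ⟨nxt h5 k, ?_, ?_, fun hC r hr hmk hi hs => ?_⟩⟩
    · rintro rfl hc
      exact h6 ((ch hp).1 hc)
    · rintro rfl
      exact (ch hp').2 h7
    · exact (ch (occBox_of_box hr)).2 (h8 hC r k (occBox_of_box hr) hmk hi hs)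

/-- The blocks of the types of a quasimodel pass the test. -/
theorem closed_range (hQ : ∀ B B', (∀ k < φ.encode.length, Q.id B k = Q.id B' k) →
    Q.id B = Q.id B') :
    Closed L φ {B | ∃ t p p' a, Q.block t p p' a = B} := by
  rintro _ ⟨t, q, q', c, rfl⟩ _ ⟨t', p, p', a, rfl⟩
  obtain ⟨t₀, h0, h0'⟩ := Q.root
  have h1 : ∀ j : Wit n, ∃ W : Q.T,
      Trig L (φ.profile (Q.block t q q' c) (Q.imp p) (φ.NameAt a) p)
        (φ.profile (Q.block t q q' c) (Q.imp p) (φ.NameAt a) p') j →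
      ∀ k, WitOK L (φ.profile (Q.block t q q' c) (Q.imp p) (φ.NameAt a) k)
        (k = p) (k = p') (Q.block W 0 0 [] k) j := by
    intro j
    by_cases hj : Trig L (φ.profile (Q.block t q q' c) (Q.imp p) (φ.NameAt a) p)
        (φ.profile (Q.block t q q' c) (Q.imp p) (φ.NameAt a) p') j
    · obtain ⟨W, hW⟩ := exists_witOK t p p' q q' a c j hj
      exact ⟨W, fun _ => hW⟩
    · exact ⟨t, fun h => (hj h).elim⟩
  choose W hW using h1
  have hm := φ.length_pos
  set m := φ.encode.length with hm'
  -- the position to the left, if any; the value `m` stands for no position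
  let pred : ℕ → ℕ := fun p => if 0 < p ∧ p < m then p - 1 else m
  have hpred : ∀ p k, k < m → (k = pred p ↔ k + 1 < m ∧ k + 1 = p) := by
    intro p k hk
    simp only [pred]
    split_ifs <;> omega
  let V : Head n → ℕ → Cell n
    | .main => Q.block t q q' c
    | .uni => Q.block t' p p' a
    | .root => Q.block t₀ 0 0 []
    | .last => Q.block t (m - 1) (m - 1) []
    | .left1 => Q.block t' (pred p) p' a
    | .left2 => Q.block t' p (pred p') a
    | .bit b => Q.block t' p p' (b :: a)
    | .wit j => Q.block (W j) 0 0 []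
  refine ⟨V, rfl, rfl, fun h => by cases h <;> exact ⟨_, _, _, _, rfl⟩,
    ⟨φ.profile (Q.block t q q' c) (Q.imp p) (φ.NameAt a) p,
      φ.profile (Q.block t q q' c) (Q.imp p) (φ.NameAt a) p', Q.eps t,
      ∃ k, Occ φ (.c (.name a)) k (Q.lev t) ∧ Q.mark t k, Q.id t ≠ Q.id t'⟩, ?_⟩
  refine ⟨locF_block .root, ⟨?_, h0'⟩, fun hd => ?_, fun k _ hk => ?_, fun k _ hk => ?_,
    fun k _ => rfl, ?_, ?_, ?_, fun k hk => ⟨?_, ?_, ?_⟩,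
    fun k hk => ⟨hpred p k hk, Iff.rfl, Iff.rfl⟩,
    fun k hk => ⟨Iff.rfl, hpred p' k hk, Iff.rfl, Iff.rfl⟩,
    fun k hk b => ⟨Iff.rfl, Iff.rfl, Formula.nameAt_cons hk, Iff.rfl⟩, fun k _ j hj => hW j hj k⟩
  · refine ⟨.f φ, ?_⟩
    rw [h0]
    exact .root
  · by_contra! hcon
    exact hd (hQ t t' hcon)
  · obtain rfl : k = p := hk
    rfl
  · obtain rfl : k = p' := hk
    rfl
  · rintro k - h1 ⟨-, h2⟩ ⟨e, he⟩
    obtain rfl := he.name_of_letter h1 h2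
    refine ⟨fun h => ⟨k, he, h⟩, ?_⟩
    rintro ⟨k', he', h⟩
    exact (Q.name t a k' k he' he).1 h
  · rintro hL k - i s h1 ⟨e, he⟩ h2
    exact Q.not_box_M hL t i s k (.of_letter he h1) h2
  · intro hd k _
    have hd : Q.id t = Q.id t' := not_not.1 hd
    refine ⟨funext fun i => propext (Q.key_eps t t' hd i),
      funext fun i => congrFun (Q.key_tgt t t' hd i) k, ?_⟩
    rintro h1 ⟨e, he⟩ ⟨e', he'⟩
    obtain rfl := he.unique he'
    obtain ⟨ψ, rfl⟩ := he.formula_of_letter h1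
    exact Q.key_mark t t' hd ψ k he he'
  · change k = m - 1 ↔ _
    omega
  · change k = m - 1 ↔ _
    omega
  · exact Formula.nameAt_nil hk

end Quasi

/-- The certificates for the satisfiability of a formula. -/
theorem Formula.satisfiable_iff {L : Log} {φ : Formula n} :
    φ.Satisfiable L ↔ ∃ D : Set (ℕ → Cell n), D.Nonempty ∧ Closed L φ D := by
  constructor
  · intro h
    obtain ⟨Q, hQ⟩ := h.exists_quasi
    obtain ⟨t, -⟩ := Q.root
    exact ⟨{B | ∃ t p p' a, Q.block t p p' a = B}, ⟨Q.block t 0 0 [], t, 0, 0, [], rfl⟩,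
      Quasi.closed_range hQ⟩
  · rintro ⟨D, hne, hD⟩
    obtain ⟨G, hS⟩ := hD.exists_sound hne
    exact hS.quasi.satisfiable

end MLALC

/-! ### The complexity of satisfiability -/

theorem mainTheorem2 (L : MLALC.Log) (n : ℕ) :
    MLALC.satProblem L n ∈ NExpTime (MLALC.Letter n) := by
  refine NTM.mem_NExpTime_of_sweep (MLALC.testPDA L n) ?_ (main := MLALC.Head.main)
    (uni := MLALC.Head.uni) (by simp) fun x => ⟨?_, ?_⟩
  · rintro ⟨θ, s, c, q⟩ h1 h2
    obtain rfl : q = (false, none) := h1.2.2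
    obtain ⟨-, g, hg⟩ := h2
    cases hg
  · rintro ⟨φ, hφ, rfl⟩
    obtain ⟨D, hne, hD⟩ := MLALC.Formula.satisfiable_iff.1 hφ
    refine ⟨D, hne, fun B hB C hC => ?_⟩
    obtain ⟨V, h1, h2, h3, h4⟩ := hD B hB C hC
    exact ⟨V, h1, h2, h3, MLALC.accepts_testPDA_iff.2 h4⟩
  · rintro ⟨D, ⟨B, hB⟩, hD⟩
    -- any accepting run shows that the input is a code
    obtain ⟨φ, rfl⟩ : ∃ φ : MLALC.Formula n, φ.encode = x := by
      obtain ⟨V, -, -, -, h⟩ := hD B hB B hB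
      obtain ⟨φ, hφ, -⟩ := MLALC.accepts_locPDA_iff.1 (PDA.accepts_guess_iff.1 h).1
      exact ⟨φ, hφ⟩
    refine ⟨φ, MLALC.Formula.satisfiable_iff.2 ⟨D, ⟨B, hB⟩, fun B hB C hC => ?_⟩, rfl⟩
    obtain ⟨V, h1, h2, h3, h4⟩ := hD B hB C hC
    exact ⟨V, h1, h2, h3, MLALC.accepts_testPDA_iff.1 h4⟩
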